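/- Let $L=E(5,10)$ be the Lie superalgebra over $\mathbb C$ whose even part consists of the vector fields $X=\sum_{i=1}^5 f_i\partial_i$, $f_i\in\mathbb C[[x_1,\dots,x_5]]$, of zero divergence and whose odd part consists of the closed two-forms in $x_1,\dots,x_5$. The bracket of two vector fields is the commutator, the bracket of a vector field and a form is the Lie derivative, and $[f\,d_{ij},g\,d_{kl}]=\varepsilon_{ijkl}\,fg\,\partial_t$, where $d_{ij}=dx_i\wedge dx_j$ and, if $i,j,k,l$ are distinct, $t$ is the remaining index and $\varepsilon_{ijkl}$ is the sign of the permutation $(i,j,k,l,t)$, while $\varepsilon_{ijkl}=0$ otherwise. Grade $L$ by giving $f\partial_i$ degree $2k-2$ and $f\,d_{ij}$ degree $2k-1$ for $f$ homogeneous of degree $k$; then $L_0\cong\mathfrak{sl}_5$ via $x_i\partial_j\leftrightarrow E_{ij}$. Let $L_{\ge 0}$ (resp. $L_+$) be the subalgebra of elements all of whose homogeneous components have degree $\ge 0$ (resp. $>0$), and $L_-=L_{-2}\oplus L_{-1}$. For an $L_0$-module $V$ let $M(V)=U(L)\otimes_{U(L_{\ge 0})}V$, where $L_+$ acts trivially on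 $V$. A morphism $\varphi:M(V)\to M(W)$ is a $U(L)$-linear map; it has degree $d$ if there are finitely many $u_i\in U(L_-)$ of degree $d$ (products of $d$ elements of $L_{-1}$ span this component) and $\theta_i\in\mathrm{Hom}_{\mathbb C}(V,W)$ such that $\varphi(u\otimes v)=\sum_i uu_i\otimes\theta_i(v)$. For $a,b,c,d\in\mathbb N$ let $F(a,b,c,d)$ be the irreducible $\mathfrak{sl}_5$-module of highest weight $(a,b,c,d)$ in fundamental-weight coordinates, realized as the submodule of $\mathrm{Sym}^a(\mathbb C^5)\otimes\mathrm{Sym}^b(\bigwedge^2\mathbb C^5)\otimes\mathrm{Sym}^c((\bigwedge^2\mathbb C^5)^*)\otimes\mathrm{Sym}^d((\mathbb C^5)^*)$ generated by the highest weight vector $s=x_1^a x_{12}^b (x_{45}^*)^c(x_5^*)^d$, where $x_i$ is the standard basis of $\mathbb C^5$, $x_{ij}=x_i\wedge x_j$, and $x_i^*$, $x_{ij}^*$ are the dual basis vectors. Put $M(\lambda)=M(F(\lambda))$. **Theorem.** (1) For all $m,n\ge 0$ there are unique morphisms $$\nabla_A:M(m,n+1,0,0)\to M(m,n,0,0),\qquad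 \nabla_A(1\otimes s)=d_{12}\otimes x_1^m x_{12}^n,$$ $$\nabla_B:M(m+1,0,0,n)\to M(m,0,0,n+1),\qquad \nabla_B(1\otimes s)=\sum_{j=2}^5 d_{1j}\otimes x_1^m x_j^*(x_5^*)^n,$$ $$\nabla_C:M(0,0,m,n)\to M(0,0,m+1,n),\qquad \nabla_C(1\otimes s)=\sum_{i<j} d_{ij}\otimes x_{ij}^*(x_{45}^*)^m(x_5^*)^n,$$ where in each line $s$ is the highest weight vector specified above of the source. In the last line $F(0,0,m+1,n)$ is identified with $F(n,m+1,0,0)^*$ by the isomorphism of $\mathfrak{sl}_5$-modules that maps the highest weight vector to $(x_{45}^*)^{m+1}(x_5^*)^n$; here a monomial $x_{ij}^*(x_{45}^*)^m(x_5^*)^n$ acts as a linear functional on $F(n,m+1,0,0)\subset\mathrm{Sym}^n(\mathbb C^5)\otimes\mathrm{Sym}^{m+1}(\bigwedge^2\mathbb C^5)$ as the differential operator $\frac{\partial}{\partial x_{ij}}\bigl(\frac{\partial}{\partial x_{45}}\bigr)^m\bigl(\frac{\partial}{\partial x_5}\bigr)^n$. All these morphisms are nonzero of degree one. (2) Let $\lambda,\mu\in\mathbb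 N^4$ and let $\varphi:M(\lambda)\to M(\mu)$ be a nonzero morphism of degree one. Then for some $m,n\ge 0$ one of the following occurs: - $\lambda=(m,n+1,0,0)$, $\mu=(m,n,0,0)$ and, up to a scalar, $\varphi=\nabla_A$; - $\lambda=(m+1,0,0,n)$, $\mu=(m,0,0,n+1)$ and, up to a scalar, $\varphi=\nabla_B$; - $\lambda=(0,0,m,n)$, $\mu=(0,0,m+1,n)$ and, up to a scalar, $\varphi=\nabla_C$. -/

import Mathlib

open scoped TensorProduct

namespace E510

noncomputable section

attribute [local instance 100] LieRing.ofAssociativeRing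

/-! ### The Lie superalgebra `E(5,10)` -/

/-- Formal power series `ℂ[[x₁, …, x₅]]` (indices are shifted: `x₁, …, x₅` are indexed by `Fin 5`). -/
abbrev PS : Type := MvPowerSeries (Fin 5) ℂ

/-- The partial derivative `∂ᵢ` on `ℂ[[x₁, …, x₅]]`. -/
abbrev pd (i : Fin 5) : Derivation ℂ PS PS := MvPowerSeries.pderiv ℂ i

lemma pd_comm (i j : Fin 5) (f : PS) : pd i (pd j f) = pd j (pd i f) := by
  by_cases h : i = j
  · rw [h]
  · ext n
    simp only [pd, MvPowerSeries.coeff_pderiv]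
    rw [add_right_comm]
    simp [h, Ne.symm h]
    ring

/-- The even part `S₅` of `E(5,10)`: the vector fields `X = ∑ Xᵢ ∂ᵢ` with zero divergence. -/
def Even : Submodule ℂ (Fin 5 → PS) where
  carrier := {X | ∑ i, pd i (X i) = 0}
  add_mem' {X Y} hX hY := by
    simp only [Set.mem_ofPred_eq] at *
    simp [Finset.sum_add_distrib, hX, hY]
  zero_mem' := by simp
  smul_mem' c X hX := by
    simp only [Set.mem_ofPred_eq] at *
    simp [← Finset.smul_sum, hX]

/-- The odd part of `E(5,10)`: closed two-forms `ω = ∑_{i<j} ω i j dxᵢ ∧ dxⱼ`, given by their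
antisymmetric coefficient matrices. -/
def Odd : Submodule ℂ (Fin 5 → Fin 5 → PS) where
  carrier := {w | (∀ i j, w i j = - w j i) ∧
    ∀ i j k, pd i (w j k) + pd j (w k i) + pd k (w i j) = 0}
  add_mem' {v w} hv hw := by
    refine ⟨fun i j => ?_, fun i j k => ?_⟩
    · simp only [Pi.add_apply]
      rw [hv.1 i j, hw.1 i j]
      ring
    · simp only [Pi.add_apply, map_add]
      linear_combination hv.2 i j k + hw.2 i j k
  zero_mem' := by simp
  smul_mem' c w hw := by
    refine ⟨fun i j => ?_, fun i j k => ?_⟩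
    · simp only [Pi.smul_apply]
      rw [hw.1 i j, smul_neg]
    · simp only [Pi.smul_apply, Derivation.map_smul]
      rw [← smul_add, ← smul_add, hw.2 i j k, smul_zero]

/-- The commutator `[X, Y]` of two vector fields. -/
def bracketEE (X Y : Even) : Even :=
  ⟨fun i => ∑ j, (X.1 j * pd j (Y.1 i) - Y.1 j * pd j (X.1 i)), by
    have key : ∀ X Y : Even, ∑ i, ∑ j, pd i (X.1 j * pd j (Y.1 i))
        = ∑ i, ∑ j, pd j (Y.1 i) * pd i (X.1 j) := by
      intro X Y
      have h : ∑ i, ∑ j, X.1 j * pd i (pd j (Y.1 i)) = 0 := by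
        rw [Finset.sum_comm]
        refine Finset.sum_eq_zero fun j _ => ?_
        rw [← Finset.mul_sum]
        have : ∑ i, pd i (pd j (Y.1 i)) = pd j (∑ i, pd i (Y.1 i)) := by
          rw [map_sum]
          exact Finset.sum_congr rfl fun i _ => pd_comm i j _
        have hY : ∑ i, pd i (Y.1 i) = 0 := Y.2
        rw [this, hY, map_zero, mul_zero]
      simp only [Derivation.leibniz, smul_eq_mul, Finset.sum_add_distrib, h, zero_add]
    change ∑ i, pd i (∑ j, (X.1 j * pd j (Y.1 i) - Y.1 j * pd j (X.1 i))) = 0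
    simp only [map_sum, map_sub, Finset.sum_sub_distrib]
    rw [key X Y, key Y X, sub_eq_zero, Finset.sum_comm]
    exact Finset.sum_congr rfl fun i _ => Finset.sum_congr rfl fun j _ => mul_comm _ _⟩

/-- The Lie derivative of a closed two-form along a vector field. -/
def bracketEO (X : Even) (w : Odd) : Odd :=
  ⟨fun i j => ∑ k, (X.1 k * pd k (w.1 i j) + pd i (X.1 k) * w.1 k j + pd j (X.1 k) * w.1 i k), by
    obtain ⟨h1, h2⟩ := w.2
    refine ⟨fun i j => ?_, fun i j k => ?_⟩
    · simp only [← Finset.sum_neg_distrib]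
      refine Finset.sum_congr rfl fun k _ => ?_
      rw [h1 i j, h1 k j, h1 i k, map_neg]
      ring
    · simp only [map_sum, ← Finset.sum_add_distrib]
      refine Finset.sum_eq_zero fun l _ => ?_
      simp only [map_add, Derivation.leibniz, smul_eq_mul]
      have e := congrArg (pd l) (h2 i j k)
      simp only [map_add, map_zero] at e
      rw [pd_comm l i, pd_comm l j, pd_comm l k] at e
      rw [pd_comm j i (X.1 l), pd_comm k i (X.1 l), pd_comm k j (X.1 l)]
      have a1 : pd i (w.1 l k) = - pd i (w.1 k l) := by rw [h1 l k, map_neg]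
      have a2 : pd j (w.1 l i) = - pd j (w.1 i l) := by rw [h1 l i, map_neg]
      have a3 : pd k (w.1 l j) = - pd k (w.1 j l) := by rw [h1 l j, map_neg]
      linear_combination X.1 l * e + pd i (X.1 l) * (h2 l j k) + pd j (X.1 l) * (h2 l k i)
        + pd k (X.1 l) * (h2 l i j) + pd i (pd j (X.1 l)) * h1 l k
        + pd j (pd k (X.1 l)) * h1 l i + pd i (pd k (X.1 l)) * h1 l j⟩

/-- The bracket of two odd elements, i.e. the bilinear extension of
`[f d_{ij}, g d_{kl}] = ε_{ijkl} f g ∂_t`, where `t` is the remaining index and `ε_{ijkl}` is the sign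
of the permutation `(i,j,k,l,t)`; each unordered pair `{i,j}`, `{k,l}` is counted twice in the sum
over all permutations, whence the factor `1/4`. -/
def bracketOO (v w : Odd) : Even :=
  ⟨fun t => (1 / 4 : ℂ) • ∑ s : Equiv.Perm (Fin 5),
      if s 4 = t then ((Equiv.Perm.sign s : ℤ) : PS) * (v.1 (s 0) (s 1) * w.1 (s 2) (s 3)) else 0,
    by
    have key : ∀ (a b c d : Fin 5) (w v : Odd), (a, b, c, d) = (0, 1, 2, 3) ∨
        (a, b, c, d) = (2, 3, 0, 1) →
        ∑ s : Equiv.Perm (Fin 5), ((Equiv.Perm.sign s : ℤ) : PS) *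
          (pd (s 4) (w.1 (s a) (s b)) * v.1 (s c) (s d)) = 0 := by
      intro a b c d w v h
      -- the three-cycle `a ↦ b ↦ 4 ↦ a`
      obtain ⟨g, hg, ga, gb, g4, gc, gd⟩ : ∃ g : Equiv.Perm (Fin 5), Equiv.Perm.sign g = 1 ∧
          g a = b ∧ g b = 4 ∧ g 4 = a ∧ g c = c ∧ g d = d := by
        refine ⟨Equiv.swap a b * Equiv.swap b 4, ?_⟩
        rcases h with h | h <;> (simp only [Prod.mk.injEq] at h; obtain ⟨rfl, rfl, rfl, rfl⟩ := h) <;>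
          decide
      set T : Equiv.Perm (Fin 5) → PS := fun s => ((Equiv.Perm.sign s : ℤ) : PS) *
          (pd (s 4) (w.1 (s a) (s b)) * v.1 (s c) (s d)) with hT
      have e1 : ∑ s, T (s * g) = ∑ s, T s := Equiv.sum_comp (Equiv.mulRight g) T
      have e2 : ∑ s, T (s * g * g) = ∑ s, T s := by
        rw [← e1]
        exact Equiv.sum_comp (Equiv.mulRight g) (fun s => T (s * g))
      have e3 : ∑ s, (T s + T (s * g) + T (s * g * g)) = 0 := by
        refine Finset.sum_eq_zero fun s _ => ?_
        simp only [hT, Equiv.Perm.sign_mul, hg, mul_one, Equiv.Perm.mul_apply, ga, gb, g4, gc, gd]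
        linear_combination ((Equiv.Perm.sign s : ℤ) : PS) * v.1 (s c) (s d) *
          (w.2.2 (s 4) (s a) (s b))
      rw [Finset.sum_add_distrib, Finset.sum_add_distrib, e1, e2] at e3
      have : (3 : ℂ) • ∑ s, T s = 0 := by
        rw [← e3, show (3 : ℂ) = 1 + 1 + 1 by norm_num, add_smul, add_smul, one_smul]
      exact (smul_eq_zero.mp this).resolve_left (by norm_num)
    change ∑ t, pd t ((1 / 4 : ℂ) • ∑ s : Equiv.Perm (Fin 5), if s 4 = t then
      ((Equiv.Perm.sign s : ℤ) : PS) * (v.1 (s 0) (s 1) * w.1 (s 2) (s 3)) else 0) = 0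
    simp only [Derivation.map_smul, map_sum, ← Finset.smul_sum]
    rw [Finset.sum_comm]
    have : ∀ s : Equiv.Perm (Fin 5), ∑ t, pd t (if s 4 = t then
        ((Equiv.Perm.sign s : ℤ) : PS) * (v.1 (s 0) (s 1) * w.1 (s 2) (s 3)) else 0) =
        ((Equiv.Perm.sign s : ℤ) : PS) * (pd (s 4) (v.1 (s 0) (s 1)) * w.1 (s 2) (s 3)) +
        ((Equiv.Perm.sign s : ℤ) : PS) * (pd (s 4) (w.1 (s 2) (s 3)) * v.1 (s 0) (s 1)) := by
      intro s
      rw [Finset.sum_eq_single (s 4)]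
      · rw [if_pos rfl, Derivation.leibniz, Derivation.map_intCast, Derivation.leibniz]
        simp only [smul_eq_mul]
        ring
      · intro t _ ht
        rw [if_neg (Ne.symm ht), map_zero]
      · simp
    rw [Finset.sum_congr rfl fun s _ => this s, Finset.sum_add_distrib,
      key 0 1 2 3 v w (Or.inl rfl), key 2 3 0 1 w v (Or.inr rfl), add_zero, smul_zero]⟩

/-- The underlying vector space of the Lie superalgebra `L = E(5,10)`. -/
abbrev L : Type := Even × Odd

/-- The super bracket of `L = E(5,10)`. -/
def bracket (a b : L) : L :=
  (bracketEE a.1 b.1 + bracketOO a.2 b.2, bracketEO a.1 b.2 - bracketEO b.1 a.2)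

/-- The inclusion of the even part. -/
abbrev ev (X : Even) : L := (X, 0)

/-- The inclusion of the odd part. -/
abbrev od (w : Odd) : L := (0, w)

/-- The defining relations `ab - (-1)^{|a||b|} ba = [a, b]` (for homogeneous `a`, `b` in `L`) of the
universal enveloping algebra. -/
inductive Rel : TensorAlgebra ℂ L → TensorAlgebra ℂ L → Prop
  | even_even (X Y : Even) :
      Rel (TensorAlgebra.ι ℂ (ev X) * TensorAlgebra.ι ℂ (ev Y)
        - TensorAlgebra.ι ℂ (ev Y) * TensorAlgebra.ι ℂ (ev X))
        (TensorAlgebra.ι ℂ (bracket (ev X) (ev Y)))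
  | even_odd (X : Even) (w : Odd) :
      Rel (TensorAlgebra.ι ℂ (ev X) * TensorAlgebra.ι ℂ (od w)
        - TensorAlgebra.ι ℂ (od w) * TensorAlgebra.ι ℂ (ev X))
        (TensorAlgebra.ι ℂ (bracket (ev X) (od w)))
  | odd_odd (v w : Odd) :
      Rel (TensorAlgebra.ι ℂ (od v) * TensorAlgebra.ι ℂ (od w)
        + TensorAlgebra.ι ℂ (od w) * TensorAlgebra.ι ℂ (od v))
        (TensorAlgebra.ι ℂ (bracket (od v) (od w)))

/-- The universal enveloping algebra `U = U(L)`. Modules over the Lie superalgebra `L` are the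
same thing as modules over the associative algebra `U`. -/
def U : Type := RingQuot Rel

instance : Ring U := inferInstanceAs (Ring (RingQuot Rel))

instance : Algebra ℂ U := inferInstanceAs (Algebra ℂ (RingQuot Rel))

/-- The canonical map `L → U(L)`. -/
def toU : L →ₗ[ℂ] U :=
  (RingQuot.mkAlgHom ℂ Rel).toLinearMap ∘ₗ TensorAlgebra.ι ℂ

/-- `L_{≥ 0}`: the vector fields and the closed two-forms all of whose coefficients have zero
constant term (`x_i` has degree `2`, hence `f ∂ᵢ` has degree `2 deg f - 2` and `f d_{ij}` has degree
`2 deg f - 1`). -/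
def nonneg : Submodule ℂ L where
  carrier := {a | (∀ i, MvPowerSeries.constantCoeff (a.1.1 i) = 0) ∧
    ∀ i j, MvPowerSeries.constantCoeff (a.2.1 i j) = 0}
  add_mem' {a b} ha hb := by
    refine ⟨fun i => ?_, fun i j => ?_⟩
    · simp [ha.1 i, hb.1 i]
    · simp [ha.2 i j, hb.2 i j]
  zero_mem' := by simp
  smul_mem' c a ha := by
    refine ⟨fun i => ?_, fun i j => ?_⟩
    · simp [ha.1 i]
    · simp [ha.2 i j]

/-- The Lie algebra `𝔰𝔩₅`; it is identified with `L₀` through `E_{ij} ↔ x_i ∂_j`. -/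
abbrev sl5 : LieSubalgebra ℂ (Matrix (Fin 5) (Fin 5) ℂ) :=
  LieAlgebra.SpecialLinear.sl (Fin 5) ℂ

/-- The component in `L₀ ≅ 𝔰𝔩₅` of a vector field `∑ X_j ∂_j` of zero divergence: the matrix whose
`(i, j)` entry is the coefficient of `x_i` in `X_j`. -/
def linPart (X : Even) : sl5 :=
  ⟨Matrix.of fun i j => MvPowerSeries.coeff (Finsupp.single i 1) (X.1 j), by
    have h : ∑ i, pd i (X.1 i) = 0 := X.2
    have h' := congrArg (MvPowerSeries.coeff 0) h
    simp only [map_sum, MvPowerSeries.coeff_pderiv, map_zero] at h'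
    change Matrix.trace (Matrix.of fun i j : Fin 5 =>
      MvPowerSeries.coeff (Finsupp.single i 1) (X.1 j)) = 0
    simpa [Matrix.trace] using h'⟩

/-- The constant two-form `d_{ij} = dx_i ∧ dx_j`, an element of `L_{-1}`. -/
def d (i j : Fin 5) : Odd :=
  ⟨fun k l => MvPowerSeries.C ((if i = k ∧ j = l then 1 else 0) - (if i = l ∧ j = k then 1 else 0)), by
    refine ⟨fun k l => ?_, fun k l m => ?_⟩
    · rw [← map_neg, neg_sub]
    · simp only [pd, MvPowerSeries.pderiv_C, add_zero]⟩

/-- The element `d_{ij}` of `U(L)`. -/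
def dU (i j : Fin 5) : U := toU (od (d i j))

/-- The homogeneous component `(U_-)_n` of degree `n` of `U_- = U(L_-)`, which is spanned by the
products of `n` elements `d_{ij}`. -/
def UnegDeg (n : ℕ) : Submodule ℂ U :=
  Submodule.span ℂ (Set.range fun p : Fin 5 × Fin 5 => dU p.1 p.2) ^ n

/-! ### Generalized Verma modules and their morphisms -/

section Verma

variable (V : Type*) [AddCommGroup V] [Module ℂ V] [LieRingModule sl5 V] [LieModule ℂ sl5 V]

/-- The relations `u a ⊗ v = u ⊗ a v` for `a ∈ L_{≥ 0}`, where `L_{≥ 0}` acts on the `L₀`-module `V`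
through its component in `L₀` (so that `L_+` acts by zero). -/
def inducedRel : Submodule U (U ⊗[ℂ] V) :=
  Submodule.span U {z | ∃ u : U, ∃ a ∈ nonneg, ∃ v : V,
    z = (u * toU a) ⊗ₜ[ℂ] v - u ⊗ₜ[ℂ] ⁅linPart a.1, v⁆}

/-- The generalized Verma module `M(V) = U(L) ⊗_{U(L_{≥ 0})} V`. -/
abbrev Verma : Type _ := (U ⊗[ℂ] V) ⧸ inducedRel V

variable {V}

/-- The element `u ⊗ v` of `M(V)`. -/
def tmul (u : U) (v : V) : Verma V := Submodule.Quotient.mk (u ⊗ₜ[ℂ] v)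

variable {W : Type*} [AddCommGroup W] [Module ℂ W] [LieRingModule sl5 W] [LieModule ℂ sl5 W]

/-- A morphism `φ : M(V) → M(W)` has degree `n` if it is associated with an element
`Φ = ∑ uᵢ ⊗ θᵢ` of `(U_-)_n ⊗ Hom(V, W)`, that is, `φ(u ⊗ v) = ∑ u uᵢ ⊗ θᵢ(v)`. -/
def HasDegree (n : ℕ) (φ : Verma V →ₗ[U] Verma W) : Prop :=
  ∃ (r : ℕ) (u : Fin r → U) (θ : Fin r → (V →ₗ[ℂ] W)), (∀ i, u i ∈ UnegDeg n) ∧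
    ∀ (u' : U) (v : V), φ (tmul u' v) = ∑ i, tmul (u' * u i) (θ i v)

end Verma

/-! ### The irreducible `𝔰𝔩₅`-modules -/

/-- Pairs `i < j` of indices. -/
abbrev Pair : Type := {p : Fin 5 × Fin 5 // p.1 < p.2}

/-- The basis vectors `x_i` of `ℂ⁵`, `x_{ij} = x_i ∧ x_j` (`i < j`) of `⋀² ℂ⁵`, and the dual basis vectors
`x_{ij}^*` and `x_i^*`. -/
inductive Gen : Type
  | x (i : Fin 5)
  | xx (p : Pair)
  | xxs (p : Pair)
  | xs (i : Fin 5)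

/-- The symmetric algebra of `ℂ⁵ ⊕ ⋀² ℂ⁵ ⊕ (⋀² ℂ⁵)^* ⊕ (ℂ⁵)^*`, that is, the direct sum of all
`Sym^a(ℂ⁵) ⊗ Sym^b(⋀² ℂ⁵) ⊗ Sym^c((⋀² ℂ⁵)^*) ⊗ Sym^d((ℂ⁵)^*)`. -/
abbrev Poly : Type := MvPolynomial Gen ℂ

/-- The vector `x_i`. -/
abbrev vx (i : Fin 5) : Poly := MvPolynomial.X (Gen.x i)

/-- The vector `x_i^*`. -/
abbrev vxs (i : Fin 5) : Poly := MvPolynomial.X (Gen.xs i)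

/-- The vector `x_{ij} = x_i ∧ x_j` for arbitrary `i`, `j`. -/
def vxx (i j : Fin 5) : Poly :=
  if h : i < j then MvPolynomial.X (Gen.xx ⟨(i, j), h⟩)
  else if h : j < i then - MvPolynomial.X (Gen.xx ⟨(j, i), h⟩) else 0

/-- The vector `x_{ij}^*` for arbitrary `i`, `j` (antisymmetric in `i` and `j`). -/
def vxxs (i j : Fin 5) : Poly :=
  if h : i < j then MvPolynomial.X (Gen.xxs ⟨(i, j), h⟩)
  else if h : j < i then - MvPolynomial.X (Gen.xxs ⟨(j, i), h⟩) else 0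

/-- The action of a matrix on the basis vectors: `E_{ij} x_k = δ_{jk} x_i`,
`E_{ij} x_{kl} = δ_{jk} x_{il} + δ_{jl} x_{ki}`, and dually. -/
def actGen (A : Matrix (Fin 5) (Fin 5) ℂ) : Gen → Poly
  | Gen.x k => ∑ i, A i k • vx i
  | Gen.xx p => ∑ i, (A i p.1.1 • vxx i p.1.2 + A i p.1.2 • vxx p.1.1 i)
  | Gen.xxs p => - ∑ i, (A p.1.1 i • vxxs i p.1.2 + A p.1.2 i • vxxs p.1.1 i)
  | Gen.xs k => - ∑ i, A k i • vxs i

/-- The action of a matrix on the symmetric algebra by a derivation. -/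
def act (A : Matrix (Fin 5) (Fin 5) ℂ) : Derivation ℂ Poly Poly :=
  MvPolynomial.mkDerivation ℂ (actGen A)

lemma vxx_swap (i j : Fin 5) : vxx i j = - vxx j i := by
  rcases lt_trichotomy i j with h | h | h
  · simp [vxx, h, not_lt.mpr h.le]
  · simp [vxx, h]
  · simp [vxx, h, not_lt.mpr h.le]

lemma vxxs_swap (i j : Fin 5) : vxxs i j = - vxxs j i := by
  rcases lt_trichotomy i j with h | h | h
  · simp [vxxs, h, not_lt.mpr h.le]
  · simp [vxxs, h]
  · simp [vxxs, h, not_lt.mpr h.le]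

lemma act_vx (A : Matrix (Fin 5) (Fin 5) ℂ) (k : Fin 5) :
    act A (vx k) = ∑ i, A i k • vx i := by
  simp [act, vx, MvPolynomial.mkDerivation_X, actGen]

lemma act_vxs (A : Matrix (Fin 5) (Fin 5) ℂ) (k : Fin 5) :
    act A (vxs k) = - ∑ i, A k i • vxs i := by
  simp [act, vxs, MvPolynomial.mkDerivation_X, actGen]

lemma act_vxx (A : Matrix (Fin 5) (Fin 5) ℂ) (k l : Fin 5) :
    act A (vxx k l) = ∑ i, (A i k • vxx i l + A i l • vxx k i) := by
  have main : ∀ k l : Fin 5, k < l →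
      act A (vxx k l) = ∑ i, (A i k • vxx i l + A i l • vxx k i) := by
    intro k l h
    have : vxx k l = MvPolynomial.X (Gen.xx ⟨(k, l), h⟩) := by simp [vxx, h]
    rw [this, act, MvPolynomial.mkDerivation_X, actGen]
  rcases lt_trichotomy k l with h | h | h
  · exact main k l h
  · subst h
    have : vxx k k = 0 := by simp [vxx]
    rw [this, map_zero]
    symm
    refine Finset.sum_eq_zero fun i _ => ?_
    rw [vxx_swap i k, smul_neg, neg_add_cancel]
  · rw [vxx_swap k l, map_neg, main l k h, ← Finset.sum_neg_distrib]
    refine Finset.sum_congr rfl fun i _ => ?_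
    rw [vxx_swap i k, vxx_swap l i]
    simp only [smul_neg, neg_add, neg_neg]
    rw [add_comm]

lemma act_vxxs (A : Matrix (Fin 5) (Fin 5) ℂ) (k l : Fin 5) :
    act A (vxxs k l) = - ∑ i, (A k i • vxxs i l + A l i • vxxs k i) := by
  have main : ∀ k l : Fin 5, k < l →
      act A (vxxs k l) = - ∑ i, (A k i • vxxs i l + A l i • vxxs k i) := by
    intro k l h
    have : vxxs k l = MvPolynomial.X (Gen.xxs ⟨(k, l), h⟩) := by simp [vxxs, h]
    rw [this, act, MvPolynomial.mkDerivation_X, actGen]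
  rcases lt_trichotomy k l with h | h | h
  · exact main k l h
  · subst h
    have : vxxs k k = 0 := by simp [vxxs]
    rw [this, map_zero]
    symm
    rw [neg_eq_zero]
    refine Finset.sum_eq_zero fun i _ => ?_
    rw [vxxs_swap i k, smul_neg, neg_add_cancel]
  · rw [vxxs_swap k l, map_neg, main l k h, neg_inj, ← Finset.sum_neg_distrib]
    refine Finset.sum_congr rfl fun i _ => ?_
    rw [vxxs_swap i k, vxxs_swap l i]
    simp only [smul_neg, neg_add, neg_neg]
    rw [add_comm]

lemma act_add (A B : Matrix (Fin 5) (Fin 5) ℂ) : act (A + B) = act A + act B := by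
  refine MvPolynomial.derivation_ext fun g => ?_
  rw [Derivation.add_apply]
  simp only [act, MvPolynomial.mkDerivation_X]
  cases g <;>
    simp only [actGen, Matrix.add_apply, add_smul, Finset.sum_add_distrib, neg_add] <;> abel

lemma act_smul (c : ℂ) (A : Matrix (Fin 5) (Fin 5) ℂ) : act (c • A) = c • act A := by
  refine MvPolynomial.derivation_ext fun g => ?_
  rw [Derivation.smul_apply]
  simp only [act, MvPolynomial.mkDerivation_X]
  cases g <;>
    simp only [actGen, Matrix.smul_apply, smul_assoc, Finset.smul_sum, smul_add, smul_neg]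

lemma act_lie (A B : Matrix (Fin 5) (Fin 5) ℂ) : act ⁅A, B⁆ = ⁅act A, act B⁆ := by
  refine MvPolynomial.derivation_ext fun g => ?_
  rw [Derivation.commutator_apply]
  cases g with
  | x k =>
    change act _ (vx k) = act A (act B (vx k)) - act B (act A (vx k))
    simp only [act_vx, map_add, Derivation.map_smul, Ring.lie_def, Matrix.sub_apply, Matrix.mul_apply,
      Fin.sum_univ_five]
    module
  | xs k =>
    change act _ (vxs k) = act A (act B (vxs k)) - act B (act A (vxs k))
    simp only [act_vxs, map_add, Derivation.map_smul, map_neg, Ring.lie_def, Matrix.sub_apply,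
      Matrix.mul_apply, Fin.sum_univ_five]
    module
  | xx p =>
    obtain ⟨⟨k, l⟩, h⟩ := p
    have : (MvPolynomial.X (Gen.xx ⟨(k, l), h⟩) : Poly) = vxx k l := by simp [vxx, h]
    rw [this]
    simp only [act_vxx, map_add, Derivation.map_smul, Ring.lie_def, Matrix.sub_apply,
      Matrix.mul_apply, Fin.sum_univ_five]
    module
  | xxs p =>
    obtain ⟨⟨k, l⟩, h⟩ := p
    have : (MvPolynomial.X (Gen.xxs ⟨(k, l), h⟩) : Poly) = vxxs k l := by simp [vxxs, h]
    rw [this]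
    simp only [act_vxxs, map_add, Derivation.map_smul, map_neg, Ring.lie_def, Matrix.sub_apply,
      Matrix.mul_apply, Fin.sum_univ_five]
    module

instance : LieRingModule sl5 Poly where
  bracket A p := act A.1 p
  add_lie A B p := by
    change act (A.1 + B.1) p = _
    rw [act_add]
    rfl
  lie_add A p q := map_add _ _ _
  leibniz_lie A B p := by
    change act A.1 (act B.1 p) = act (⁅A.1, B.1⁆) p + act B.1 (act A.1 p)
    rw [act_lie, Derivation.commutator_apply, sub_add_cancel]

instance : LieModule ℂ sl5 Poly where
  smul_lie c A p := by
    change act (c • A.1) p = _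
    rw [act_smul]
    rfl
  lie_smul c A p := Derivation.map_smul _ _ _

/-- The vector `x_1^a x_{12}^b (x_{45}^*)^c (x_5^*)^d`. -/
def hwPoly (lam : Fin 4 → ℕ) : Poly :=
  vx 0 ^ lam 0 * vxx 0 1 ^ lam 1 * vxxs 3 4 ^ lam 2 * vxs 4 ^ lam 3

/-- The irreducible `𝔰𝔩₅`-module `F(λ)` of highest weight `λ = (a, b, c, d)`: the submodule of
`Sym^a(ℂ⁵) ⊗ Sym^b(⋀² ℂ⁵) ⊗ Sym^c((⋀² ℂ⁵)^*) ⊗ Sym^d((ℂ⁵)^*)` generated by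
`x_1^a x_{12}^b (x_{45}^*)^c (x_5^*)^d`. -/
def F (lam : Fin 4 → ℕ) : LieSubmodule ℂ sl5 Poly :=
  LieSubmodule.lieSpan ℂ sl5 {hwPoly lam}

/-- The highest weight vector of `F(λ)`. -/
def hw (lam : Fin 4 → ℕ) : F lam :=
  ⟨hwPoly lam, LieSubmodule.subset_lieSpan rfl⟩

/-- The minimal Verma module `M(λ) = M(F(λ))`. -/
abbrev M (lam : Fin 4 → ℕ) : Type := Verma (F lam)

/-! ### The morphisms `∇_A`, `∇_B`, `∇_C` -/

/-- `φ` is the morphism `∇_A : M(m,n+1,0,0) → M(m,n,0,0)`: it maps `1 ⊗ s`, where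
`s = x_1^m x_{12}^{n+1}`, to `d_{12} ⊗ x_1^m x_{12}^n`. -/
def IsNablaA (m n : ℕ) {lam mu : Fin 4 → ℕ} (φ : M lam →ₗ[U] M mu) : Prop :=
  lam = ![m, n + 1, 0, 0] ∧ mu = ![m, n, 0, 0] ∧
    φ (tmul 1 (hw lam)) = tmul (dU 0 1) (hw mu)

/-- `φ` is the morphism `∇_B : M(m+1,0,0,n) → M(m,0,0,n+1)`: it maps `1 ⊗ s`, where
`s = x_1^{m+1} (x_5^*)^n`, to `∑_{j=2}^5 d_{1j} ⊗ x_1^m x_j^* (x_5^*)^n`. -/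
def IsNablaB (m n : ℕ) {lam mu : Fin 4 → ℕ} (φ : M lam →ₗ[U] M mu) : Prop :=
  lam = ![m + 1, 0, 0, n] ∧ mu = ![m, 0, 0, n + 1] ∧
    ∃ w : Fin 4 → F mu, (∀ j, (w j : Poly) = vx 0 ^ m * vxs j.succ * vxs 4 ^ n) ∧
      φ (tmul 1 (hw lam)) = ∑ j, tmul (dU 0 j.succ) (w j)

/-- For `i < j`, the element `x_{ij}^* (x_{45}^*)^m (x_5^*)^n` of `F(n,m+1,0,0)^*`: it acts on a
polynomial in the `x_i` and `x_{ij}` as the corresponding partial differential operator with constant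
coefficients (the pairing of the symmetric powers of a space and of its dual). -/
def dualVec (m n : ℕ) (p : Pair) : Module.Dual ℂ (F ![n, m + 1, 0, 0]) :=
  MvPolynomial.lcoeff ℂ 0 ∘ₗ
    (MvPolynomial.pderiv (Gen.xx p)).toLinearMap ∘ₗ
    ((MvPolynomial.pderiv (Gen.xx ⟨(3, 4), by decide⟩)).toLinearMap ^ m : Poly →ₗ[ℂ] Poly) ∘ₗ
    ((MvPolynomial.pderiv (Gen.x 4)).toLinearMap ^ n : Poly →ₗ[ℂ] Poly) ∘ₗ
    (F ![n, m + 1, 0, 0]).toSubmodule.subtype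

/-- `φ` is the morphism `∇_C : M(0,0,m,n) → M(0,0,m+1,n)`: it maps `1 ⊗ s`, where
`s = (x_{45}^*)^m (x_5^*)^n`, to `∑_{i<j} d_{ij} ⊗ x_{ij}^* (x_{45}^*)^m (x_5^*)^n`. Here `F(0,0,m+1,n)` is
identified with `F(n,m+1,0,0)^*` by the isomorphism `e` of `L₀`-modules that maps the highest weight
vector to `(x_{45}^*)^{m+1} (x_5^*)^n`. -/
def IsNablaC (m n : ℕ) {lam mu : Fin 4 → ℕ} (φ : M lam →ₗ[U] M mu) : Prop :=
  lam = ![0, 0, m, n] ∧ mu = ![0, 0, m + 1, n] ∧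
    ∃ e : F mu ≃ₗ⁅ℂ, sl5⁆ Module.Dual ℂ (F ![n, m + 1, 0, 0]),
      e (hw mu) = dualVec m n ⟨(3, 4), by decide⟩ ∧
      φ (tmul 1 (hw lam)) = ∑ p : Pair, tmul (dU p.1.1 p.1.2) (e.symm (dualVec m n p))

end

end E510

open scoped TensorProduct

namespace E510

noncomputable section

attribute [local instance 100] LieRing.ofAssociativeRing

/-! A morphism of degree one out of `M(λ)` amounts to an `𝔰𝔩₅`-equivariant map from `F(λ)` to
`L_{-1} ⊗ F(μ)` whose values are annihilated by `L_+`, and it is determined by the image of the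
highest weight vector (`exists_morphism_of_hw`, `F_hom_ext`). Even elements of `L_+` have degree at
least 2 and annihilate degree one automatically. An odd `w` in `L_+` sends `∑ d_{ij} ⊗ f_{ij}` to `1
⊗ ∑ [w, d_{ij}] f_{ij}`, which involves only the linear coefficients of `w`. Being singular is
therefore the vanishing of a signed sum over the permutations of five indices
(`oddSingular_degOne_iff`).

Reading off the coefficient of `d_{ij}` requires independence of the vectors `d_{ij} ⊗ v` in `M(V)`.
Instead of a PBW theorem for `L`, an action of `L` on `U(L_-) ⊗ V` is constructed. The rule `a(yn) =
[a,y]n ± y(an)` for `y ∈ L_-` turns `Hom(L, U(L_-) ⊗ V)` into a `U(L_-)`-module, so the action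
extends from `1 ⊗ V`; Jacobi identities with a constant argument show that it respects the bracket
(`Ind.relations`). Homomorphisms from `U(L_-)` to the dual numbers then give the coefficients in
degrees 0 and 1.

Existence. The equivariant maps are `∂/∂x_{ij}` for `∇_A`, the antisymmetrization of `x_j^* ∂/∂x_i`
for `∇_B`, and multiplication by `x_{ij}^*`, read in the dual of `F(n,m+1,0,0)`, for `∇_C`. For
`∇_A` every term of the singularity sum vanishes. For `∇_B` the terms cancel because two-forms in
`L` are closed and because a symmetric expression has signed sum zero. For `∇_C` they cancel by
closedness and by the Plücker relations on `F(n,m+1,0,0)`.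

Classification. Write the image of the highest weight vector as `∑ d_{ij} ⊗ w_{ij}`. Raising
operators increase indices, so the nonzero `w_{de}` with `d + e` maximal is a highest weight vector
of `F(μ)`, hence a multiple of the standard one; this uniqueness comes from a contravariant positive
definite form. For `a`, `b` outside `{d, e}`, the closed form `x_a d_{bc} + x_b d_{ac}` forces the
quantity `wt μ a + [a<d] + [a<e]` to agree at `a` and `b`. Both the weight and the correction
decrease weakly in `a`, so both are constant on the complement of `{d, e}`. This leaves `{d, e} =
{1,2}, {1,5}, {4,5}`, which are the families A, B, C. Finally, subtracting the right multiple of the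
known morphism cancels the leading coefficient, and the same classification shows that the
difference is zero (`exists_eq_smul_nabla`). -/

/-! ### The bracket of two-forms in coordinates -/

theorem sum_perm_fix_four {M : Type*} [AddCommGroup M] (T : Fin 5 → Fin 5 → Fin 5 → Fin 5 → M) :
    ∑ s : Equiv.Perm (Fin 5), (if s 4 = 4 then
      (Equiv.Perm.sign s : ℤ) • T (s 0) (s 1) (s 2) (s 3) else 0) =
    T 0 1 2 3 - T 0 1 3 2 - T 0 2 1 3 + T 0 2 3 1 + T 0 3 1 2 - T 0 3 2 1 - T 1 0 2 3 + T 1 0 3 2 + T 1 2 0 3 - T 1 2 3 0 - T 1 3 0 2 + T 1 3 2 0 + T 2 0 1 3 - T 2 0 3 1 - T 2 1 0 3 + T 2 1 3 0 + T 2 3 0 1 - T 2 3 1 0 - T 3 0 1 2 + T 3 0 2 1 + T 3 1 0 2 - T 3 1 2 0 - T 3 2 0 1 + T 3 2 1 0 := by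
  rw [← Finset.sum_filter]
  -- Each summand depends only on the first four values of `s` and its sign, so an equality of
  -- multisets of such tuples, which is decidable, suffices.
  have key : ((Finset.univ.filter fun s : Equiv.Perm (Fin 5) => s 4 = 4).val.map
      fun s => (s 0, s 1, s 2, s 3, (Equiv.Perm.sign s : ℤ))) =
      ([(0, 1, 2, 3, 1), (0, 1, 3, 2, -1), (0, 2, 1, 3, -1), (0, 2, 3, 1, 1), (0, 3, 1, 2, 1), (0, 3, 2, 1, -1), (1, 0, 2, 3, -1), (1, 0, 3, 2, 1), (1, 2, 0, 3, 1), (1, 2, 3, 0, -1), (1, 3, 0, 2, -1), (1, 3, 2, 0, 1), (2, 0, 1, 3, 1), (2, 0, 3, 1, -1), (2, 1, 0, 3, -1), (2, 1, 3, 0, 1), (2, 3, 0, 1, 1), (2, 3, 1, 0, -1), (3, 0, 1, 2, -1), (3, 0, 2, 1, 1), (3, 1, 0, 2, 1), (3, 1, 2, 0, -1), (3, 2, 0, 1, -1), (3, 2, 1, 0, 1)] : List (Fin 5 × Fin 5 × Fin 5 × Fin 5 × ℤ)) := by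
    decide +kernel
  have h := congrArg (fun m => (m.map fun k : Fin 5 × Fin 5 × Fin 5 × Fin 5 × ℤ =>
    k.2.2.2.2 • T k.1 k.2.1 k.2.2.1 k.2.2.2.1).sum) key
  simp only [Multiset.map_map, Multiset.map_coe, Multiset.sum_coe, List.map_cons, List.map_nil,
    List.sum_cons, List.sum_nil] at h
  refine Eq.trans h ?_
  simp only [one_smul, neg_smul]
  abel

theorem odd_swap (w : Odd) (i j : Fin 5) : w.1 i j = - w.1 j i := w.2.1 i j

theorem odd_closed (w : Odd) (i j k : Fin 5) :
    pd i (w.1 j k) + pd j (w.1 k i) + pd k (w.1 i j) = 0 := w.2.2 i j k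

/-- The coefficients of the product of two two-forms. -/
def wedge {R : Type*} [Ring R] (v w : Fin 5 → Fin 5 → R) (i j k l : Fin 5) : R :=
  v i j * w k l - v i k * w j l + v i l * w j k + v j k * w i l - v j l * w i k + v k l * w i j

/-- Left translation by `g` reduces the component `g 4` to permutations fixing `4`. Antisymmetry
then groups the 24 terms into six groups of four, which cancels the factor `1/4`. -/
theorem bracketOO_apply_perm (v w : Odd) (g : Equiv.Perm (Fin 5)) :
    (bracketOO v w).1 (g 4) =
      ((Equiv.Perm.sign g : ℤ) : PS) * wedge v.1 w.1 (g 0) (g 1) (g 2) (g 3) := by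
  have h : ∑ s : Equiv.Perm (Fin 5), (if s 4 = g 4 then
      ((Equiv.Perm.sign s : ℤ) : PS) * (v.1 (s 0) (s 1) * w.1 (s 2) (s 3)) else 0) =
      (4 : ℂ) • (((Equiv.Perm.sign g : ℤ) : PS) * wedge v.1 w.1 (g 0) (g 1) (g 2) (g 3)) := by
    rw [← Equiv.sum_comp (Equiv.mulLeft g)]
    have e := sum_perm_fix_four (fun i j k l => v.1 (g i) (g j) * w.1 (g k) (g l))
    have e' : ∀ s : Equiv.Perm (Fin 5), (if (Equiv.mulLeft g s) 4 = g 4 then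
      ((Equiv.Perm.sign (Equiv.mulLeft g s) : ℤ) : PS) * (v.1 (Equiv.mulLeft g s 0)
        (Equiv.mulLeft g s 1) * w.1 (Equiv.mulLeft g s 2) (Equiv.mulLeft g s 3)) else 0) =
      ((Equiv.Perm.sign g : ℤ) : PS) * (if s 4 = 4 then (Equiv.Perm.sign s : ℤ) •
        (v.1 (g (s 0)) (g (s 1)) * w.1 (g (s 2)) (g (s 3))) else 0) := by
      intro s
      simp only [Equiv.coe_mulLeft, Equiv.Perm.mul_apply, Equiv.Perm.sign_mul,
        EmbeddingLike.apply_eq_iff_eq, zsmul_eq_mul]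
      split_ifs
      · push_cast
        ring
      · simp
    rw [Finset.sum_congr rfl fun s _ => e' s, ← Finset.mul_sum, e, Algebra.smul_def,
      map_ofNat (algebraMap ℂ PS) 4]
    simp only [wedge]
    rw [odd_swap v (g 1) (g 0), odd_swap v (g 2) (g 0), odd_swap v (g 3) (g 0),
      odd_swap v (g 2) (g 1), odd_swap v (g 3) (g 1), odd_swap v (g 3) (g 2),
      odd_swap w (g 1) (g 0), odd_swap w (g 2) (g 0), odd_swap w (g 3) (g 0),
      odd_swap w (g 2) (g 1), odd_swap w (g 3) (g 1), odd_swap w (g 3) (g 2)]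
    ring
  change (1 / 4 : ℂ) • ∑ s : Equiv.Perm (Fin 5), _ = _
  rw [h, smul_smul]
  norm_num

theorem bracketOO_apply (v w : Odd) :
    (bracketOO v w).1 = ![wedge v.1 w.1 1 2 3 4, - wedge v.1 w.1 0 2 3 4, wedge v.1 w.1 0 1 3 4,
      - wedge v.1 w.1 0 1 2 4, wedge v.1 w.1 0 1 2 3] := by
  have key : ∀ (g : Equiv.Perm (Fin 5)) (i j k l t : Fin 5) (c : ℤ), g 0 = i → g 1 = j → g 2 = k →
      g 3 = l → g 4 = t → Equiv.Perm.sign g = c →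
      (bracketOO v w).1 t = (c : PS) * wedge v.1 w.1 i j k l := by
    rintro g i j k l t c rfl rfl rfl rfl rfl rfl
    exact bracketOO_apply_perm v w g
  funext t
  fin_cases t
  · simpa using key (finRotate 5) 1 2 3 4 0 1 rfl rfl rfl rfl rfl (by decide)
  · simpa using key (finRotate 5 * Equiv.swap 4 0) 0 2 3 4 1 (-1)
      (by decide) (by decide) (by decide) (by decide) (by decide) (by decide)
  · simpa using key (Equiv.swap 2 3 * Equiv.swap 3 4) 0 1 3 4 2 1
      (by decide) (by decide) (by decide) (by decide) (by decide) (by decide)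
  · simpa using key (Equiv.swap 3 4) 0 1 2 4 3 (-1)
      (by decide) (by decide) (by decide) (by decide) (by decide) (by decide)
  · simpa using key 1 0 1 2 3 4 1 rfl rfl rfl rfl rfl (by decide)

/-! ### Jacobi identities with constant arguments -/

/-- A vector field with constant coefficients. -/
def IsConstE (X : Even) : Prop := ∀ i j, pd i (X.1 j) = 0

/-- A two-form with constant coefficients. -/
def IsConstO (w : Odd) : Prop := ∀ i j k, pd i (w.1 j k) = 0

set_option maxHeartbeats 2000000 in
-- Elements of `L_-` have constant coefficients. The inductive construction of the induced module
-- only commutes operators past elements of `L_-`, so Jacobi identities with one constant argument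
-- are enough.
theorem jacobi_even_even_odd (X Y : Even) {d : Odd} (hd : IsConstO d) :
    bracketEO (bracketEE X Y) d = bracketEO X (bracketEO Y d) - bracketEO Y (bracketEO X d) := by
  apply Subtype.ext
  funext i j
  simp only [bracketEO, bracketEE, Submodule.coe_sub, Pi.sub_apply, Fin.sum_univ_five, map_add,
    map_sub, Derivation.leibniz, smul_eq_mul, hd _ _ _, mul_zero, zero_add, pd_comm i, pd_comm j]
  ring

theorem odd_swap_literal (w : Odd) : w.1 1 0 = - w.1 0 1 ∧ w.1 2 0 = - w.1 0 2 ∧ w.1 2 1 = - w.1 1 2 ∧ w.1 3 0 = - w.1 0 3 ∧ w.1 3 1 = - w.1 1 3 ∧ w.1 3 2 = - w.1 2 3 ∧ w.1 4 0 = - w.1 0 4 ∧ w.1 4 1 = - w.1 1 4 ∧ w.1 4 2 = - w.1 2 4 ∧ w.1 4 3 = - w.1 3 4 :=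
  ⟨odd_swap w _ _, odd_swap w _ _, odd_swap w _ _, odd_swap w _ _, odd_swap w _ _, odd_swap w _ _, odd_swap w _ _, odd_swap w _ _, odd_swap w _ _, odd_swap w _ _⟩

theorem odd_diag (w : Odd) (i : Fin 5) : w.1 i i = 0 := by
  have h := odd_swap w i i
  rw [eq_neg_iff_add_eq_zero, ← two_smul ℂ, smul_eq_zero] at h
  exact h.resolve_left two_ne_zero

theorem odd_closed_literal (w : Odd) : pd 0 (w.1 1 2) = pd 1 (w.1 0 2) - pd 2 (w.1 0 1) ∧ pd 0 (w.1 1 3) = pd 1 (w.1 0 3) - pd 3 (w.1 0 1) ∧ pd 0 (w.1 1 4) = pd 1 (w.1 0 4) - pd 4 (w.1 0 1) ∧ pd 0 (w.1 2 3) = pd 2 (w.1 0 3) - pd 3 (w.1 0 2) ∧ pd 0 (w.1 2 4) = pd 2 (w.1 0 4) - pd 4 (w.1 0 2) ∧ pd 0 (w.1 3 4) = pd 3 (w.1 0 4) - pd 4 (w.1 0 3) ∧ pd 1 (w.1 2 3) = pd 2 (w.1 1 3) - pd 3 (w.1 1 2) ∧ pd 1 (w.1 2 4) = pd 2 (w.1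 1 4) - pd 4 (w.1 1 2) ∧ pd 1 (w.1 3 4) = pd 3 (w.1 1 4) - pd 4 (w.1 1 3) ∧ pd 2 (w.1 3 4) = pd 3 (w.1 2 4) - pd 4 (w.1 2 3) := by
  have h : ∀ i j k, pd i (w.1 j k) = pd j (w.1 i k) - pd k (w.1 i j) := by
    intro i j k
    have e : pd j (w.1 k i) = - pd j (w.1 i k) := by rw [odd_swap w k i, map_neg]
    linear_combination odd_closed w i j k - e
  exact ⟨h _ _ _, h _ _ _, h _ _ _, h _ _ _, h _ _ _, h _ _ _, h _ _ _, h _ _ _, h _ _ _, h _ _ _⟩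

set_option linter.unusedSimpArgs false in
set_option maxHeartbeats 2000000 in
-- The two sides differ, componentwise and up to sign, by `div X` times `[w, d]`; this is the place
-- where zero divergence is indispensable.
theorem jacobi_even_odd_odd (X : Even) (w : Odd) {d : Odd} (hd : IsConstO d) :
    bracketEE X (bracketOO w d) = bracketOO (bracketEO X w) d + bracketOO w (bracketEO X d) := by
  apply Subtype.ext
  have hX : ∑ i, pd i (X.1 i) = 0 := X.2
  simp only [Fin.sum_univ_five] at hX
  obtain ⟨a1, a2, a3, a4, a5, a6, a7, a8, a9, a10⟩ := odd_swap_literal w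
  obtain ⟨b1, b2, b3, b4, b5, b6, b7, b8, b9, b10⟩ := odd_swap_literal d
  funext t
  rw [Submodule.coe_add, Pi.add_apply, bracketOO_apply (bracketEO X w) d, bracketOO_apply w (bracketEO X d)]
  change ∑ j, (X.1 j * pd j ((bracketOO w d).1 t) - (bracketOO w d).1 j * pd j (X.1 t)) = _
  rw [bracketOO_apply w d]
  fin_cases t
  all_goals
    simp [wedge, bracketEO, Fin.sum_univ_five, Derivation.leibniz, hd _ _ _, odd_diag,
      a1, a2, a3, a4, a5, a6, a7, a8, a9, a10, b1, b2, b3, b4, b5, b6, b7, b8, b9, b10]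
  · linear_combination -(w.1 1 2 * d.1 3 4 - w.1 1 3 * d.1 2 4 + w.1 1 4 * d.1 2 3 +
      w.1 2 3 * d.1 1 4 - w.1 2 4 * d.1 1 3 + w.1 3 4 * d.1 1 2) * hX
  · linear_combination (w.1 0 2 * d.1 3 4 - w.1 0 3 * d.1 2 4 + w.1 0 4 * d.1 2 3 +
      w.1 2 3 * d.1 0 4 - w.1 2 4 * d.1 0 3 + w.1 3 4 * d.1 0 2) * hX
  · linear_combination -(w.1 0 1 * d.1 3 4 - w.1 0 3 * d.1 1 4 + w.1 0 4 * d.1 1 3 +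
      w.1 1 3 * d.1 0 4 - w.1 1 4 * d.1 0 3 + w.1 3 4 * d.1 0 1) * hX
  · linear_combination (w.1 0 1 * d.1 2 4 - w.1 0 2 * d.1 1 4 + w.1 0 4 * d.1 1 2 +
      w.1 1 2 * d.1 0 4 - w.1 1 4 * d.1 0 2 + w.1 2 4 * d.1 0 1) * hX
  · linear_combination -(w.1 0 1 * d.1 2 3 - w.1 0 2 * d.1 1 3 + w.1 0 3 * d.1 1 2 +
      w.1 1 2 * d.1 0 3 - w.1 1 3 * d.1 0 2 + w.1 2 3 * d.1 0 1) * hX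

set_option linter.unusedSimpArgs false in
set_option maxHeartbeats 4000000 in
-- This rests on closedness of `v` and `w`. Once the derivatives `∂_i w_{jk}` with `i < j < k` are
-- eliminated through it, and all indices are ordered by antisymmetry, a polynomial identity
-- remains.
theorem jacobi_odd_odd_odd (v w : Odd) {d : Odd} (hd : IsConstO d) :
    bracketEO (bracketOO v w) d + bracketEO (bracketOO v d) w + bracketEO (bracketOO w d) v = 0 := by
  have red : ∀ u : Odd, (∀ i j : Fin 5, i < j → u.1 i j = 0) → u = 0 := by
    intro u hu
    apply Subtype.ext
    funext i j
    rcases lt_trichotomy i j with h | rfl | h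
    · exact hu i j h
    · exact odd_diag u i
    · rw [odd_swap u, hu j i h, neg_zero]
      rfl
  apply red
  obtain ⟨a1, a2, a3, a4, a5, a6, a7, a8, a9, a10⟩ := odd_swap_literal w
  obtain ⟨b1, b2, b3, b4, b5, b6, b7, b8, b9, b10⟩ := odd_swap_literal d
  obtain ⟨c1, c2, c3, c4, c5, c6, c7, c8, c9, c10⟩ := odd_swap_literal v
  obtain ⟨x1, x2, x3, x4, x5, x6, x7, x8, x9, x10⟩ := odd_closed_literal w
  obtain ⟨y1, y2, y3, y4, y5, y6, y7, y8, y9, y10⟩ := odd_closed_literal v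
  intro i j hij
  simp only [bracketEO, Submodule.coe_add, Pi.add_apply, bracketOO_apply, Fin.sum_univ_five]
  fin_cases i <;> fin_cases j <;> first | (exfalso; revert hij; decide) | skip
  all_goals
    clear hij
    simp [wedge, Derivation.leibniz, hd _ _ _, odd_diag,
      a1, a2, a3, a4, a5, a6, a7, a8, a9, a10, b1, b2, b3, b4, b5, b6, b7, b8, b9, b10,
      c1, c2, c3, c4, c5, c6, c7, c8, c9, c10, x1, x2, x3, x4, x5, x6, x7, x8, x9, x10,
      y1, y2, y3, y4, y5, y6, y7, y8, y9, y10]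
    ring

theorem bracketEE_comm_const {X Y : Even} (hX : IsConstE X) (hY : IsConstE Y) (Z : Even) :
    bracketEE (bracketEE Z X) Y = bracketEE (bracketEE Z Y) X := by
  apply Subtype.ext
  funext i
  simp only [bracketEE, Fin.sum_univ_five, map_add, Derivation.leibniz, smul_eq_mul,
    hX _ _, hY _ _, mul_zero, zero_sub, map_neg, add_zero, pd_comm 1 0, pd_comm 2 0, pd_comm 3 0,
    pd_comm 4 0, pd_comm 2 1, pd_comm 3 1, pd_comm 4 1, pd_comm 3 2, pd_comm 4 2, pd_comm 4 3]
  ring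

theorem bracketEO_comm_const {X Y : Even} (hX : IsConstE X) (hY : IsConstE Y) (w : Odd) :
    bracketEO X (bracketEO Y w) = bracketEO Y (bracketEO X w) := by
  apply Subtype.ext
  funext i j
  simp only [bracketEO, Fin.sum_univ_five, map_add, Derivation.leibniz, smul_eq_mul,
    hX _ _, hY _ _, mul_zero, zero_mul, add_zero, pd_comm 1 0, pd_comm 2 0, pd_comm 3 0,
    pd_comm 4 0, pd_comm 2 1, pd_comm 3 1, pd_comm 4 1, pd_comm 3 2, pd_comm 4 2, pd_comm 4 3]
  ring

theorem bracketEE_const {X Y : Even} (hX : IsConstE X) (hY : IsConstE Y) : bracketEE X Y = 0 := by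
  apply Subtype.ext
  funext i
  simp [bracketEE, hX _ _, hY _ _]

theorem bracketEO_const {X : Even} {w : Odd} (hX : IsConstE X) (hw : IsConstO w) :
    bracketEO X w = 0 := by
  apply Subtype.ext
  funext i j
  simp [bracketEO, hX _ _, hw _ _]

theorem bracketOO_const {v w : Odd} (hv : IsConstO v) (hw : IsConstO w) :
    IsConstE (bracketOO v w) := by
  intro i j
  rw [bracketOO_apply]
  fin_cases j <;> simp [wedge, hv _ _, hw _ _]

theorem bracketEE_swap (X Y : Even) : bracketEE X Y = - bracketEE Y X := by
  apply Subtype.ext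
  funext i
  simp only [bracketEE, Submodule.coe_neg, Pi.neg_apply, ← Finset.sum_neg_distrib, neg_sub]

theorem bracketOO_swap (v w : Odd) : bracketOO v w = bracketOO w v := by
  apply Subtype.ext
  rw [bracketOO_apply, bracketOO_apply]
  have h : ∀ i j k l, wedge v.1 w.1 i j k l = wedge w.1 v.1 i j k l := by
    intro i j k l
    simp only [wedge]
    ring
  simp only [h]

/-- The commutator of vector fields as a bilinear map. -/
def bilEE : Even →ₗ[ℂ] Even →ₗ[ℂ] Even :=
  LinearMap.mk₂ ℂ bracketEE
    (fun X X' Y => Subtype.ext <| funext fun i => by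
      simp only [bracketEE, Submodule.coe_add, Pi.add_apply, map_add, Fin.sum_univ_five]
      ring)
    (fun c X Y => Subtype.ext <| funext fun i => by
      simp only [bracketEE, Submodule.coe_smul, Pi.smul_apply, Derivation.map_smul,
        Finset.smul_sum, smul_sub, smul_mul_assoc, mul_smul_comm])
    (fun X Y Y' => Subtype.ext <| funext fun i => by
      simp only [bracketEE, Submodule.coe_add, Pi.add_apply, map_add, Fin.sum_univ_five]
      ring)
    (fun c X Y => Subtype.ext <| funext fun i => by
      simp only [bracketEE, Submodule.coe_smul, Pi.smul_apply, Derivation.map_smul,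
        Finset.smul_sum, smul_sub, smul_mul_assoc, mul_smul_comm])

/-- The Lie derivative as a bilinear map. -/
def bilEO : Even →ₗ[ℂ] Odd →ₗ[ℂ] Odd :=
  LinearMap.mk₂ ℂ bracketEO
    (fun X X' w => Subtype.ext <| funext fun i => funext fun j => by
      simp only [bracketEO, Submodule.coe_add, Pi.add_apply, map_add, Fin.sum_univ_five]
      ring)
    (fun c X w => Subtype.ext <| funext fun i => funext fun j => by
      simp only [bracketEO, Submodule.coe_smul, Pi.smul_apply, Derivation.map_smul,
        Finset.smul_sum, smul_add, smul_mul_assoc])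
    (fun X w w' => Subtype.ext <| funext fun i => funext fun j => by
      simp only [bracketEO, Submodule.coe_add, Pi.add_apply, map_add, Fin.sum_univ_five]
      ring)
    (fun c X w => Subtype.ext <| funext fun i => funext fun j => by
      simp only [bracketEO, Submodule.coe_smul, Pi.smul_apply, Derivation.map_smul,
        Finset.smul_sum, smul_add, mul_smul_comm])

/-- The bracket of two-forms as a bilinear map. -/
def bilOO : Odd →ₗ[ℂ] Odd →ₗ[ℂ] Even :=
  LinearMap.mk₂ ℂ bracketOO
    (fun v v' w => Subtype.ext <| by
      simp only [Submodule.coe_add, bracketOO_apply, wedge, Pi.add_apply]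
      funext i
      fin_cases i <;> simp <;> ring)
    (fun c v w => Subtype.ext <| by
      simp only [Submodule.coe_smul, bracketOO_apply, wedge, Pi.smul_apply, smul_mul_assoc]
      funext i
      fin_cases i <;> simp [smul_add, smul_sub])
    (fun v w w' => Subtype.ext <| by
      simp only [Submodule.coe_add, bracketOO_apply, wedge, Pi.add_apply]
      funext i
      fin_cases i <;> simp <;> ring)
    (fun c v w => Subtype.ext <| by
      simp only [Submodule.coe_smul, bracketOO_apply, wedge, Pi.smul_apply, mul_smul_comm]
      funext i
      fin_cases i <;> simp [smul_add, smul_sub])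

theorem bilEE_apply (X Y : Even) : bilEE X Y = bracketEE X Y := rfl

theorem bilEO_apply (X : Even) (w : Odd) : bilEO X w = bracketEO X w := rfl

theorem bilOO_apply (v w : Odd) : bilOO v w = bracketOO v w := rfl

set_option linter.unusedSimpArgs false in
theorem jacobi_even_even_const (X Y : Even) {A : Even} (hA : IsConstE A) :
    bracketEE (bracketEE X Y) A = bracketEE X (bracketEE Y A) - bracketEE Y (bracketEE X A) := by
  apply Subtype.ext
  funext i
  simp only [bracketEE, Submodule.coe_sub, Pi.sub_apply, Fin.sum_univ_five, map_add, map_sub,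
    map_neg, Derivation.leibniz, smul_eq_mul, hA _ _, mul_zero, zero_add, zero_sub, add_zero,
    pd_comm 1 0, pd_comm 2 0, pd_comm 3 0,
    pd_comm 4 0, pd_comm 2 1, pd_comm 3 1, pd_comm 4 1, pd_comm 3 2, pd_comm 4 2, pd_comm 4 3]
  ring

set_option linter.unusedSimpArgs false in
set_option maxHeartbeats 1000000 in
theorem jacobi_even_const_odd (X : Even) (w : Odd) {A : Even} (hA : IsConstE A) :
    bracketEO A (bracketEO X w) = bracketEO (bracketEE A X) w + bracketEO X (bracketEO A w) := by
  apply Subtype.ext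
  funext i j
  simp only [bracketEE, bracketEO, Submodule.coe_add, Pi.add_apply, Fin.sum_univ_five, map_add,
    map_sub, map_zero, Derivation.leibniz, smul_eq_mul, hA _ _, mul_zero, zero_mul, zero_add, sub_zero,
    add_zero, pd_comm i, pd_comm j]
  simp only [pd_comm 1 0, pd_comm 2 0, pd_comm 3 0,
    pd_comm 4 0, pd_comm 2 1, pd_comm 3 1, pd_comm 4 1, pd_comm 3 2, pd_comm 4 2, pd_comm 4 3]
  ring

set_option linter.unusedSimpArgs false in
theorem jacobi_const_odd_odd (v w : Odd) {A : Even} (hA : IsConstE A) :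
    bracketEE A (bracketOO v w) = bracketOO (bracketEO A v) w + bracketOO v (bracketEO A w) := by
  apply Subtype.ext
  funext t
  rw [Submodule.coe_add, Pi.add_apply, bracketOO_apply (bracketEO A v) w,
    bracketOO_apply v (bracketEO A w)]
  change ∑ j, (A.1 j * pd j ((bracketOO v w).1 t) - (bracketOO v w).1 j * pd j (A.1 t)) = _
  rw [bracketOO_apply v w]
  fin_cases t
  all_goals
    simp [wedge, bracketEO, Fin.sum_univ_five, Derivation.leibniz, hA _ _]
    ring

/-! ### The universal enveloping algebra of `L_-` -/

/-- The constant vector fields. -/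
def negE : Submodule ℂ Even where
  carrier := {X | IsConstE X}
  add_mem' {X Y} hX hY i j := by simp [hX i j, hY i j]
  zero_mem' i j := by simp
  smul_mem' c X hX i j := by simp [hX i j]

/-- The two-forms with constant coefficients. -/
def negO : Submodule ℂ Odd where
  carrier := {w | IsConstO w}
  add_mem' {v w} hv hw i j k := by simp [hv i j k, hw i j k]
  zero_mem' i j k := by simp
  smul_mem' c w hw i j k := by simp [hw i j k]

/-- The defining relations of the universal enveloping algebra of `L_-`. -/
inductive RelNeg : TensorAlgebra ℂ (negE × negO) → TensorAlgebra ℂ (negE × negO) → Prop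
  | even_even (X Y : negE) :
      RelNeg (TensorAlgebra.ι ℂ (X, 0) * TensorAlgebra.ι ℂ (Y, 0)
        - TensorAlgebra.ι ℂ (Y, 0) * TensorAlgebra.ι ℂ (X, 0)) 0
  | even_odd (X : negE) (w : negO) :
      RelNeg (TensorAlgebra.ι ℂ (X, 0) * TensorAlgebra.ι ℂ (0, w)
        - TensorAlgebra.ι ℂ (0, w) * TensorAlgebra.ι ℂ (X, 0)) 0
  | odd_odd (v w : negO) :
      RelNeg (TensorAlgebra.ι ℂ (0, v) * TensorAlgebra.ι ℂ (0, w)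
        + TensorAlgebra.ι ℂ (0, w) * TensorAlgebra.ι ℂ (0, v))
        (TensorAlgebra.ι ℂ (⟨bracketOO v w, bracketOO_const v.2 w.2⟩, 0))

/-- The universal enveloping algebra of `L_-`. -/
def UNeg : Type := RingQuot RelNeg

instance : Ring UNeg := inferInstanceAs (Ring (RingQuot RelNeg))

instance : Algebra ℂ UNeg := inferInstanceAs (Algebra ℂ (RingQuot RelNeg))

namespace UNeg

/-- The canonical map from constant vector fields. -/
def ιE : negE →ₗ[ℂ] UNeg :=
  (RingQuot.mkAlgHom ℂ RelNeg).toLinearMap ∘ₗ TensorAlgebra.ι ℂ ∘ₗ LinearMap.inl ℂ negE negO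

/-- The canonical map from constant two-forms. -/
def ιO : negO →ₗ[ℂ] UNeg :=
  (RingQuot.mkAlgHom ℂ RelNeg).toLinearMap ∘ₗ TensorAlgebra.ι ℂ ∘ₗ LinearMap.inr ℂ negE negO

theorem ιE_comm (X Y : negE) : ιE X * ιE Y = ιE Y * ιE X := by
  have h := RingQuot.mkAlgHom_rel ℂ (RelNeg.even_even X Y)
  rw [map_sub, map_mul, map_mul, map_zero, sub_eq_zero] at h
  exact h

theorem ιE_ιO_comm (X : negE) (w : negO) : ιE X * ιO w = ιO w * ιE X := by
  have h := RingQuot.mkAlgHom_rel ℂ (RelNeg.even_odd X w)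
  rw [map_sub, map_mul, map_mul, map_zero, sub_eq_zero] at h
  exact h

theorem ιO_anticomm (v w : negO) :
    ιO v * ιO w + ιO w * ιO v = ιE ⟨bracketOO v w, bracketOO_const v.2 w.2⟩ := by
  have h := RingQuot.mkAlgHom_rel ℂ (RelNeg.odd_odd v w)
  rw [map_add, map_mul, map_mul] at h
  exact h

section lift

variable {A : Type*} [Ring A] [Algebra ℂ A] (fE : negE →ₗ[ℂ] A) (fO : negO →ₗ[ℂ] A)
  (h1 : ∀ X Y, fE X * fE Y = fE Y * fE X) (h2 : ∀ X w, fE X * fO w = fO w * fE X)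
  (h3 : ∀ v w, fO v * fO w + fO w * fO v = fE ⟨bracketOO v w, bracketOO_const v.2 w.2⟩)

/-- The universal property of `U(L_-)`. -/
def lift : UNeg →ₐ[ℂ] A :=
  RingQuot.liftAlgHom ℂ ⟨TensorAlgebra.lift ℂ (fE.coprod fO), by
    intro x y h
    cases h with
    | even_even X Y => simp [h1 X Y]
    | even_odd X w => simp [h2 X w]
    | odd_odd v w => simp [h3 v w]⟩

theorem lift_ιE (X : negE) : lift fE fO h1 h2 h3 (ιE X) = fE X := by
  refine (RingQuot.liftAlgHom_mkAlgHom_apply ℂ _ _ _).trans ?_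
  simp

theorem lift_ιO (w : negO) : lift fE fO h1 h2 h3 (ιO w) = fO w := by
  refine (RingQuot.liftAlgHom_mkAlgHom_apply ℂ _ _ _).trans ?_
  simp

end lift

theorem induction {P : UNeg → Prop} (hs : ∀ c : ℂ, P (algebraMap ℂ UNeg c)) (hE : ∀ X, P (ιE X))
    (hO : ∀ w, P (ιO w)) (hadd : ∀ a b, P a → P b → P (a + b))
    (hmul : ∀ a b, P a → P b → P (a * b)) (u : UNeg) : P u := by
  obtain ⟨t, rfl⟩ := RingQuot.mkAlgHom_surjective ℂ RelNeg u
  induction t using TensorAlgebra.induction with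
  | algebraMap c =>
    rw [AlgHom.commutes]
    exact hs c
  | ι x =>
    obtain ⟨X, w⟩ := x
    have : RingQuot.mkAlgHom ℂ RelNeg (TensorAlgebra.ι ℂ (X, w)) = ιE X + ιO w := by
      change _ = RingQuot.mkAlgHom ℂ RelNeg (TensorAlgebra.ι ℂ (X, 0)) +
        RingQuot.mkAlgHom ℂ RelNeg (TensorAlgebra.ι ℂ (0, w))
      rw [← map_add, ← map_add, Prod.mk_add_mk, add_zero, zero_add]
    rw [this]
    exact hadd _ _ (hE X) (hO w)
  | mul a b ha hb =>
    rw [map_mul]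
    exact hmul _ _ ha hb
  | add a b ha hb =>
    rw [map_add]
    exact hadd _ _ ha hb

end UNeg

/-! ### The `L`-module structure on `U(L_-) ⊗ V` -/

/-- The constant part of a vector field. -/
def constE : Even →ₗ[ℂ] negE where
  toFun X := ⟨⟨fun i => MvPowerSeries.C (MvPowerSeries.constantCoeff (X.1 i)), by
    change ∑ i, pd i (MvPowerSeries.C _) = 0
    simp⟩, fun i j => by simp⟩
  map_add' X Y := by
    refine Subtype.ext (Subtype.ext (funext fun i => ?_))
    simp
  map_smul' c X := by
    refine Subtype.ext (Subtype.ext (funext fun i => ?_))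
    simp [MvPowerSeries.smul_eq_C_mul]

/-- The constant part of a two-form. -/
def constO : Odd →ₗ[ℂ] negO where
  toFun w := ⟨⟨fun i j => MvPowerSeries.C (MvPowerSeries.constantCoeff (w.1 i j)), by
    refine ⟨fun i j => ?_, fun i j k => ?_⟩
    · change MvPowerSeries.C (MvPowerSeries.constantCoeff (w.1 i j)) = - MvPowerSeries.C _
      rw [odd_swap w i j, map_neg, map_neg]
    · simp⟩, fun i j k => by simp⟩
  map_add' v w := by
    refine Subtype.ext (Subtype.ext (funext fun i => funext fun j => ?_))
    simp
  map_smul' c w := by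
    refine Subtype.ext (Subtype.ext (funext fun i => funext fun j => ?_))
    simp [MvPowerSeries.smul_eq_C_mul]

theorem eq_C_of_pd_eq_zero {f : PS} (h : ∀ i, pd i f = 0) :
    MvPowerSeries.C (MvPowerSeries.constantCoeff f) = f := by
  ext n
  rw [MvPowerSeries.coeff_C]
  split_ifs with hn
  · rw [hn]
    rfl
  · obtain ⟨i, hi⟩ : ∃ i, n i ≠ 0 := by
      by_contra! hc
      exact hn (Finsupp.ext hc)
    have e := congrArg (MvPowerSeries.coeff (n - Finsupp.single i 1)) (h i)
    rw [MvPowerSeries.coeff_pderiv, tsub_add_cancel_of_le (by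
      simpa [Finsupp.single_le_iff] using Nat.one_le_iff_ne_zero.mpr hi), map_zero] at e
    refine ((mul_eq_zero.mp e).resolve_right ?_).symm
    exact Nat.cast_add_one_ne_zero _

theorem constE_coe (X : negE) : constE X = X := by
  refine Subtype.ext (Subtype.ext (funext fun i => ?_))
  exact eq_C_of_pd_eq_zero fun j => X.2 j i

theorem constO_coe (w : negO) : constO w = w := by
  refine Subtype.ext (Subtype.ext (funext fun i => funext fun j => ?_))
  exact eq_C_of_pd_eq_zero fun k => w.2 k i j

theorem linPart_apply (X : Even) (i j : Fin 5) :
    (linPart X).1 i j = MvPowerSeries.constantCoeff (pd i (X.1 j)) := by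
  change MvPowerSeries.coeff (Finsupp.single i 1) (X.1 j) =
    MvPowerSeries.coeff (R := ℂ) 0 (pd i (X.1 j))
  rw [MvPowerSeries.coeff_pderiv]
  simp

/-- The projection to `L_0` as a linear map. -/
def linPartL : Even →ₗ[ℂ] sl5 where
  toFun := linPart
  map_add' X Y := Subtype.ext <| Matrix.ext fun i j => by
    simp [linPart_apply]
  map_smul' c X := Subtype.ext <| Matrix.ext fun i j => by
    simp [linPart_apply]

theorem linPart_of_const {X : Even} (hX : IsConstE X) : linPart X = 0 :=
  Subtype.ext <| Matrix.ext fun i j => by simp [linPart_apply, hX i j]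

/-- Second derivatives in the bracket are multiplied by coefficients without constant term, so only
products of first derivatives survive at the origin. -/
theorem linPart_bracketEE {X Y : Even} (hX : ∀ i, MvPowerSeries.constantCoeff (X.1 i) = 0)
    (hY : ∀ i, MvPowerSeries.constantCoeff (Y.1 i) = 0) :
    linPart (bracketEE X Y) = ⁅linPart X, linPart Y⁆ := by
  refine Subtype.ext (Matrix.ext fun i j => ?_)
  rw [LieSubalgebra.coe_bracket, Ring.lie_def, Matrix.sub_apply, Matrix.mul_apply, Matrix.mul_apply,
    linPart_apply, ← Finset.sum_sub_distrib]
  simp only [bracketEE, map_sum, map_sub, Derivation.leibniz, smul_eq_mul, map_add, map_mul, hX, hY,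
    zero_mul, zero_add, linPart_apply]
  exact Finset.sum_congr rfl fun k _ => by ring

/-- Both arguments have degree at least 1, so their bracket has degree at least 2 and no component
in `L_0`. -/
theorem linPart_bracketOO_of_nonneg {v w : Odd}
    (hv : ∀ i j, MvPowerSeries.constantCoeff (v.1 i j) = 0)
    (hw : ∀ i j, MvPowerSeries.constantCoeff (w.1 i j) = 0) :
    linPart (bracketOO v w) = 0 := by
  refine Subtype.ext (Matrix.ext fun i j => ?_)
  rw [linPart_apply, bracketOO_apply]
  fin_cases j <;> simp [wedge, Derivation.leibniz, hv, hw]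

section Induced

variable (V : Type*) [AddCommGroup V] [Module ℂ V]

/-- The vector space `U(L_-) ⊗ V`, which carries the induced `L`-module. -/
def Ind : Type _ := UNeg ⊗[ℂ] V

instance : AddCommGroup (Ind V) := inferInstanceAs (AddCommGroup (UNeg ⊗[ℂ] V))

instance : Module ℂ (Ind V) := inferInstanceAs (Module ℂ (UNeg ⊗[ℂ] V))

instance : Module UNeg (Ind V) := inferInstanceAs (Module UNeg (UNeg ⊗[ℂ] V))

instance : IsScalarTower ℂ UNeg (Ind V) := inferInstanceAs (IsScalarTower ℂ UNeg (UNeg ⊗[ℂ] V))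

instance : SMulCommClass ℂ UNeg (Ind V) := inferInstanceAs (SMulCommClass ℂ UNeg (UNeg ⊗[ℂ] V))

/-- The space `Hom(L, U(L_-) ⊗ V)`. -/
abbrev HomL : Type _ := (Even →ₗ[ℂ] Ind V) × (Odd →ₗ[ℂ] Ind V)

namespace Ind

variable {V}

/-- The element `u ⊗ v`. -/
def mk : UNeg →ₗ[ℂ] V →ₗ[ℂ] Ind V := TensorProduct.mk ℂ UNeg V

theorem smul_mk (u u' : UNeg) (v : V) : u • mk u' v = mk (u * u') v :=
  TensorProduct.smul_tmul' u u' v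

theorem induction_mk {P : Ind V → Prop} (h0 : P 0) (h1 : ∀ u v, P (mk u v))
    (hadd : ∀ a b, P a → P b → P (a + b)) (n : Ind V) : P n :=
  TensorProduct.induction_on n h0 h1 hadd

theorem induction {P : Ind V → Prop} (h1 : ∀ v, P (mk 1 v))
    (hadd : ∀ a b, P a → P b → P (a + b)) (hsmul : ∀ (c : ℂ) a, P a → P (c • a))
    (hE : ∀ X a, P a → P (UNeg.ιE X • a)) (hO : ∀ w a, P a → P (UNeg.ιO w • a)) (n : Ind V) :
    P n := by
  have key : ∀ u : UNeg, ∀ a, P a → P (u • a) := by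
    intro u
    induction u using UNeg.induction with
    | hs c =>
      intro a ha
      rw [algebraMap_smul]
      exact hsmul c a ha
    | hE X => exact hE X
    | hO w => exact hO w
    | hadd x y hx hy =>
      intro a ha
      rw [add_smul]
      exact hadd _ _ (hx a ha) (hy a ha)
    | hmul x y hx hy =>
      intro a ha
      rw [mul_smul]
      exact hx _ (hy a ha)
  refine induction_mk ?_ (fun u v => ?_) hadd n
  · have := hsmul 0 _ (h1 0)
    rwa [zero_smul] at this
  · have := key u _ (h1 v)
    rwa [smul_mk, mul_one] at this

/-- The action of constant vector fields on `Hom(L, U(L_-) ⊗ V)`. -/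
def homE : negE →ₗ[ℂ] HomL V →ₗ[ℂ] HomL V :=
  LinearMap.mk₂ ℂ
    (fun X f => (f.1 ∘ₗ bilEE.flip X.1 + Algebra.lsmul ℂ ℂ (Ind V) (UNeg.ιE X) ∘ₗ f.1,
      - f.2 ∘ₗ bilEO X.1 + Algebra.lsmul ℂ ℂ (Ind V) (UNeg.ιE X) ∘ₗ f.2))
    (fun X X' f => by
      refine Prod.ext (LinearMap.ext fun Z => ?_) (LinearMap.ext fun w => ?_)
      · simp
        abel
      · simp
        abel)
    (fun c X f => by
      refine Prod.ext (LinearMap.ext fun Z => ?_) (LinearMap.ext fun w => ?_) <;> simp)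
    (fun X f f' => by
      refine Prod.ext (LinearMap.ext fun Z => ?_) (LinearMap.ext fun w => ?_)
      · simp
        abel
      · simp
        abel)
    (fun c X f => by
      refine Prod.ext (LinearMap.ext fun Z => ?_) (LinearMap.ext fun w => ?_) <;>
        simp [smul_comm c])

/-- The action of constant two-forms on `Hom(L, U(L_-) ⊗ V)`. -/
def homO : negO →ₗ[ℂ] HomL V →ₗ[ℂ] HomL V :=
  LinearMap.mk₂ ℂ
    (fun w f => (f.2 ∘ₗ bilEO.flip w.1 + Algebra.lsmul ℂ ℂ (Ind V) (UNeg.ιO w) ∘ₗ f.1,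
      f.1 ∘ₗ bilOO.flip w.1 - Algebra.lsmul ℂ ℂ (Ind V) (UNeg.ιO w) ∘ₗ f.2))
    (fun X X' f => by
      refine Prod.ext (LinearMap.ext fun Z => ?_) (LinearMap.ext fun w => ?_)
      · simp
        abel
      · simp
        abel)
    (fun c X f => by
      refine Prod.ext (LinearMap.ext fun Z => ?_) (LinearMap.ext fun w => ?_)
      · simp
      · simp [smul_sub])
    (fun X f f' => by
      refine Prod.ext (LinearMap.ext fun Z => ?_) (LinearMap.ext fun w => ?_)
      · simp
        abel
      · simp
        abel)
    (fun c X f => by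
      refine Prod.ext (LinearMap.ext fun Z => ?_) (LinearMap.ext fun w => ?_)
      · simp [smul_comm c]
      · simp [smul_comm c, smul_sub])

/-- For `f` of the form `a ↦ a n`, these four formulas are the values of `a ↦ a(yn) = [a,y]n ±
y(an)` with `y` in `L_-`; the minus sign occurs when `a` and `y` are both odd. -/
theorem homE_fst (X : negE) (f : HomL V) (Z : Even) :
    (homE X f).1 Z = f.1 (bracketEE Z X) + UNeg.ιE X • f.1 Z := rfl

theorem homE_snd (X : negE) (f : HomL V) (w : Odd) :
    (homE X f).2 w = - f.2 (bracketEO X w) + UNeg.ιE X • f.2 w := rfl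

theorem homO_fst (v : negO) (f : HomL V) (Z : Even) :
    (homO v f).1 Z = f.2 (bracketEO Z v) + UNeg.ιO v • f.1 Z := rfl

theorem homO_snd (v : negO) (f : HomL V) (w : Odd) :
    (homO v f).2 w = f.1 (bracketOO w v) - UNeg.ιO v • f.2 w := rfl

/-- This and the next two lemmas are the defining relations of `U(L_-)` for the operators on `Hom(L,
U(L_-) ⊗ V)`. Each is a Jacobi identity in which two of the arguments are constant. -/
theorem homE_comm (X Y : negE) (f : HomL V) : homE X (homE Y f) = homE Y (homE X f) := by
  refine Prod.ext (LinearMap.ext fun Z => ?_) (LinearMap.ext fun w => ?_)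
  · simp only [homE_fst, bracketEE_comm_const X.2 Y.2 Z, smul_add, ← mul_smul, UNeg.ιE_comm X Y]
    abel
  · simp only [homE_snd, bracketEO_comm_const X.2 Y.2 w, smul_add, smul_neg, neg_add, neg_neg,
      ← mul_smul, UNeg.ιE_comm X Y]
    abel

theorem homE_homO_comm (X : negE) (v : negO) (f : HomL V) :
    homE X (homO v f) = homO v (homE X f) := by
  refine Prod.ext (LinearMap.ext fun Z => ?_) (LinearMap.ext fun w => ?_)
  · have h := jacobi_even_even_odd Z X v.2
    rw [bracketEO_const X.2 v.2] at h
    have h0 : bracketEO Z 0 = 0 := (bilEO Z).map_zero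
    rw [h0, zero_sub] at h
    simp only [homE_fst, homO_fst, homE_snd, h, map_neg, smul_add, ← mul_smul, UNeg.ιE_ιO_comm X v]
    abel
  · have h := jacobi_even_odd_odd X w v.2
    rw [bracketEO_const X.2 v.2] at h
    have h0 : bracketOO w 0 = 0 := (bilOO w).map_zero
    rw [h0, add_zero] at h
    simp only [homE_fst, homO_snd, homE_snd, bracketEE_swap (bracketOO w v), h, map_neg, smul_add,
      smul_sub, smul_neg, ← mul_smul, UNeg.ιE_ιO_comm X v]
    abel

theorem homO_anticomm (v w : negO) (f : HomL V) :
    homO v (homO w f) + homO w (homO v f) = homE ⟨bracketOO v w, bracketOO_const v.2 w.2⟩ f := by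
  refine Prod.ext (LinearMap.ext fun Z => ?_) (LinearMap.ext fun u => ?_)
  · have h := jacobi_even_odd_odd Z v.1 w.2
    rw [Prod.fst_add, LinearMap.add_apply]
    simp only [homO_fst, homO_snd, homE_fst, h, map_add, ← UNeg.ιO_anticomm, add_smul, mul_smul,
      smul_add, bracketOO_swap v.1 (bracketEO Z w.1)]
    abel
  · have h := jacobi_odd_odd_odd u v.1 w.2
    rw [Prod.snd_add, LinearMap.add_apply]
    have e : - f.2 (bracketEO (bracketOO v w) u) = f.2 (bracketEO (bracketOO u v) w) +
        f.2 (bracketEO (bracketOO u w) v) := by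
      rw [← map_add, ← map_neg]
      congr 1
      rw [neg_eq_iff_add_eq_zero, ← h]
      abel
    simp only [homO_fst, homO_snd, homE_snd, e, ← UNeg.ιO_anticomm, add_smul, mul_smul,
      smul_sub]
    abel

/-- The action of `U(L_-)` on `Hom(L, U(L_-) ⊗ V)`. -/
def homAct : UNeg →ₐ[ℂ] Module.End ℂ (HomL V) :=
  UNeg.lift homE homO (fun X Y => LinearMap.ext fun f => homE_comm X Y f)
    (fun X w => LinearMap.ext fun f => homE_homO_comm X w f)
    (fun v w => LinearMap.ext fun f => homO_anticomm v w f)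

variable [LieRingModule sl5 V] [LieModule ℂ sl5 V]

/-- The action of `L` on `1 ⊗ V`. -/
def base : V →ₗ[ℂ] HomL V where
  -- On `1 ⊗ v` the constant part acts by multiplication in `U(L_-)`, the linear part of a vector
  -- field through `𝔰𝔩₅`, and all remaining coefficients act by zero.
  toFun v := (mk.flip v ∘ₗ UNeg.ιE ∘ₗ constE +
      mk 1 ∘ₗ ((LieModule.toEnd ℂ sl5 V : sl5 →ₗ[ℂ] Module.End ℂ V).flip v) ∘ₗ linPartL,
    mk.flip v ∘ₗ UNeg.ιO ∘ₗ constO)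
  map_add' v v' := by
    refine Prod.ext (LinearMap.ext fun Z => ?_) (LinearMap.ext fun u => ?_)
    · simp
      abel
    · simp
  map_smul' c v := by
    refine Prod.ext (LinearMap.ext fun Z => ?_) (LinearMap.ext fun u => ?_) <;> simp

/-- The action of `L` on `U(L_-) ⊗ V`, as a map from `U(L_-) ⊗ V`. -/
def toHomL : Ind V →ₗ[ℂ] HomL V :=
  TensorProduct.lift (homAct.toLinearMap.compl₂ base)

theorem toHomL_mk (u : UNeg) (v : V) : toHomL (mk u v) = homAct u (base v) := rfl

theorem toHomL_smul (u : UNeg) (n : Ind V) : toHomL (u • n) = homAct u (toHomL n) := by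
  induction n using induction_mk with
  | h0 => simp
  | h1 u' v =>
    rw [smul_mk, toHomL_mk, map_mul]
    rfl
  | hadd a b ha hb => rw [smul_add, map_add, ha, hb, map_add, map_add]

/-- The action of vector fields on `U(L_-) ⊗ V`. -/
def actE : Even →ₗ[ℂ] Module.End ℂ (Ind V) := (LinearMap.fst ℂ _ _ ∘ₗ toHomL).flip

/-- The action of two-forms on `U(L_-) ⊗ V`. -/
def actO : Odd →ₗ[ℂ] Module.End ℂ (Ind V) := (LinearMap.snd ℂ _ _ ∘ₗ toHomL).flip

theorem actE_ιO (Z : Even) (w : negO) (n : Ind V) :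
    actE Z (UNeg.ιO w • n) = actO (bracketEO Z w) n + UNeg.ιO w • actE Z n := by
  change (toHomL (UNeg.ιO w • n)).1 Z = _
  rw [toHomL_smul, homAct, UNeg.lift_ιO]
  rfl

theorem actO_ιO (v : Odd) (w : negO) (n : Ind V) :
    actO v (UNeg.ιO w • n) = actE (bracketOO v w) n - UNeg.ιO w • actO v n := by
  change (toHomL (UNeg.ιO w • n)).2 v = _
  rw [toHomL_smul, homAct, UNeg.lift_ιO]
  rfl

theorem actE_ιE (Z : Even) (X : negE) (n : Ind V) :
    actE Z (UNeg.ιE X • n) = actE (bracketEE Z X) n + UNeg.ιE X • actE Z n := by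
  change (toHomL (UNeg.ιE X • n)).1 Z = _
  rw [toHomL_smul, homAct, UNeg.lift_ιE]
  rfl

theorem actO_ιE (v : Odd) (X : negE) (n : Ind V) :
    actO v (UNeg.ιE X • n) = - actO (bracketEO X v) n + UNeg.ιE X • actO v n := by
  change (toHomL (UNeg.ιE X • n)).2 v = _
  rw [toHomL_smul, homAct, UNeg.lift_ιE]
  rfl

theorem actE_mk_one (Z : Even) (v : V) :
    actE Z (mk 1 v) = mk (UNeg.ιE (constE Z)) v + mk 1 ⁅linPart Z, v⁆ := by
  change (toHomL (mk 1 v)).1 Z = _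
  rw [toHomL_mk, map_one]
  rfl

theorem actO_mk_one (w : Odd) (v : V) : actO w (mk 1 v) = mk (UNeg.ιO (constO w)) v := by
  change (toHomL (mk 1 v)).2 w = _
  rw [toHomL_mk, map_one]
  rfl

/-- Elements of `L_-` act on `U(L_-) ⊗ V` both as elements of `L` and by left multiplication. The
two actions agree on `1 ⊗ V`, and the recursion for a product with a generator propagates the
agreement. -/
theorem act_const (n : Ind V) :
    (∀ X : negE, actE X.1 n = UNeg.ιE X • n) ∧ (∀ w : negO, actO w.1 n = UNeg.ιO w • n) := by
  induction n using Ind.induction with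
  | h1 v =>
    refine ⟨fun X => ?_, fun w => ?_⟩
    · rw [actE_mk_one, constE_coe, linPart_of_const X.2, zero_lie, map_zero, add_zero, smul_mk,
        mul_one]
    · rw [actO_mk_one, constO_coe, smul_mk, mul_one]
  | hadd a b ha hb =>
    refine ⟨fun X => ?_, fun w => ?_⟩
    · rw [map_add, ha.1, hb.1, smul_add]
    · rw [map_add, ha.2, hb.2, smul_add]
  | hsmul c a ha =>
    refine ⟨fun X => ?_, fun w => ?_⟩
    · rw [map_smul, ha.1, smul_comm]
    · rw [map_smul, ha.2, smul_comm]
  | hE Y a ha =>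
    refine ⟨fun X => ?_, fun w => ?_⟩
    · rw [actE_ιE, bracketEE_const X.2 Y.2, map_zero, LinearMap.zero_apply, zero_add, ha.1,
        ← mul_smul, ← mul_smul, UNeg.ιE_comm]
    · rw [actO_ιE, bracketEO_const Y.2 w.2, map_zero, LinearMap.zero_apply, neg_zero, zero_add,
        ha.2, ← mul_smul, ← mul_smul, UNeg.ιE_ιO_comm]
  | hO v a ha =>
    refine ⟨fun X => ?_, fun w => ?_⟩
    · rw [actE_ιO, bracketEO_const X.2 v.2, map_zero, LinearMap.zero_apply, zero_add, ha.1,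
        ← mul_smul, ← mul_smul, UNeg.ιE_ιO_comm]
    · rw [actO_ιO, ha.2, ha.1 ⟨bracketOO w v, bracketOO_const w.2 v.2⟩, ← UNeg.ιO_anticomm,
        add_smul, mul_smul, mul_smul, add_sub_cancel_right]

theorem actE_constE (X : negE) (n : Ind V) : actE X.1 n = UNeg.ιE X • n := (act_const n).1 X

theorem actO_constO (w : negO) (n : Ind V) : actO w.1 n = UNeg.ιO w • n := (act_const n).2 w

end Ind

end Induced

/-! ### The super commutation relations on the induced module -/

namespace Ind

variable {V : Type*} [AddCommGroup V] [Module ℂ V] [LieRingModule sl5 V] [LieModule ℂ sl5 V]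

theorem constantCoeff_sub_constE (X : Even) (i : Fin 5) :
    MvPowerSeries.constantCoeff ((X - (constE X).1).1 i) = 0 := by
  change MvPowerSeries.constantCoeff (X.1 i - MvPowerSeries.C _) = 0
  rw [map_sub, MvPowerSeries.constantCoeff_C, sub_self]

theorem constantCoeff_sub_constO (w : Odd) (i j : Fin 5) :
    MvPowerSeries.constantCoeff ((w - (constO w).1).1 i j) = 0 := by
  change MvPowerSeries.constantCoeff (w.1 i j - MvPowerSeries.C _) = 0
  rw [map_sub, MvPowerSeries.constantCoeff_C, sub_self]

theorem constE_of_nonneg {X : Even} (hX : ∀ i, MvPowerSeries.constantCoeff (X.1 i) = 0) :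
    constE X = 0 := by
  refine Subtype.ext (Subtype.ext (funext fun i => ?_))
  change MvPowerSeries.C (MvPowerSeries.constantCoeff (X.1 i)) = 0
  rw [hX, map_zero]

theorem constO_of_nonneg {w : Odd} (hw : ∀ i j, MvPowerSeries.constantCoeff (w.1 i j) = 0) :
    constO w = 0 := by
  refine Subtype.ext (Subtype.ext (funext fun i => funext fun j => ?_))
  change MvPowerSeries.C (MvPowerSeries.constantCoeff (w.1 i j)) = 0
  rw [hw, map_zero]

theorem exists_constE_add (X : Even) : ∃ (A : negE) (Y : Even),
    (∀ i, MvPowerSeries.constantCoeff (Y.1 i) = 0) ∧ X = A.1 + Y :=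
  ⟨constE X, X - (constE X).1, constantCoeff_sub_constE X, by abel⟩

theorem exists_constO_add (w : Odd) : ∃ (a : negO) (v : Odd),
    (∀ i j, MvPowerSeries.constantCoeff (v.1 i j) = 0) ∧ w = a.1 + v :=
  ⟨constO w, w - (constO w).1, constantCoeff_sub_constO w, by abel⟩

theorem nonneg_bracketEE {X Y : Even} (hX : ∀ i, MvPowerSeries.constantCoeff (X.1 i) = 0)
    (hY : ∀ i, MvPowerSeries.constantCoeff (Y.1 i) = 0) (i : Fin 5) :
    MvPowerSeries.constantCoeff ((bracketEE X Y).1 i) = 0 := by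
  simp [bracketEE, hX, hY]

theorem nonneg_bracketEO {X : Even} {w : Odd}
    (hX : ∀ i, MvPowerSeries.constantCoeff (X.1 i) = 0)
    (hw : ∀ i j, MvPowerSeries.constantCoeff (w.1 i j) = 0) (i j : Fin 5) :
    MvPowerSeries.constantCoeff ((bracketEO X w).1 i j) = 0 := by
  simp [bracketEO, hX, hw]

theorem nonneg_bracketOO {v : Odd} (hv : ∀ i j, MvPowerSeries.constantCoeff (v.1 i j) = 0)
    (w : Odd) (i : Fin 5) :
    MvPowerSeries.constantCoeff ((bracketOO v w).1 i) = 0 := by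
  rw [bracketOO_apply]
  fin_cases i <;> simp [wedge, hv]

theorem actE_mk_nonneg {X : Even} (hX : ∀ i, MvPowerSeries.constantCoeff (X.1 i) = 0) (v : V) :
    actE X (mk 1 v) = mk 1 ⁅linPart X, v⁆ := by
  rw [actE_mk_one, constE_of_nonneg hX, map_zero, map_zero, LinearMap.zero_apply, zero_add]

theorem actO_mk_nonneg {w : Odd} (hw : ∀ i j, MvPowerSeries.constantCoeff (w.1 i j) = 0) (v : V) :
    actO w (mk 1 v) = 0 := by
  rw [actO_mk_one, constO_of_nonneg hw, map_zero, map_zero, LinearMap.zero_apply]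

theorem actE_actE_const (X : Even) (A : negE) (n : Ind V) :
    actE X (actE A.1 n) - actE A.1 (actE X n) = actE (bracketEE X A) n := by
  rw [actE_constE, actE_constE, actE_ιE, add_sub_cancel_right]

theorem actO_actE_const (w : Odd) (A : negE) (n : Ind V) :
    actE A.1 (actO w n) - actO w (actE A.1 n) = actO (bracketEO A w) n := by
  rw [actE_constE, actE_constE, actO_ιE]
  abel

theorem actE_actO_const (X : Even) (a : negO) (n : Ind V) :
    actE X (actO a.1 n) - actO a.1 (actE X n) = actO (bracketEO X a) n := by
  rw [actO_constO, actO_constO, actE_ιO, add_sub_cancel_right]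

theorem actO_actO_const (w : Odd) (a : negO) (n : Ind V) :
    actO w (actO a.1 n) + actO a.1 (actO w n) = actE (bracketOO w a) n := by
  rw [actO_constO, actO_constO, actO_ιO, sub_add_cancel]

/-- The super commutation relations at a given vector. -/
structure Relations (n : Ind V) : Prop where
  ee : ∀ X Y, actE X (actE Y n) - actE Y (actE X n) = actE (bracketEE X Y) n
  eo : ∀ X w, actE X (actO w n) - actO w (actE X n) = actO (bracketEO X w) n
  oo : ∀ v w, actO v (actO w n) + actO w (actO v n) = actE (bracketOO v w) n

/-- Each argument is split into a constant part and a part in `L_{≥0}`. Pairs with a constant member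
are covered by the recursion defining the action; two elements of `L_{≥0}` act on `1 ⊗ V` through
`L_0`, where `V` is already a module. -/
theorem relations_mk_one (v : V) : Relations (mk 1 v) := by
  refine ⟨fun X Y => ?_, fun X w => ?_, fun w w' => ?_⟩
  · obtain ⟨A, X, hX, rfl⟩ := exists_constE_add X
    obtain ⟨B, Y, hY, rfl⟩ := exists_constE_add Y
    have h1 := actE_actE_const A.1 B (mk 1 v)
    have h2 := actE_actE_const X B (mk 1 v)
    have h3 := actE_actE_const Y A (mk 1 v)
    have h4 : actE X (actE Y (mk 1 v)) - actE Y (actE X (mk 1 v)) =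
        actE (bracketEE X Y) (mk 1 v) := by
      rw [actE_mk_nonneg hX, actE_mk_nonneg hY, actE_mk_nonneg (nonneg_bracketEE hX hY),
        actE_mk_nonneg hX, actE_mk_nonneg hY, linPart_bracketEE hX hY, ← map_sub, ← lie_lie]
    rw [bracketEE_swap, map_neg, LinearMap.neg_apply] at h3
    simp only [← bilEE_apply, map_add, LinearMap.add_apply] at *
    rw [← h1, ← h2, ← h4, ← neg_eq_iff_eq_neg.mpr h3]
    abel
  · obtain ⟨A, X, hX, rfl⟩ := exists_constE_add X
    obtain ⟨a, w, hw, rfl⟩ := exists_constO_add w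
    have h1 := actE_actO_const A.1 a (mk 1 v)
    have h2 := actE_actO_const X a (mk 1 v)
    have h3 := actO_actE_const w A (mk 1 v)
    have h4 : actE X (actO w (mk 1 v)) - actO w (actE X (mk 1 v)) =
        actO (bracketEO X w) (mk 1 v) := by
      rw [actE_mk_nonneg hX, actO_mk_nonneg hw, actO_mk_nonneg (nonneg_bracketEO hX hw),
        actO_mk_nonneg hw, map_zero, sub_zero]
    simp only [← bilEO_apply, map_add, LinearMap.add_apply] at *
    rw [← h1, ← h2, ← h3, ← h4]
    abel
  · obtain ⟨a, w, hw, rfl⟩ := exists_constO_add w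
    obtain ⟨a', w', hw', rfl⟩ := exists_constO_add w'
    have h1 := actO_actO_const a.1 a' (mk 1 v)
    have h2 := actO_actO_const w a' (mk 1 v)
    have h3 := actO_actO_const w' a (mk 1 v)
    have h4 : actO w (actO w' (mk 1 v)) + actO w' (actO w (mk 1 v)) =
        actE (bracketOO w w') (mk 1 v) := by
      rw [actO_mk_nonneg hw, actO_mk_nonneg hw', actE_mk_nonneg (nonneg_bracketOO hw w'),
        linPart_bracketOO_of_nonneg hw hw', zero_lie, map_zero, map_zero, map_zero, add_zero]
    rw [bracketOO_swap] at h3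
    simp only [← bilOO_apply, map_add, LinearMap.add_apply] at *
    rw [← h1, ← h2, ← h3, ← h4]
    abel

theorem Relations.add {a b : Ind V} (ha : Relations a) (hb : Relations b) : Relations (a + b) := by
  refine ⟨fun X Y => ?_, fun X w => ?_, fun w w' => ?_⟩
  · simp only [map_add, ← ha.ee, ← hb.ee]
    abel
  · simp only [map_add, ← ha.eo, ← hb.eo]
    abel
  · simp only [map_add, ← ha.oo, ← hb.oo]
    abel

theorem Relations.smul {a : Ind V} (c : ℂ) (ha : Relations a) : Relations (c • a) := by
  refine ⟨fun X Y => ?_, fun X w => ?_, fun w w' => ?_⟩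
  · simp only [map_smul, ← ha.ee, smul_sub]
  · simp only [map_smul, ← ha.eo, smul_sub]
  · simp only [map_smul, ← ha.oo, smul_add]

theorem Relations.smul_ιE {a : Ind V} (A : negE) (ha : Relations a) :
    Relations (UNeg.ιE A • a) := by
  refine ⟨fun X Y => ?_, fun X w => ?_, fun v w => ?_⟩
  · simp only [actE_ιE, map_add, jacobi_even_even_const X Y A.2, map_sub, LinearMap.sub_apply,
      ← ha.ee, smul_sub]
    abel
  · have h := jacobi_even_const_odd X w A.2
    rw [bracketEE_swap, ← bilEO_apply (- _), map_neg, LinearMap.neg_apply, bilEO_apply] at h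
    simp only [actE_ιE, actO_ιE, map_add, map_neg, h, LinearMap.add_apply, LinearMap.neg_apply,
      ← ha.eo, smul_sub]
    abel
  · have h := jacobi_const_odd_odd v w A.2
    simp only [actE_ιE, actO_ιE, map_add, map_neg, bracketEE_swap (bracketOO v w), h,
      LinearMap.add_apply, LinearMap.neg_apply, ← ha.oo, smul_add]
    abel

/-- Moving `d` to the left past two operators creates brackets with `d`. The relations at `a` and
the Jacobi identity with constant argument `d` make the extra terms cancel. -/
theorem Relations.smul_ιO {a : Ind V} (d : negO) (ha : Relations a) :
    Relations (UNeg.ιO d • a) := by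
  refine ⟨fun X Y => ?_, fun X w => ?_, fun v w => ?_⟩
  · simp only [actE_ιO, map_add, jacobi_even_even_odd X Y d.2, map_sub, LinearMap.sub_apply,
      ← ha.ee, ← ha.eo, smul_sub]
    abel
  · have h := jacobi_even_odd_odd X w d.2
    have h' : bracketOO (bracketEO X w) d =
      bracketEE X (bracketOO w d) - bracketOO w (bracketEO X d) := by rw [h, add_sub_cancel_right]
    simp only [actE_ιO, actO_ιO, map_add, map_sub, h', LinearMap.sub_apply,
      ← ha.eo, ← ha.ee, ← ha.oo, smul_sub]
    abel
  · have h := jacobi_odd_odd_odd v w d.2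
    have h' : bracketEO (bracketOO v w) d =
        - bracketEO (bracketOO v d) w - bracketEO (bracketOO w d) v := by
      rw [← sub_eq_zero, ← h]
      abel
    simp only [actE_ιO, actO_ιO, map_sub, map_neg, h', LinearMap.sub_apply, LinearMap.neg_apply,
      ← ha.eo, ← ha.oo, smul_add]
    abel

theorem relations (n : Ind V) : Relations n := by
  induction n using Ind.induction with
  | h1 v => exact relations_mk_one v
  | hadd a b ha hb => exact ha.add hb
  | hsmul c a ha => exact ha.smul c
  | hE X a ha => exact ha.smul_ιE X
  | hO w a ha => exact ha.smul_ιO w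

end Ind

/-! ### The action of `U(L)` and the comparison with the generalized Verma module -/

theorem bracket_ev_ev (X Y : Even) : bracket (ev X) (ev Y) = ev (bracketEE X Y) := by
  have h1 : bracketOO 0 0 = 0 := (bilOO 0).map_zero
  have h2 : ∀ X : Even, bracketEO X 0 = 0 := fun X => (bilEO X).map_zero
  simp [bracket, ev, h1, h2]

theorem bracket_ev_od (X : Even) (w : Odd) : bracket (ev X) (od w) = od (bracketEO X w) := by
  have h1 : bracketEE X 0 = 0 := (bilEE X).map_zero
  have h2 : bracketOO 0 w = 0 := LinearMap.map_zero₂ bilOO w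
  have h3 : bracketEO 0 0 = 0 := (bilEO 0).map_zero
  simp [bracket, od, h1, h2, h3]

theorem bracket_od_od (v w : Odd) : bracket (od v) (od w) = ev (bracketOO v w) := by
  have h1 : bracketEE 0 0 = 0 := (bilEE 0).map_zero
  have h2 : ∀ w, bracketEO 0 w = 0 := fun w => LinearMap.map_zero₂ bilEO w
  simp [bracket, ev, h1, h2]

namespace Ind

variable {V : Type*} [AddCommGroup V] [Module ℂ V] [LieRingModule sl5 V] [LieModule ℂ sl5 V]

/-- The action of `U(L)` on `U(L_-) ⊗ V`. -/
def actU : U →ₐ[ℂ] Module.End ℂ (Ind V) :=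
  RingQuot.liftAlgHom ℂ ⟨TensorAlgebra.lift ℂ (actE.coprod actO), by
    intro x y h
    cases h with
    | even_even X Y =>
      refine LinearMap.ext fun n => ?_
      rw [bracket_ev_ev]
      simpa using (relations n).ee X Y
    | even_odd X w =>
      refine LinearMap.ext fun n => ?_
      rw [bracket_ev_od]
      simpa using (relations n).eo X w
    | odd_odd v w =>
      refine LinearMap.ext fun n => ?_
      rw [bracket_od_od]
      simpa using (relations n).oo v w⟩

theorem actU_toU (a : L) : actU (V := V) (toU a) = actE a.1 + actO a.2 := by
  refine (RingQuot.liftAlgHom_mkAlgHom_apply ℂ _ _ _).trans ?_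
  simp

/-- The map `U(L) ⊗ V → U(L_-) ⊗ V`. -/
def ofTensor : U ⊗[ℂ] V →ₗ[ℂ] Ind V :=
  TensorProduct.lift (actU.toLinearMap.compl₂ (mk 1))

theorem ofTensor_tmul (u : U) (v : V) : ofTensor (u ⊗ₜ[ℂ] v) = actU u (mk 1 v) := rfl

theorem ofTensor_smul (u : U) (z : U ⊗[ℂ] V) : ofTensor (u • z) = actU u (ofTensor z) := by
  induction z with
  | zero => simp
  | tmul u' v =>
    rw [TensorProduct.smul_tmul', ofTensor_tmul, ofTensor_tmul, smul_eq_mul, map_mul]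
    rfl
  | add a b ha hb => rw [smul_add, map_add, ha, hb, map_add, map_add]

theorem ofTensor_inducedRel {z : U ⊗[ℂ] V} (hz : z ∈ inducedRel V) : ofTensor z = 0 := by
  induction hz using Submodule.span_induction with
  | mem z h =>
    obtain ⟨u, a, ha, v, rfl⟩ := h
    rw [map_sub, ofTensor_tmul, ofTensor_tmul, map_mul, Module.End.mul_apply, actU_toU,
      LinearMap.add_apply, actE_mk_nonneg ha.1, actO_mk_nonneg ha.2, add_zero, sub_self]
  | zero => exact map_zero _
  | add x y _ _ hx hy => rw [map_add, hx, hy, add_zero]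
  | smul u x _ hx => rw [ofTensor_smul, hx, map_zero]

/-- The map from the generalized Verma module to `U(L_-) ⊗ V`. -/
def ofVerma : Verma V →ₗ[ℂ] Ind V :=
  ((inducedRel V).restrictScalars ℂ).liftQ ofTensor fun _ hz => ofTensor_inducedRel hz

theorem ofVerma_tmul (u : U) (v : V) : ofVerma (tmul u v) = actU u (mk 1 v) := rfl

/-- The map `U(L_-) ⊗ V → V` defined by a linear functional on `U(L_-)`. -/
def contract (f : UNeg →ₗ[ℂ] ℂ) : Ind V →ₗ[ℂ] V :=
  TensorProduct.lift (LinearMap.lsmul ℂ V ∘ₗ f)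

theorem contract_mk (f : UNeg →ₗ[ℂ] ℂ) (u : UNeg) (v : V) : contract f (mk u v) = f u • v := rfl

end Ind

/-! ### Reading off coefficients in degrees 0 and 1 -/

/-- The homomorphism from `U(L_-)` to the dual numbers that is given by a linear functional on
`L_{-1}`. -/
def UNeg.toDual (f : negO →ₗ[ℂ] ℂ) : UNeg →ₐ[ℂ] DualNumber ℂ :=
  -- Constant vector fields have degree `-2` and go to zero; since `ε² = 0`, all products of odd
  -- generators vanish as well, so every relation of `U(L_-)` holds trivially.
  UNeg.lift 0 (TrivSqZeroExt.inrHom ℂ ℂ ∘ₗ f) (fun _ _ => by simp) (fun _ _ => by simp)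
    (fun _ _ => by simp)

theorem UNeg.toDual_ιO (f : negO →ₗ[ℂ] ℂ) (w : negO) :
    UNeg.toDual f (UNeg.ιO w) = TrivSqZeroExt.inr (f w) :=
  UNeg.lift_ιO _ _ _ _ _ w

/-- The functional that maps a constant two-form to its coefficient of `d_{kl}`. -/
def negOCoeff (k l : Fin 5) : negO →ₗ[ℂ] ℂ where
  toFun w := MvPowerSeries.constantCoeff (w.1.1 k l)
  map_add' v w := by simp
  map_smul' c w := by simp

section coeff

variable {V : Type*} [AddCommGroup V] [Module ℂ V] [LieRingModule sl5 V] [LieModule ℂ sl5 V]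

/-- The coefficient of `d_{kl}` in the component of degree `1` of the generalized Verma module. -/
def coeffOne (k l : Fin 5) : Verma V →ₗ[ℂ] V :=
  Ind.contract (TrivSqZeroExt.sndHom ℂ ℂ ∘ₗ (UNeg.toDual (negOCoeff k l)).toLinearMap) ∘ₗ Ind.ofVerma

/-- The component of degree `0` of the generalized Verma module. -/
def coeffZero : Verma V →ₗ[ℂ] V :=
  Ind.contract ((TrivSqZeroExt.fstHom ℂ ℂ ℂ).toLinearMap ∘ₗ (UNeg.toDual 0).toLinearMap) ∘ₗ
    Ind.ofVerma

theorem coeffZero_tmul_one (v : V) : coeffZero (tmul 1 v) = v := by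
  rw [coeffZero, LinearMap.comp_apply, Ind.ofVerma_tmul, map_one, Module.End.one_apply,
    Ind.contract_mk, LinearMap.comp_apply, AlgHom.toLinearMap_apply, AlgHom.toLinearMap_apply, map_one,
    map_one, one_smul]

theorem d_mem_negO (i j : Fin 5) : d i j ∈ negO := fun a b c =>
  MvPowerSeries.pderiv_C

theorem coeffOne_tmul_dU (k l i j : Fin 5) (v : V) : coeffOne k l (tmul (dU i j) v) =
    (((if i = k ∧ j = l then 1 else 0) - (if i = l ∧ j = k then 1 else 0) : ℂ)) • v := by
  rw [coeffOne, LinearMap.comp_apply, Ind.ofVerma_tmul, dU, Ind.actU_toU, LinearMap.add_apply,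
    map_zero, LinearMap.zero_apply, zero_add, Ind.actO_constO ⟨d i j, d_mem_negO i j⟩, Ind.smul_mk,
    mul_one, Ind.contract_mk, LinearMap.comp_apply, AlgHom.toLinearMap_apply, UNeg.toDual_ιO]
  rfl

end coeff

/-! ### The action of `L_{≥0}` on elements of degree one -/

theorem toU_ev_mul_od (X : Even) (w : Odd) :
    toU (ev X) * toU (od w) = toU (od w) * toU (ev X) + toU (od (bracketEO X w)) := by
  have h := RingQuot.mkAlgHom_rel ℂ (Rel.even_odd X w)
  rw [map_sub, map_mul, map_mul, bracket_ev_od, sub_eq_iff_eq_add'] at h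
  exact h

theorem toU_od_mul_od (v w : Odd) :
    toU (od v) * toU (od w) = - (toU (od w) * toU (od v)) + toU (ev (bracketOO v w)) := by
  have h := RingQuot.mkAlgHom_rel ℂ (Rel.odd_odd v w)
  rw [map_add, map_mul, map_mul, bracket_od_od, ← eq_sub_iff_add_eq, sub_eq_neg_add] at h
  exact h

theorem d_swap (i j : Fin 5) : d i j = - d j i := by
  refine Subtype.ext (funext fun k => funext fun l => ?_)
  change MvPowerSeries.C _ = - MvPowerSeries.C _
  rw [← map_neg, neg_sub]
  congr 2 <;> simp only [and_comm]

theorem dU_swap (i j : Fin 5) : dU i j = - dU j i := by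
  rw [dU, d_swap, dU, ← map_neg, od, od, Prod.neg_mk, neg_zero]

theorem constantCoeff_d (i j k l : Fin 5) : MvPowerSeries.constantCoeff ((d i j).1 k l) =
    (if i = k ∧ j = l then 1 else 0) - (if i = l ∧ j = k then 1 else 0) := rfl

theorem mem_nonneg_ev {X : Even} : ev X ∈ nonneg ↔
    ∀ i, MvPowerSeries.constantCoeff (X.1 i) = 0 :=
  ⟨fun h => h.1, fun h => ⟨h, fun i j => map_zero _⟩⟩

theorem mem_nonneg_od {w : Odd} : od w ∈ nonneg ↔
    ∀ i j, MvPowerSeries.constantCoeff (w.1 i j) = 0 :=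
  ⟨fun h => h.2, fun h => ⟨fun i => map_zero _, h⟩⟩

section VermaAction

variable {V : Type*} [AddCommGroup V] [Module ℂ V] [LieRingModule sl5 V] [LieModule ℂ sl5 V]

/-- The bilinear map `(u, v) ↦ u ⊗ v`. -/
def tmulL : U →ₗ[ℂ] V →ₗ[ℂ] Verma V :=
  (TensorProduct.mk ℂ U V).compr₂ ((inducedRel V).mkQ.restrictScalars ℂ)

theorem tmulL_apply (u : U) (v : V) : tmulL u v = tmul u v := rfl

theorem smul_tmul (u u' : U) (v : V) : u • (tmul u' v : Verma V) = tmul (u * u') v := rfl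

theorem tmul_mul_toU (u : U) {a : L} (ha : a ∈ nonneg) (v : V) :
    (tmul (u * toU a) v : Verma V) = tmul u ⁅linPart a.1, v⁆ := by
  refine (Submodule.Quotient.eq _).mpr (Submodule.subset_span ⟨u, a, ha, v, rfl⟩)

/-- After its constant part is removed, `w` lies in `L_+` and annihilates `1 ⊗ v`. The factor `1/2`
compensates for the sum over ordered pairs. -/
theorem tmul_toU_od (w : Odd) (v : V) : (tmul (toU (od w)) v : Verma V) =
    ∑ k, ∑ l, ((1 / 2 : ℂ) * MvPowerSeries.constantCoeff (w.1 k l)) • tmul (dU k l) v := by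
  set w' : Odd := ∑ k, ∑ l, ((1 / 2 : ℂ) * MvPowerSeries.constantCoeff (w.1 k l)) • d k l with hw'
  have h0 : od (w - w') ∈ nonneg := by
    rw [mem_nonneg_od]
    intro i j
    have e : MvPowerSeries.constantCoeff (w'.1 i j) = MvPowerSeries.constantCoeff (w.1 i j) := by
      have e' : w'.1 i j = ∑ k, ∑ l,
          ((1 / 2 : ℂ) * MvPowerSeries.constantCoeff (w.1 k l)) • (d k l).1 i j := by
        simp [hw', Finset.sum_apply]
      have hs : MvPowerSeries.constantCoeff (w.1 j i) =
        - MvPowerSeries.constantCoeff (w.1 i j) := by rw [odd_swap w j i, map_neg]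
      rw [e']
      simp only [map_sum, MvPowerSeries.constantCoeff_smul, constantCoeff_d, ite_and, mul_sub,
        Finset.sum_sub_distrib, smul_eq_mul, mul_ite, mul_one, mul_zero, Finset.sum_ite_eq',
        Finset.mem_univ, if_true, Finset.sum_ite_irrel, Finset.sum_const_zero, hs]
      ring
    change MvPowerSeries.constantCoeff (w.1 i j - w'.1 i j) = 0
    rw [map_sub, e, sub_self]
  have h1 : (tmul (toU (od (w - w'))) v : Verma V) = 0 := by
    rw [← one_mul (toU _), tmul_mul_toU 1 h0]
    change tmul 1 ⁅linPart 0, v⁆ = _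
    rw [linPart_of_const (X := 0) (fun i j => by simp), zero_lie, ← tmulL_apply, map_zero]
  have h2 : toU (od w) = toU (od (w - w')) +
      ∑ k, ∑ l, ((1 / 2 : ℂ) * MvPowerSeries.constantCoeff (w.1 k l)) • dU k l := by
    have : ∀ x : Odd, toU (od x) = (toU ∘ₗ LinearMap.inr ℂ Even Odd) x := fun _ => rfl
    simp only [dU, this, ← map_smul, ← map_sum, ← map_add]
    rw [sub_add_cancel]
  rw [h2, ← tmulL_apply, map_add, LinearMap.add_apply, tmulL_apply, h1, zero_add]
  simp only [map_sum, map_smul, LinearMap.sum_apply, LinearMap.smul_apply, tmulL_apply]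

/-- The element `∑ d_{ij} ⊗ w_{ij}` of the generalized Verma module. -/
def degOne : (Fin 5 → Fin 5 → V) →ₗ[ℂ] Verma V :=
  ∑ i, ∑ j, tmulL (dU i j) ∘ₗ LinearMap.proj j ∘ₗ LinearMap.proj i

theorem degOne_apply (w : Fin 5 → Fin 5 → V) : degOne w = ∑ i, ∑ j, tmul (dU i j) (w i j) := by
  simp [degOne, LinearMap.sum_apply, tmulL_apply]

theorem tmul_dU_swap (i j : Fin 5) (v : V) :
    (tmul (dU i j) v : Verma V) = - tmul (dU j i) v := by
  rw [dU_swap, ← tmulL_apply, map_neg, LinearMap.neg_apply, tmulL_apply]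

theorem degOne_swap (w : Fin 5 → Fin 5 → V) : degOne (fun i j => w j i) = - degOne w := by
  rw [degOne_apply, degOne_apply, Finset.sum_comm, ← Finset.sum_neg_distrib]
  refine Finset.sum_congr rfl fun i _ => ?_
  rw [← Finset.sum_neg_distrib]
  exact Finset.sum_congr rfl fun j _ => tmul_dU_swap _ _ _

theorem coeffOne_degOne (w : Fin 5 → Fin 5 → V) (k l : Fin 5) :
    coeffOne k l (degOne w) = w k l - w l k := by
  simp only [degOne_apply, map_sum, coeffOne_tmul_dU, ite_and, sub_smul, Finset.sum_sub_distrib,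
    ite_smul, one_smul, zero_smul, Finset.sum_ite_eq', Finset.mem_univ, if_true,
    Finset.sum_ite_irrel, Finset.sum_const_zero]

/-- This independence of the vectors `d_{ij} ⊗ v` is what the action on `U(L_-) ⊗ V` was built for.
Because `degOne` sums over ordered pairs, the coefficient of `d_{ij}` is `2 w_{ij}`. -/
theorem degOne_injective {w : Fin 5 → Fin 5 → V} (hw : ∀ i j, w i j = - w j i)
    (h : degOne w = 0) : w = 0 := by
  funext i j
  have e := coeffOne_degOne w i j
  rw [h, map_zero, hw j i, sub_neg_eq_add, ← two_smul ℂ, eq_comm, smul_eq_zero] at e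
  exact e.resolve_left two_ne_zero

/-- The action of `L_0` on `L_{-1} ⊗ V`, in coordinates. -/
def tensorAct (A : sl5) (w : Fin 5 → Fin 5 → V) (i j : Fin 5) : V :=
  ⁅A, w i j⁆ + ∑ m, (A.1 i m • w m j + A.1 j m • w i m)

theorem tmul_toU_bracketEO {X : Even} (hX : ev X ∈ nonneg) (i j : Fin 5) (v : V) :
    (tmul (toU (od (bracketEO X (d i j)))) v : Verma V) =
      ∑ k, ((linPart X).1 k i • tmul (dU k j) v + (linPart X).1 k j • tmul (dU i k) v) := by
  have h0 := mem_nonneg_ev.mp hX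
  have e : ∀ k l, MvPowerSeries.constantCoeff ((bracketEO X (d i j)).1 k l) =
      ∑ m, ((linPart X).1 k m * ((if i = m ∧ j = l then 1 else 0) - (if i = l ∧ j = m then 1 else 0))
      + (linPart X).1 l m * ((if i = k ∧ j = m then 1 else 0) - (if i = m ∧ j = k then 1 else 0))) := by
    intro k l
    simp only [bracketEO, map_sum, map_add, map_mul, h0, zero_mul, zero_add, linPart_apply,
      constantCoeff_d]
  generalize (linPart X).1 = A at e
  have e' : ∀ k l, MvPowerSeries.constantCoeff ((bracketEO X (d i j)).1 k l) =
      (if j = l then A k i else 0) - (if i = l then A k j else 0) + (if i = k then A l j else 0)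
        - (if j = k then A l i else 0) := by
    intro k l
    rw [e]
    simp only [ite_and, mul_sub, Finset.sum_sub_distrib, Finset.sum_add_distrib, mul_ite, mul_one,
      mul_zero, Finset.sum_ite_eq, Finset.mem_univ, if_true, Finset.sum_ite_irrel,
      Finset.sum_const_zero]
    ring
  rw [tmul_toU_od]
  simp only [e', mul_add, mul_sub, add_smul, sub_smul, Finset.sum_add_distrib,
    Finset.sum_sub_distrib, mul_ite, ite_smul, mul_zero, zero_smul, Finset.sum_ite_eq,
    Finset.mem_univ, if_true, Finset.sum_ite_irrel, Finset.sum_const_zero]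
  have s1 : ∀ (f : Fin 5 → ℂ) (a : Fin 5), ∑ k, f k • (tmul (dU k a) v : Verma V) =
      - ∑ k, f k • tmul (dU a k) v := by
    intro f a
    rw [← Finset.sum_neg_distrib]
    exact Finset.sum_congr rfl fun k _ => by rw [tmul_dU_swap k a, smul_neg]
  have h2 : ∀ (f : Fin 5 → ℂ) (g : Fin 5 → Verma V), ∑ k, f k • g k =
      (2 : ℂ) • ∑ k, ((1 / 2 : ℂ) * f k) • g k := by
    intro f g
    rw [Finset.smul_sum]
    exact Finset.sum_congr rfl fun k _ => by rw [smul_smul, ← mul_assoc]; norm_num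
  rw [h2 (fun k => A k i), h2 (fun k => A k j)]
  rw [s1 (fun k => 1 / 2 * A k j) i, s1 (fun k => 1 / 2 * A k i) j]
  module

theorem toU_ev_smul_tmul_dU {X : Even} (hX : ev X ∈ nonneg) (i j : Fin 5) (v : V) :
    toU (ev X) • (tmul (dU i j) v : Verma V) = tmul (dU i j) ⁅linPart X, v⁆ +
      ∑ k, ((linPart X).1 k i • tmul (dU k j) v + (linPart X).1 k j • tmul (dU i k) v) := by
  rw [smul_tmul, dU, toU_ev_mul_od, ← tmulL_apply, map_add, LinearMap.add_apply, tmulL_apply,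
    tmulL_apply, tmul_mul_toU _ hX, tmul_toU_bracketEO hX]

/-- Coefficients of `X` of order at least two bracket `d_{ij}` into `L_+`, hence contribute nothing.
The even part of `L_+` therefore never obstructs singularity in degree one. -/
theorem toU_ev_smul_degOne {X : Even} (hX : ev X ∈ nonneg) (w : Fin 5 → Fin 5 → V) :
    toU (ev X) • degOne w = degOne (tensorAct (linPart X) w) := by
  simp only [degOne_apply, Finset.smul_sum, toU_ev_smul_tmul_dU hX, tensorAct]
  simp only [← tmulL_apply, map_add, map_sum, map_smul, Finset.sum_add_distrib]
  refine congrArg₂ (· + ·) rfl (congrArg₂ (· + ·) ?_ ?_)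
  · calc _ = ∑ i, ∑ k, ∑ j, (linPart X).1 k i • tmulL (dU k j) (w i j) :=
          Finset.sum_congr rfl fun i _ => Finset.sum_comm
      _ = ∑ k, ∑ i, ∑ j, (linPart X).1 k i • tmulL (dU k j) (w i j) := Finset.sum_comm
      _ = _ := Finset.sum_congr rfl fun k _ => Finset.sum_comm
  · exact Finset.sum_congr rfl fun i _ => Finset.sum_comm

/-- Since `w` annihilates `1 ⊗ f_{ij}`, only the anticommutator `[w, d_{ij}]` survives; it lies in
`L_{≥0}` and acts through `L_0`. -/
theorem toU_od_smul_degOne {w : Odd} (hw : od w ∈ nonneg) (f : Fin 5 → Fin 5 → V) :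
    toU (od w) • degOne f = tmul 1 (∑ i, ∑ j, ⁅linPart (bracketOO w (d i j)), f i j⁆) := by
  have h0 := mem_nonneg_od.mp hw
  rw [← tmulL_apply, degOne_apply, Finset.smul_sum, map_sum]
  refine Finset.sum_congr rfl fun i _ => ?_
  rw [Finset.smul_sum, map_sum]
  refine Finset.sum_congr rfl fun j _ => ?_
  have h1 : ev (bracketOO w (d i j)) ∈ nonneg := mem_nonneg_ev.mpr (Ind.nonneg_bracketOO h0 _)
  rw [smul_tmul, dU, toU_od_mul_od, ← tmulL_apply, map_add, map_neg, LinearMap.add_apply,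
    LinearMap.neg_apply, tmulL_apply, tmulL_apply, tmul_mul_toU _ hw, ← one_mul (toU (ev _)),
    tmul_mul_toU 1 h1, tmulL_apply]
  change - tmul _ ⁅linPart 0, f i j⁆ + _ = _
  rw [linPart_of_const (X := 0) (fun i j => by simp), zero_lie, ← tmulL_apply, map_zero, neg_zero,
    zero_add]

theorem tmul_mem_range_degOne {u : U} (hu : u ∈ UnegDeg 1) (v : V) :
    (tmul u v : Verma V) ∈ LinearMap.range (degOne (V := V)) := by
  rw [UnegDeg, pow_one] at hu
  induction hu using Submodule.span_induction with
  | mem u h =>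
    obtain ⟨⟨a, b⟩, rfl⟩ := h
    refine ⟨fun i j => if a = i then if b = j then v else 0 else 0, ?_⟩
    rw [degOne_apply]
    have : ∀ i j, (tmul (dU i j) (if a = i then if b = j then v else 0 else 0) : Verma V) =
        if a = i then if b = j then tmul (dU i j) v else 0 else 0 := by
      intro i j
      split_ifs
      · rfl
      · rw [← tmulL_apply, map_zero]
      · rw [← tmulL_apply, map_zero]
    simp only [this, Finset.sum_ite_irrel, Finset.sum_ite_eq, Finset.mem_univ, if_true,
      Finset.sum_const_zero]
  | zero => rw [← tmulL_apply, map_zero]; exact zero_mem _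
  | add x y _ _ hx hy =>
    rw [← tmulL_apply, map_add]
    exact add_mem hx hy
  | smul c x _ hx =>
    rw [← tmulL_apply, map_smul]
    exact Submodule.smul_mem _ c hx

end VermaAction

/-- The linear vector field of a matrix. -/
def matField (A : sl5) : Even :=
  ⟨fun j => ∑ i, A.1 i j • MvPowerSeries.X i, by
    have h : Matrix.trace A.1 = 0 := A.2
    change ∑ j, pd j (∑ i, A.1 i j • MvPowerSeries.X i) = 0
    simp only [map_sum, Derivation.map_smul, pd, MvPowerSeries.pderiv_X, Pi.single_apply, smul_ite,
      smul_zero, Finset.sum_ite_eq', Finset.mem_univ, if_true]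
    rw [← Finset.sum_smul]
    exact (congrArg (· • (1 : PS)) h).trans (zero_smul ℂ 1)⟩

theorem matField_mem (A : sl5) : ev (matField A) ∈ nonneg := by
  rw [mem_nonneg_ev]
  intro i
  simp [matField]

theorem linPart_matField (A : sl5) : linPart (matField A) = A := by
  refine Subtype.ext (Matrix.ext fun i j => ?_)
  rw [linPart_apply]
  change MvPowerSeries.constantCoeff (pd i (∑ k, A.1 k j • MvPowerSeries.X k)) = A.1 i j
  simp only [map_sum, Derivation.map_smul, pd, MvPowerSeries.pderiv_X, Pi.single_apply, smul_ite,
    smul_zero, Finset.sum_ite_eq', Finset.mem_univ, if_true, MvPowerSeries.constantCoeff_smul,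
    map_one, smul_eq_mul, mul_one]

/-! ### Morphisms and singular vectors -/

section Morphisms

variable {V : Type*} [AddCommGroup V] [Module ℂ V] [LieRingModule sl5 V] [LieModule ℂ sl5 V]
  {W : Type*} [AddCommGroup W] [Module ℂ W] [LieRingModule sl5 W] [LieModule ℂ sl5 W]

theorem verma_ext {φ ψ : Verma V →ₗ[U] Verma W}
    (h : ∀ v, φ (tmul 1 v) = ψ (tmul 1 v)) : φ = ψ := by
  have key : ∀ z : U ⊗[ℂ] V, φ (Submodule.Quotient.mk z) = ψ (Submodule.Quotient.mk z) := by
    intro z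
    induction z with
    | zero => rw [Submodule.Quotient.mk_zero, map_zero, map_zero]
    | tmul u v =>
      have : (Submodule.Quotient.mk (u ⊗ₜ[ℂ] v) : Verma V) = u • tmul 1 v := by
        rw [smul_tmul, mul_one]
        rfl
      rw [this, map_smul, map_smul, h]
    | add a b ha hb => rw [Submodule.Quotient.mk_add, map_add, map_add, ha, hb]
  refine LinearMap.ext fun x => ?_
  obtain ⟨z, rfl⟩ := Submodule.Quotient.mk_surjective _ x
  exact key z

theorem toU_matField_smul (A : sl5) (v : V) :
    toU (ev (matField A)) • (tmul 1 v : Verma V) = tmul 1 ⁅A, v⁆ := by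
  have h := tmul_mul_toU 1 (matField_mem A) v
  rw [linPart_matField, one_mul] at h
  rw [smul_tmul, mul_one, h]

/-- A vector of a generalized Verma module is annihilated by the odd part of `L_+`. -/
def OddSingular (z : Verma W) : Prop := ∀ w : Odd, od w ∈ nonneg → toU (od w) • z = 0

/-- Bracketing with `L_0` preserves the odd part of `L_+`. Singularity thus passes from the highest
weight vector to the whole `𝔰𝔩₅`-module that it generates. -/
theorem OddSingular.matField_smul {z : Verma W} (hz : OddSingular z) (A : sl5) :
    OddSingular (toU (ev (matField A)) • z) := by
  intro w hw
  have h := toU_ev_mul_od (matField A) w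
  have h' : od (bracketEO (matField A) w) ∈ nonneg := mem_nonneg_od.mpr
    (Ind.nonneg_bracketEO (mem_nonneg_ev.mp (matField_mem A)) (mem_nonneg_od.mp hw))
  rw [← mul_smul, eq_sub_iff_add_eq.mpr h.symm, sub_smul, mul_smul, hz w hw, smul_zero, hz _ h',
    sub_zero]

/-- A homomorphism of `L_0`-modules from `V` to the singular vectors in `L_{-1} ⊗ W` defines a
morphism of degree one. -/
theorem exists_morphism (θ : V →ₗ[ℂ] (Fin 5 → Fin 5 → W))
    (h1 : ∀ (A : sl5) (v : V), θ ⁅A, v⁆ = tensorAct A (θ v))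
    (h2 : ∀ v, OddSingular (degOne (θ v))) :
    ∃ φ : Verma V →ₗ[U] Verma W, HasDegree 1 φ ∧ ∀ v, φ (tmul 1 v) = degOne (θ v) := by
  set f : U ⊗[ℂ] V →ₗ[ℂ] Verma W :=
    TensorProduct.lift (LinearMap.mk₂ ℂ (fun (u : U) (v : V) => u • degOne (θ v))
      (fun u u' v => add_smul _ _ _) (fun c u v => smul_assoc _ _ _)
      (fun u v v' => by rw [map_add, map_add, smul_add])
      (fun c u v => by rw [map_smul, map_smul, smul_comm])) with hf
  have hft : ∀ u v, f (u ⊗ₜ[ℂ] v) = u • degOne (θ v) := fun u v => rfl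
  have hfs : ∀ (u : U) z, f (u • z) = u • f z := by
    intro u z
    induction z with
    | zero => simp
    | tmul u' v => rw [TensorProduct.smul_tmul', hft, hft, smul_eq_mul, mul_smul]
    | add a b ha hb => rw [smul_add, map_add, ha, hb, map_add, smul_add]
  set g : U ⊗[ℂ] V →ₗ[U] Verma W := { toFun := f, map_add' := map_add f, map_smul' := hfs } with hg
  have hk : inducedRel V ≤ LinearMap.ker g := by
    refine Submodule.span_le.mpr ?_
    rintro _ ⟨u, a, ha, v, rfl⟩
    change g _ = 0
    rw [map_sub, sub_eq_zero]
    change (u * toU a) • degOne (θ v) = u • degOne (θ ⁅linPart a.1, v⁆)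
    have ha1 : ev a.1 ∈ nonneg := mem_nonneg_ev.mpr ha.1
    have ha2 : od a.2 ∈ nonneg := mem_nonneg_od.mpr ha.2
    have e : toU a = toU (ev a.1) + toU (od a.2) := by
      rw [← map_add, ev, od, Prod.mk_add_mk, add_zero, zero_add]
    rw [mul_smul, e, add_smul, h2 v a.2 ha2, add_zero, h1, toU_ev_smul_degOne ha1]
  refine ⟨(inducedRel V).liftQ g hk, ?_, fun v => one_smul U (degOne (θ v))⟩
  refine ⟨5 * 5, fun k => dU (finProdFinEquiv.symm k).1 (finProdFinEquiv.symm k).2,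
    fun k => LinearMap.proj (finProdFinEquiv.symm k).2 ∘ₗ LinearMap.proj (finProdFinEquiv.symm k).1
      ∘ₗ θ, fun k => ?_, fun u v => ?_⟩
  · rw [UnegDeg, pow_one]
    exact Submodule.subset_span ⟨finProdFinEquiv.symm k, rfl⟩
  · change u • degOne (θ v) = _
    refine Eq.trans ?_ (Equiv.sum_comp finProdFinEquiv.symm (fun p : Fin 5 × Fin 5 =>
      (tmul (u * dU p.1 p.2) (θ v p.1 p.2) : Verma W))).symm
    rw [degOne_apply, Fintype.sum_prod_type, Finset.smul_sum]
    exact Finset.sum_congr rfl fun i _ => Finset.smul_sum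

/-- Antisymmetrizing is harmless because `d_{ij} = -d_{ji}`, and it makes the coefficients unique.
-/
theorem HasDegree.exists_antisymm {φ : Verma V →ₗ[U] Verma W} (h : HasDegree 1 φ) (v : V) :
    ∃ w : Fin 5 → Fin 5 → W, (∀ i j, w i j = - w j i) ∧ φ (tmul 1 v) = degOne w := by
  obtain ⟨r, u, θ, hu, hφ⟩ := h
  have : φ (tmul 1 v) ∈ LinearMap.range (degOne (V := W)) := by
    rw [hφ]
    refine Submodule.sum_mem _ fun i _ => ?_
    rw [one_mul]
    exact tmul_mem_range_degOne (hu i) _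
  obtain ⟨w, hw⟩ := this
  refine ⟨fun i j => (1 / 2 : ℂ) • (w i j - w j i), fun i j => ?_, ?_⟩
  · rw [← smul_neg, neg_sub]
  · have : (fun i j => (1 / 2 : ℂ) • (w i j - w j i)) =
        (1 / 2 : ℂ) • (w - fun i j => w j i) := rfl
    rw [this, map_smul, map_sub, degOne_swap w, sub_neg_eq_add, ← two_smul ℂ, smul_smul, ← hw]
    norm_num

end Morphisms

/-! ### Constant coefficient derivations -/

/-- The derivation `∂/∂x_i`. -/
def pdx (i : Fin 5) : Derivation ℂ Poly Poly := MvPolynomial.pderiv (Gen.x i)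

/-- The derivation `∂/∂x_i^*`. -/
def pdxs (i : Fin 5) : Derivation ℂ Poly Poly := MvPolynomial.pderiv (Gen.xs i)

/-- The derivation `∂/∂x_{ij}`, antisymmetric in `i` and `j`. -/
def pdxx (i j : Fin 5) : Derivation ℂ Poly Poly :=
  if h : i < j then MvPolynomial.pderiv (Gen.xx ⟨(i, j), h⟩)
  else if h : j < i then - MvPolynomial.pderiv (Gen.xx ⟨(j, i), h⟩) else 0

/-- The derivation `∂/∂x_{ij}^*`, antisymmetric in `i` and `j`. -/
def pdxxs (i j : Fin 5) : Derivation ℂ Poly Poly :=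
  if h : i < j then MvPolynomial.pderiv (Gen.xxs ⟨(i, j), h⟩)
  else if h : j < i then - MvPolynomial.pderiv (Gen.xxs ⟨(j, i), h⟩) else 0

theorem pderiv_X_gen (g h : Gen) : MvPolynomial.pderiv g (MvPolynomial.X h : Poly) =
    by classical exact if h = g then 1 else 0 := by
  classical
  rw [MvPolynomial.pderiv_X, Pi.single_apply]

theorem vxx_of_lt (p : Pair) : MvPolynomial.X (Gen.xx p) = vxx p.1.1 p.1.2 := by
  obtain ⟨⟨k, l⟩, h⟩ := p
  have h' : k < l := h
  simp [vxx, h']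

theorem vxxs_of_lt (p : Pair) : MvPolynomial.X (Gen.xxs p) = vxxs p.1.1 p.1.2 := by
  obtain ⟨⟨k, l⟩, h⟩ := p
  have h' : k < l := h
  simp [vxxs, h']

/-- Two derivations that agree on all generators are equal. -/
theorem poly_derivation_ext {D D' : Derivation ℂ Poly Poly} (h1 : ∀ k, D (vx k) = D' (vx k))
    (h2 : ∀ k l, D (vxx k l) = D' (vxx k l)) (h3 : ∀ k l, D (vxxs k l) = D' (vxxs k l))
    (h4 : ∀ k, D (vxs k) = D' (vxs k)) : D = D' := by
  refine MvPolynomial.derivation_ext fun g => ?_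
  cases g with
  | x k => exact h1 k
  | xx p => rw [vxx_of_lt]; exact h2 _ _
  | xxs p => rw [vxxs_of_lt]; exact h3 _ _
  | xs k => exact h4 k

section pdTable

variable (i j k l : Fin 5)

theorem pdx_vx : pdx i (vx k) = if k = i then 1 else 0 := by
  simp [pdx, vx, pderiv_X_gen]

theorem pdx_vxs : pdx i (vxs k) = 0 := by
  simp [pdx, vxs, pderiv_X_gen]

theorem pdx_vxx : pdx i (vxx k l) = 0 := by
  unfold vxx
  split_ifs <;> simp [pdx, pderiv_X_gen]

theorem pdx_vxxs : pdx i (vxxs k l) = 0 := by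
  unfold vxxs
  split_ifs <;> simp [pdx, pderiv_X_gen]

theorem pdxs_vx : pdxs i (vx k) = 0 := by
  simp [pdxs, vx, pderiv_X_gen]

theorem pdxs_vxs : pdxs i (vxs k) = if k = i then 1 else 0 := by
  simp [pdxs, vxs, pderiv_X_gen]

theorem pdxs_vxx : pdxs i (vxx k l) = 0 := by
  unfold vxx
  split_ifs <;> simp [pdxs, pderiv_X_gen]

theorem pdxs_vxxs : pdxs i (vxxs k l) = 0 := by
  unfold vxxs
  split_ifs <;> simp [pdxs, pderiv_X_gen]

theorem pdxx_vx : pdxx i j (vx k) = 0 := by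
  unfold pdxx
  split_ifs <;> simp [vx, pderiv_X_gen]

theorem pdxx_vxs : pdxx i j (vxs k) = 0 := by
  unfold pdxx
  split_ifs <;> simp [vxs, pderiv_X_gen]

theorem pdxx_vxxs : pdxx i j (vxxs k l) = 0 := by
  unfold pdxx vxxs
  split_ifs <;> simp [pderiv_X_gen]

theorem pdxxs_vx : pdxxs i j (vx k) = 0 := by
  unfold pdxxs
  split_ifs <;> simp [vx, pderiv_X_gen]

theorem pdxxs_vxs : pdxxs i j (vxs k) = 0 := by
  unfold pdxxs
  split_ifs <;> simp [vxs, pderiv_X_gen]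

theorem pdxxs_vxx : pdxxs i j (vxx k l) = 0 := by
  unfold pdxxs vxx
  split_ifs <;> simp [pderiv_X_gen]

theorem pdxx_vxx : pdxx i j (vxx k l) =
    (if k = i ∧ l = j then 1 else 0) - (if k = j ∧ l = i then 1 else 0) := by
  unfold pdxx vxx
  rcases lt_trichotomy i j with h | rfl | h <;> rcases lt_trichotomy k l with h' | rfl | h'
  · have e : ¬ (k = j ∧ l = i) := by omega
    simp [h, h', pderiv_X_gen, e]
  · have e : ¬ (k = i ∧ k = j) := by omega
    have e' : ¬ (k = j ∧ k = i) := by omega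
    simp [e, e']
  · have e : ¬ (k = i ∧ l = j) := by omega
    simp [h, h', h'.not_gt, pderiv_X_gen, e, and_comm]
  · simp
  · simp
  · simp
  · have e : ¬ (k = i ∧ l = j) := by omega
    simp [h, h', h.not_gt, pderiv_X_gen, e]
  · have e : ¬ (k = i ∧ k = j) := by omega
    have e' : ¬ (k = j ∧ k = i) := by omega
    simp [e, e']
  · have e : ¬ (k = j ∧ l = i) := by omega
    simp [h, h', h.not_gt, h'.not_gt, pderiv_X_gen, e, and_comm]

theorem pdxxs_vxxs : pdxxs i j (vxxs k l) =
    (if k = i ∧ l = j then 1 else 0) - (if k = j ∧ l = i then 1 else 0) := by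
  unfold pdxxs vxxs
  rcases lt_trichotomy i j with h | rfl | h <;> rcases lt_trichotomy k l with h' | rfl | h'
  · have e : ¬ (k = j ∧ l = i) := by omega
    simp [h, h', pderiv_X_gen, e]
  · have e : ¬ (k = i ∧ k = j) := by omega
    have e' : ¬ (k = j ∧ k = i) := by omega
    simp [e, e']
  · have e : ¬ (k = i ∧ l = j) := by omega
    simp [h, h', h'.not_gt, pderiv_X_gen, e, and_comm]
  · simp
  · simp
  · simp
  · have e : ¬ (k = i ∧ l = j) := by omega
    simp [h, h', h.not_gt, pderiv_X_gen, e]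
  · have e : ¬ (k = i ∧ k = j) := by omega
    have e' : ¬ (k = j ∧ k = i) := by omega
    simp [e, e']
  · have e : ¬ (k = j ∧ l = i) := by omega
    simp [h, h', h.not_gt, h'.not_gt, pderiv_X_gen, e, and_comm]

end pdTable

theorem derivation_sum_apply (D : Fin 5 → Derivation ℂ Poly Poly) (f : Poly) :
    (∑ k, D k) f = ∑ k, D k f := by
  simp only [Fin.sum_univ_five, Derivation.add_apply]

/-- Both sides of the commutator formula are derivations, so comparison on generators suffices. With
such formulas, families of derivatives are equivariant for `tensorAct`; this is the source of the
maps behind `∇_A` and `∇_B`. -/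
theorem pdx_act (M : Matrix (Fin 5) (Fin 5) ℂ) (i : Fin 5) (f : Poly) :
    pdx i (act M f) = act M (pdx i f) + ∑ k, M i k • pdx k f := by
  have h : ⁅pdx i, act M⁆ = ∑ k, M i k • pdx k := by
    refine poly_derivation_ext (fun k => ?_) (fun k l => ?_) (fun k l => ?_) (fun k => ?_) <;>
    simp [Derivation.commutator_apply, derivation_sum_apply, act_vx, act_vxs, act_vxx, act_vxxs,
      pdx_vx, pdx_vxs, pdx_vxx, pdx_vxxs, apply_ite]
  have e := congrArg (fun D => D f) h
  simp only [Derivation.commutator_apply, derivation_sum_apply, Derivation.smul_apply] at e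
  rw [← e, add_sub_cancel]

theorem pdxs_act (M : Matrix (Fin 5) (Fin 5) ℂ) (i : Fin 5) (f : Poly) :
    pdxs i (act M f) = act M (pdxs i f) - ∑ k, M k i • pdxs k f := by
  have h : ⁅pdxs i, act M⁆ = - ∑ k, M k i • pdxs k := by
    refine poly_derivation_ext (fun k => ?_) (fun k l => ?_) (fun k l => ?_) (fun k => ?_) <;>
    simp [Derivation.commutator_apply, derivation_sum_apply, act_vx, act_vxs, act_vxx, act_vxxs,
      pdxs_vx, pdxs_vxs, pdxs_vxx, pdxs_vxxs, apply_ite]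
  have e := congrArg (fun D => D f) h
  simp only [Derivation.commutator_apply, derivation_sum_apply, Derivation.smul_apply,
    Derivation.neg_apply] at e
  rw [sub_eq_add_neg, ← e, add_sub_cancel]

theorem pdxx_act (M : Matrix (Fin 5) (Fin 5) ℂ) (i j : Fin 5) (f : Poly) :
    pdxx i j (act M f) = act M (pdxx i j f) +
      ∑ k, (M i k • pdxx k j f + M j k • pdxx i k f) := by
  have h : ⁅pdxx i j, act M⁆ = ∑ k, (M i k • pdxx k j + M j k • pdxx i k) := by
    refine poly_derivation_ext (fun k => ?_) (fun k l => ?_) (fun k l => ?_) (fun k => ?_)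
    · simp [Derivation.commutator_apply, derivation_sum_apply, act_vx, pdxx_vx]
    · simp only [Derivation.commutator_apply, derivation_sum_apply, act_vxx, pdxx_vxx, map_sum,
        map_add, Derivation.map_smul, Derivation.add_apply, Derivation.smul_apply, ite_and,
        smul_sub, smul_ite, smul_zero, Finset.sum_add_distrib, Finset.sum_sub_distrib,
        Finset.sum_ite_eq', Finset.sum_ite_eq, Finset.mem_univ, if_true, Finset.sum_ite_irrel,
        Finset.sum_const_zero, map_sub, apply_ite (act M), map_zero, Derivation.map_one_eq_zero,
        ite_self, sub_self, sub_zero]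
      split_ifs <;> module
    · simp [Derivation.commutator_apply, derivation_sum_apply, act_vxxs, pdxx_vxxs]
    · simp [Derivation.commutator_apply, derivation_sum_apply, act_vxs, pdxx_vxs]
  have e := congrArg (fun D => D f) h
  simp only [Derivation.commutator_apply, derivation_sum_apply, Derivation.add_apply,
    Derivation.smul_apply] at e
  rw [← e, add_sub_cancel]

theorem pdxxs_act (M : Matrix (Fin 5) (Fin 5) ℂ) (i j : Fin 5) (f : Poly) :
    pdxxs i j (act M f) = act M (pdxxs i j f) -
      ∑ k, (M k i • pdxxs k j f + M k j • pdxxs i k f) := by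
  have h : ⁅pdxxs i j, act M⁆ = - ∑ k, (M k i • pdxxs k j + M k j • pdxxs i k) := by
    refine poly_derivation_ext (fun k => ?_) (fun k l => ?_) (fun k l => ?_) (fun k => ?_)
    · simp [Derivation.commutator_apply, derivation_sum_apply, act_vx, pdxxs_vx]
    · simp [Derivation.commutator_apply, derivation_sum_apply, act_vxx, pdxxs_vxx]
    · simp only [Derivation.commutator_apply, derivation_sum_apply, act_vxxs, pdxxs_vxxs, map_sum,
        map_add, Derivation.map_smul, Derivation.add_apply, Derivation.smul_apply, ite_and,
        smul_sub, smul_ite, smul_zero, Finset.sum_add_distrib, Finset.sum_sub_distrib,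
        Finset.sum_ite_eq', Finset.sum_ite_eq, Finset.mem_univ, if_true, Finset.sum_ite_irrel,
        Finset.sum_const_zero, map_sub, apply_ite (act M), map_zero, Derivation.map_one_eq_zero,
        ite_self, sub_self, sub_zero, map_neg, Derivation.neg_apply]
      split_ifs <;> module
    · simp [Derivation.commutator_apply, derivation_sum_apply, act_vxs, pdxxs_vxs]
  have e := congrArg (fun D => D f) h
  simp only [Derivation.commutator_apply, derivation_sum_apply, Derivation.add_apply,
    Derivation.smul_apply, Derivation.neg_apply] at e
  rw [sub_eq_add_neg, ← e, add_sub_cancel]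

/-! ### The invariant bilinear form on the symmetric algebra -/

/-- The factorial of a multi-index. -/
def multiFactorial (m : Gen →₀ ℕ) : ℕ := m.prod fun _ k => k.factorial

theorem multiFactorial_pos (m : Gen →₀ ℕ) : 0 < multiFactorial m :=
  Finset.prod_pos fun _ _ => Nat.factorial_pos _

theorem multiFactorial_add_single (m : Gen →₀ ℕ) (g : Gen) :
    multiFactorial (m + Finsupp.single g 1) = (m g + 1) * multiFactorial m := by
  classical
  have h : ∀ m : Gen →₀ ℕ, multiFactorial m =
      (m g).factorial * (m.erase g).prod fun _ k => k.factorial := by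
    intro m
    exact (Finsupp.mul_prod_erase' m g _ fun _ => rfl).symm
  rw [h, h m, Finsupp.erase_add, Finsupp.erase_single, add_zero, Finsupp.add_apply,
    Finsupp.single_eq_same, Nat.factorial_succ, mul_assoc]

/-- The bilinear form for which monomials are orthogonal and `⟨x^m, x^m⟩ = m!`. -/
def fischer : Poly →ₗ[ℂ] Poly →ₗ[ℂ] ℂ :=
  (MvPolynomial.basisMonomials Gen ℂ).constr ℂ
    fun m => (multiFactorial m : ℂ) • MvPolynomial.lcoeff ℂ m

theorem fischer_monomial (m : Gen →₀ ℕ) (g : Poly) :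
    fischer (MvPolynomial.monomial m 1) g = multiFactorial m * MvPolynomial.coeff m g := by
  have h := (MvPolynomial.basisMonomials Gen ℂ).constr_basis ℂ
    (fun m => (multiFactorial m : ℂ) • MvPolynomial.lcoeff ℂ m) m
  rw [MvPolynomial.coe_basisMonomials] at h
  rw [fischer, h]
  rfl

/-- The normalization by `m!` is chosen so that multiplication by a variable is adjoint to
differentiation. -/
theorem fischer_X_mul (h : Gen) (f g : Poly) :
    fischer (MvPolynomial.X h * f) g = fischer f (MvPolynomial.pderiv h g) := by
  induction f using MvPolynomial.induction_on' with
  | monomial m c =>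
    have : (MvPolynomial.monomial m c : Poly) = c • MvPolynomial.monomial m 1 := by
      rw [MvPolynomial.smul_monomial, smul_eq_mul, mul_one]
    rw [this, mul_smul_comm, map_smul, map_smul, LinearMap.smul_apply, LinearMap.smul_apply]
    congr 1
    rw [mul_comm, MvPolynomial.X, MvPolynomial.monomial_mul, mul_one, fischer_monomial,
      fischer_monomial, multiFactorial_add_single, MvPolynomial.coeff_pderiv]
    push_cast
    ring
  | add p q hp hq => rw [mul_add, map_add, map_add, LinearMap.add_apply, LinearMap.add_apply, hp, hq]

theorem fischer_one (g : Poly) : fischer 1 g = MvPolynomial.coeff 0 g := by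
  have := fischer_monomial 0 g
  simpa [multiFactorial] using this

theorem fischer_symm (f g : Poly) : fischer f g = fischer g f := by
  induction f using MvPolynomial.induction_on' with
  | monomial m c =>
    induction g using MvPolynomial.induction_on' with
    | monomial m' c' =>
      have : ∀ m c, (MvPolynomial.monomial m c : Poly) = c • MvPolynomial.monomial m 1 := by
        intro m c
        rw [MvPolynomial.smul_monomial, smul_eq_mul, mul_one]
      classical
      rw [this m, this m', map_smul, map_smul, map_smul, map_smul, LinearMap.smul_apply,
        LinearMap.smul_apply, fischer_monomial, fischer_monomial, MvPolynomial.coeff_monomial,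
        MvPolynomial.coeff_monomial]
      by_cases h : m = m'
      · subst h
        simp only [smul_eq_mul]
        ring
      · simp [h, Ne.symm h]
    | add p q hp hq => rw [map_add, map_add, LinearMap.add_apply, hp, hq]
  | add p q hp hq => rw [map_add, map_add, LinearMap.add_apply, hp, hq]

theorem fischer_vx_mul (i : Fin 5) (f g : Poly) : fischer (vx i * f) g = fischer f (pdx i g) :=
  fischer_X_mul _ _ _

theorem fischer_vxs_mul (i : Fin 5) (f g : Poly) : fischer (vxs i * f) g = fischer f (pdxs i g) :=
  fischer_X_mul _ _ _

theorem fischer_vxx_mul (i j : Fin 5) (f g : Poly) :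
    fischer (vxx i j * f) g = fischer f (pdxx i j g) := by
  unfold vxx pdxx
  split_ifs
  · exact fischer_X_mul _ _ _
  · rw [neg_mul, map_neg, LinearMap.neg_apply, fischer_X_mul, Derivation.neg_apply, map_neg]
  · simp

theorem fischer_vxxs_mul (i j : Fin 5) (f g : Poly) :
    fischer (vxxs i j * f) g = fischer f (pdxxs i j g) := by
  unfold vxxs pdxxs
  split_ifs
  · exact fischer_X_mul _ _ _
  · rw [neg_mul, map_neg, LinearMap.neg_apply, fischer_X_mul, Derivation.neg_apply, map_neg]
  · simp

/-- Induction on polynomials in the variables `x_i`, `x_{ij}`, `x_{ij}^*`, `x_i^*`. -/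
theorem poly_induction {P : Poly → Prop} (h1 : P 1) (hadd : ∀ f g, P f → P g → P (f + g))
    (hsmul : ∀ (c : ℂ) f, P f → P (c • f)) (hx : ∀ i f, P f → P (vx i * f))
    (hxx : ∀ i j f, P f → P (vxx i j * f)) (hxxs : ∀ i j f, P f → P (vxxs i j * f))
    (hxs : ∀ i f, P f → P (vxs i * f)) (f : Poly) : P f := by
  induction f using MvPolynomial.induction_on with
  | C c =>
    rw [← mul_one (MvPolynomial.C c), ← MvPolynomial.smul_eq_C_mul]
    exact hsmul c _ h1
  | add p q hp hq => exact hadd _ _ hp hq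
  | mul_X p g hp =>
    rw [mul_comm]
    cases g with
    | x i => exact hx i p hp
    | xx q => rw [vxx_of_lt]; exact hxx _ _ p hp
    | xxs q => rw [vxxs_of_lt]; exact hxxs _ _ p hp
    | xs i => exact hxs i p hp

theorem constantCoeff_act (A : Matrix (Fin 5) (Fin 5) ℂ) (f : Poly) :
    MvPolynomial.coeff 0 (act A f) = 0 := by
  have h0 : ∀ g : Poly, MvPolynomial.coeff 0 g = MvPolynomial.constantCoeff g := fun _ => rfl
  rw [h0]
  have e : ∀ i j, MvPolynomial.constantCoeff (vxx i j) = 0 := by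
    intro i j
    unfold vxx
    split_ifs <;> simp
  have e' : ∀ i j, MvPolynomial.constantCoeff (vxxs i j) = 0 := by
    intro i j
    unfold vxxs
    split_ifs <;> simp
  induction f using poly_induction with
  | h1 => simp
  | hadd f g hf hg => rw [map_add, map_add, hf, hg, add_zero]
  | hsmul c f hf => rw [Derivation.map_smul, MvPolynomial.smul_eq_C_mul, map_mul, hf, mul_zero]
  | hx i f hf => simp [Derivation.leibniz, hf, act_vx, MvPolynomial.smul_eq_C_mul]
  | hxx i j f hf => simp [Derivation.leibniz, hf, act_vxx, e, MvPolynomial.smul_eq_C_mul]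
  | hxxs i j f hf => simp [Derivation.leibniz, hf, act_vxxs, e', MvPolynomial.smul_eq_C_mul]
  | hxs i f hf => simp [Derivation.leibniz, hf, act_vxs, MvPolynomial.smul_eq_C_mul]

/-- Contravariance of the form: a generator is moved across as a derivative, and the commutators of
derivatives with `act` supply the action of `Aᵀ`. Raising and lowering operators are in particular
adjoint. -/
theorem fischer_act (A : Matrix (Fin 5) (Fin 5) ℂ) (f g : Poly) :
    fischer (act A f) g = fischer f (act A.transpose g) := by
  induction f using poly_induction generalizing g with
  | h1 => rw [Derivation.map_one_eq_zero, map_zero, fischer_one, constantCoeff_act]; rfl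
  | hadd f f' hf hf' => simp only [map_add, LinearMap.add_apply, hf, hf']
  | hsmul c f hf => simp only [Derivation.map_smul, map_smul, LinearMap.smul_apply, hf]
  | hx i f hf =>
    rw [Derivation.leibniz, act_vx, smul_eq_mul, smul_eq_mul, map_add, LinearMap.add_apply,
      fischer_vx_mul, fischer_vx_mul, hf, pdx_act, map_add, mul_comm, Finset.sum_mul]
    simp only [smul_mul_assoc, map_sum, map_smul, LinearMap.sum_apply, LinearMap.smul_apply,
      fischer_vx_mul, Matrix.transpose_apply]
  | hxx i j f hf =>
    rw [Derivation.leibniz, act_vxx, smul_eq_mul, smul_eq_mul, map_add, LinearMap.add_apply,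
      fischer_vxx_mul, fischer_vxx_mul, hf, pdxx_act, map_add, mul_comm, Finset.sum_mul]
    simp only [add_mul, smul_mul_assoc, map_sum, map_add, map_smul, LinearMap.sum_apply,
      LinearMap.add_apply, LinearMap.smul_apply, fischer_vxx_mul, Matrix.transpose_apply]
  | hxxs i j f hf =>
    rw [Derivation.leibniz, act_vxxs, smul_eq_mul, smul_eq_mul, map_add, LinearMap.add_apply,
      fischer_vxxs_mul, fischer_vxxs_mul, hf, pdxxs_act, map_sub, mul_comm, neg_mul, Finset.sum_mul]
    simp only [add_mul, smul_mul_assoc, map_neg, map_sum, map_add, map_smul, LinearMap.sum_apply,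
      LinearMap.add_apply, LinearMap.smul_apply, LinearMap.neg_apply, fischer_vxxs_mul,
      Matrix.transpose_apply, sub_eq_add_neg]
  | hxs i f hf =>
    rw [Derivation.leibniz, act_vxs, smul_eq_mul, smul_eq_mul, map_add, LinearMap.add_apply,
      fischer_vxs_mul, fischer_vxs_mul, hf, pdxs_act, map_sub, mul_comm, neg_mul, Finset.sum_mul]
    simp only [smul_mul_assoc, map_neg, map_sum, map_smul, LinearMap.sum_apply,
      LinearMap.smul_apply, LinearMap.neg_apply, fischer_vxs_mul, Matrix.transpose_apply,
      sub_eq_add_neg]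

/-- Complex conjugation of the coefficients. -/
def polyConj : Poly →+* Poly := MvPolynomial.map (starRingEnd ℂ)

theorem polyConj_smul (c : ℂ) (f : Poly) : polyConj (c • f) = starRingEnd ℂ c • polyConj f := by
  simp [polyConj, MvPolynomial.smul_eq_C_mul]

theorem polyConj_vx (i : Fin 5) : polyConj (vx i) = vx i := by simp [polyConj]

theorem polyConj_vxs (i : Fin 5) : polyConj (vxs i) = vxs i := by simp [polyConj]

theorem polyConj_vxx (i j : Fin 5) : polyConj (vxx i j) = vxx i j := by
  unfold vxx
  split_ifs <;> simp [polyConj]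

theorem polyConj_vxxs (i j : Fin 5) : polyConj (vxxs i j) = vxxs i j := by
  unfold vxxs
  split_ifs <;> simp [polyConj]

theorem polyConj_act (A : Matrix (Fin 5) (Fin 5) ℂ) (f : Poly) :
    polyConj (act A f) = act (A.map (starRingEnd ℂ)) (polyConj f) := by
  induction f using poly_induction with
  | h1 => simp
  | hadd f f' hf hf' => simp only [map_add, hf, hf']
  | hsmul c f hf => simp only [Derivation.map_smul, polyConj_smul, hf]
  | hx i f hf =>
    simp only [Derivation.leibniz, smul_eq_mul, map_add, map_mul, hf, act_vx, map_sum,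
      polyConj_smul, polyConj_vx, Matrix.map_apply]
  | hxx i j f hf =>
    simp only [Derivation.leibniz, smul_eq_mul, map_add, map_mul, hf, act_vxx, map_sum,
      polyConj_smul, polyConj_vxx, Matrix.map_apply]
  | hxxs i j f hf =>
    simp only [Derivation.leibniz, smul_eq_mul, map_add, map_mul, map_neg, hf, act_vxxs, map_sum,
      polyConj_smul, polyConj_vxxs, Matrix.map_apply]
  | hxs i f hf =>
    simp only [Derivation.leibniz, smul_eq_mul, map_add, map_mul, map_neg, hf, act_vxs, map_sum,
      polyConj_smul, polyConj_vxs, Matrix.map_apply]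

theorem fischer_eq_sum (f g : Poly) : fischer f g =
    ∑ m ∈ f.support, multiFactorial m * (MvPolynomial.coeff m f * MvPolynomial.coeff m g) := by
  conv_lhs => rw [f.as_sum]
  rw [map_sum, LinearMap.sum_apply]
  refine Finset.sum_congr rfl fun m _ => ?_
  have : (MvPolynomial.monomial m (MvPolynomial.coeff m f) : Poly) =
      MvPolynomial.coeff m f • MvPolynomial.monomial m 1 := by
    rw [MvPolynomial.smul_monomial, smul_eq_mul, mul_one]
  rw [this, map_smul, LinearMap.smul_apply, fischer_monomial, smul_eq_mul]
  ring

/-- The pairing of `f` with its conjugate is the sum of `m! |c_m|²` over the coefficients `c_m` of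
`f`. -/
theorem eq_zero_of_fischer_polyConj {f : Poly} (h : fischer f (polyConj f) = 0) : f = 0 := by
  rw [fischer_eq_sum] at h
  have e : ∀ m, (multiFactorial m : ℂ) * (MvPolynomial.coeff m f *
      MvPolynomial.coeff m (polyConj f)) =
      ((multiFactorial m * Complex.normSq (MvPolynomial.coeff m f) : ℝ) : ℂ) := by
    intro m
    rw [polyConj, MvPolynomial.coeff_map, Complex.mul_conj]
    push_cast
    rfl
  simp only [e] at h
  rw [← Complex.ofReal_sum, Complex.ofReal_eq_zero, Finset.sum_eq_zero_iff_of_nonneg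
    (fun m _ => mul_nonneg (Nat.cast_nonneg _) (Complex.normSq_nonneg _))] at h
  ext m
  by_cases hm : m ∈ f.support
  · have := h m hm
    rw [mul_eq_zero, Complex.normSq_eq_zero] at this
    rw [this.resolve_left (by exact_mod_cast (multiFactorial_pos m).ne'), MvPolynomial.coeff_zero]
  · rw [MvPolynomial.notMem_support_iff.mp hm, MvPolynomial.coeff_zero]

/-! ### Highest weight vectors of `F(λ)` -/

theorem F_le (lam : Fin 4 → ℕ) (P : Submodule ℂ Poly) (h : hwPoly lam ∈ P)
    (hact : ∀ A : sl5, ∀ f ∈ P, act A.1 f ∈ P) : (F lam).toSubmodule ≤ P := by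
  have : F lam ≤ ({ P with lie_mem := fun {A f} hf => hact A f hf } : LieSubmodule ℂ sl5 Poly) :=
    LieSubmodule.lieSpan_le.mpr (Set.singleton_subset_iff.mpr h)
  exact this

theorem act_mem_F {lam : Fin 4 → ℕ} (A : sl5) {f : Poly} (hf : f ∈ F lam) : act A.1 f ∈ F lam :=
  (F lam).lie_mem hf

/-- The elementary matrices, as linear operators on polynomials. -/
abbrev actE (i j : Fin 5) : Derivation ℂ Poly Poly := act (Matrix.single i j 1)

theorem actE_vx (i j k : Fin 5) : actE i j (vx k) = if j = k then vx i else 0 := by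
  simp [act_vx, Matrix.single_apply, ite_and, ite_smul]

theorem actE_vxs (i j k : Fin 5) : actE i j (vxs k) = if i = k then - vxs j else 0 := by
  by_cases h : i = k <;> simp [act_vxs, Matrix.single_apply, ite_and, ite_smul, h]

theorem actE_vxx (i j k l : Fin 5) : actE i j (vxx k l) =
    (if j = k then vxx i l else 0) + (if j = l then vxx k i else 0) := by
  simp [act_vxx, Matrix.single_apply, ite_and, ite_smul, Finset.sum_add_distrib]

theorem actE_vxxs (i j k l : Fin 5) : actE i j (vxxs k l) =
    - ((if i = k then vxxs j l else 0) + (if i = l then vxxs k j else 0)) := by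
  by_cases h : i = k <;> by_cases h' : i = l <;>
    simp [act_vxxs, Matrix.single_apply, ite_and, ite_smul, Finset.sum_add_distrib, h, h']

theorem act_eq_sum_actE (A : Matrix (Fin 5) (Fin 5) ℂ) (f : Poly) :
    act A f = ∑ i, ∑ j, A i j • actE i j f := by
  have hs : ∀ (s : Finset (Fin 5 × Fin 5)) (B : Fin 5 × Fin 5 → Matrix (Fin 5) (Fin 5) ℂ),
      act (∑ p ∈ s, B p) f = ∑ p ∈ s, act (B p) f := by
    classical
    intro s B
    induction s using Finset.induction_on with
    | empty =>
      have := act_smul 0 (0 : Matrix (Fin 5) (Fin 5) ℂ)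
      rw [zero_smul, zero_smul] at this
      simp [this]
    | insert a s ha ih => rw [Finset.sum_insert ha, Finset.sum_insert ha, act_add,
        Derivation.add_apply, ih]
  have e : A = ∑ p : Fin 5 × Fin 5, A p.1 p.2 • Matrix.single p.1 p.2 1 := by
    rw [Fintype.sum_prod_type]
    conv_lhs => rw [Matrix.matrix_eq_sum_single A]
    simp [Matrix.smul_single]
  conv_lhs => rw [e]
  rw [hs, Fintype.sum_prod_type]
  simp only [act_smul, Derivation.smul_apply]

/-- The off-diagonal elementary matrices in `𝔰𝔩₅`. -/
def slE (i j : Fin 5) (h : i ≠ j) : sl5 :=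
  ⟨Matrix.single i j 1, Matrix.trace_single_eq_of_ne i j 1 h⟩

/-- The diagonal matrices in `𝔰𝔩₅` with eigenvalues `1` and `-1` at `i` and `j`. -/
def slH (i j : Fin 5) : sl5 :=
  ⟨Matrix.single i i 1 - Matrix.single j j 1, by
    change Matrix.trace (Matrix.single i i (1 : ℂ) - Matrix.single j j 1) = 0
    rw [Matrix.trace_sub, Matrix.trace_single_eq_same, Matrix.trace_single_eq_same, sub_self]⟩

theorem actE_mem_F {lam : Fin 4 → ℕ} {i j : Fin 5} (h : i ≠ j) {f : Poly} (hf : f ∈ F lam) :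
    actE i j f ∈ F lam := act_mem_F (slE i j h) hf

theorem act_slH (i j : Fin 5) (f : Poly) : act (slH i j).1 f = actE i i f - actE j j f := by
  change act (Matrix.single i i 1 - Matrix.single j j 1) f = _
  rw [sub_eq_add_neg, ← neg_one_smul ℂ, act_add, act_smul, Derivation.add_apply,
    Derivation.smul_apply, neg_one_smul, ← sub_eq_add_neg]

/-- The eigenvalue of `E_{ii}` on the highest weight vector. -/
def wt (lam : Fin 4 → ℕ) : Fin 5 → ℤ :=
  ![lam 0 + lam 1, lam 1, 0, - lam 2, - lam 2 - lam 3]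

theorem derivation_pow_eigen {D : Derivation ℂ Poly Poly} {f : Poly} {c : ℂ} (h : D f = c • f)
    (n : ℕ) : D (f ^ n) = (n * c) • f ^ n := by
  rw [Derivation.leibniz_pow, h]
  cases n with
  | zero => simp
  | succ k =>
    rw [add_tsub_cancel_right, smul_eq_mul, mul_smul_comm, ← pow_succ, mul_smul, Nat.cast_smul_eq_nsmul]

theorem derivation_mul_eigen {D : Derivation ℂ Poly Poly} {f g : Poly} {a b : ℂ} (hf : D f = a • f)
    (hg : D g = b • g) : D (f * g) = (a + b) • (f * g) := by
  rw [Derivation.leibniz, hf, hg, smul_eq_mul, smul_eq_mul, mul_smul_comm, mul_smul_comm, mul_comm g,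
    add_smul, add_comm]

theorem actE_self_hwPoly (lam : Fin 4 → ℕ) (i : Fin 5) :
    actE i i (hwPoly lam) = (wt lam i : ℂ) • hwPoly lam := by
  have h1 : actE i i (vx 0) = (if i = 0 then 1 else 0 : ℂ) • vx 0 := by
    rw [actE_vx]
    split_ifs with h <;> simp [h]
  have h2 : actE i i (vxx 0 1) = (if i = 0 ∨ i = 1 then 1 else 0 : ℂ) • vxx 0 1 := by
    rw [actE_vxx]
    fin_cases i <;> simp
  have h3 : actE i i (vxxs 3 4) = (if i = 3 ∨ i = 4 then -1 else 0 : ℂ) • vxxs 3 4 := by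
    rw [actE_vxxs]
    fin_cases i <;> simp
  have h4 : actE i i (vxs 4) = (if i = 4 then -1 else 0 : ℂ) • vxs 4 := by
    rw [actE_vxs]
    split_ifs with h <;> simp [h]
  rw [hwPoly, derivation_mul_eigen (derivation_mul_eigen (derivation_mul_eigen
    (derivation_pow_eigen h1 _) (derivation_pow_eigen h2 _)) (derivation_pow_eigen h3 _))
    (derivation_pow_eigen h4 _)]
  congr 1
  fin_cases i <;> simp [wt] <;> ring

theorem derivation_mul_zero {D : Derivation ℂ Poly Poly} {f g : Poly} (hf : D f = 0)
    (hg : D g = 0) : D (f * g) = 0 := by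
  rw [Derivation.leibniz, hf, hg, smul_zero, smul_zero, add_zero]

theorem derivation_pow_zero {D : Derivation ℂ Poly Poly} {f : Poly} (hf : D f = 0) (n : ℕ) :
    D (f ^ n) = 0 := by
  rw [Derivation.leibniz_pow, hf, smul_zero, smul_zero]

theorem actE_hwPoly (lam : Fin 4 → ℕ) {i j : Fin 5} (h : i < j) : actE i j (hwPoly lam) = 0 := by
  have h1 : actE i j (vx 0) = 0 := by
    rw [actE_vx, if_neg (by omega)]
  have h4 : actE i j (vxs 4) = 0 := by
    rw [actE_vxs, if_neg (by omega)]
  have h2 : actE i j (vxx 0 1) = 0 := by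
    rw [actE_vxx, if_neg (by omega), zero_add]
    split_ifs with h'
    · have : i = 0 := by omega
      subst this
      simp [vxx]
    · rfl
  have h3 : actE i j (vxxs 3 4) = 0 := by
    rw [actE_vxxs, if_neg (c := i = 4) (by omega), add_zero, neg_eq_zero]
    split_ifs with h'
    · have : j = 4 := by omega
      subst this
      simp [vxxs]
    · rfl
  exact derivation_mul_zero (derivation_mul_zero (derivation_mul_zero (derivation_pow_zero h1 _)
    (derivation_pow_zero h2 _)) (derivation_pow_zero h3 _)) (derivation_pow_zero h4 _)

theorem actE_comm (i j k l : Fin 5) (f : Poly) : actE i j (actE k l f) = actE k l (actE i j f) +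
    ((if j = k then actE i l f else 0) - (if l = i then actE k j f else 0)) := by
  have h : ⁅Matrix.single i j (1 : ℂ), Matrix.single k l (1 : ℂ)⁆ =
      (if j = k then Matrix.single i l 1 else 0) - (if l = i then Matrix.single k j 1 else 0) := by
    rw [Ring.lie_def]
    congr 1
    · split_ifs with hh
      · subst hh; rw [Matrix.single_mul_single_same, mul_one]
      · exact Matrix.single_mul_single_of_ne _ _ _ _ hh _
    · split_ifs with hh
      · subst hh; rw [Matrix.single_mul_single_same, mul_one]
      · exact Matrix.single_mul_single_of_ne _ _ _ _ hh _
  have h0 : act 0 = 0 := by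
    have := act_smul 0 (0 : Matrix (Fin 5) (Fin 5) ℂ)
    rwa [zero_smul, zero_smul] at this
  have e := congrArg (fun D => D f) (act_lie (Matrix.single i j (1 : ℂ)) (Matrix.single k l (1 : ℂ)))
  simp only [Derivation.commutator_apply, h] at e
  rw [sub_eq_add_neg, ← neg_one_smul ℂ, act_add, act_smul, Derivation.add_apply,
    Derivation.smul_apply, neg_one_smul, ← sub_eq_add_neg, eq_comm, sub_eq_iff_eq_add'] at e
  rw [e]
  refine congrArg₂ (· + ·) rfl (congrArg₂ (· - ·) ?_ ?_)
  · split_ifs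
    exacts [rfl, by rw [h0, Derivation.zero_apply]]
  · split_ifs
    exacts [rfl, by rw [h0, Derivation.zero_apply]]

/-- This is the statement `F(λ) = U(𝔫_-) s` for the highest weight vector `s`: the smallest subspace
containing `s` and stable under lowering is already stable under all `E_{ij}`. -/
theorem F_le_of_lower (lam : Fin 4 → ℕ) (P : Submodule ℂ Poly) (h : hwPoly lam ∈ P)
    (hl : ∀ i j : Fin 5, j < i → ∀ f ∈ P, actE i j f ∈ P) : (F lam).toSubmodule ≤ P := by
  set T : Set (Submodule ℂ Poly) :=
    {P | hwPoly lam ∈ P ∧ ∀ i j : Fin 5, j < i → ∀ f ∈ P, actE i j f ∈ P}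
  set N : Submodule ℂ Poly := sInf T with hN
  have hs : hwPoly lam ∈ N := Submodule.mem_sInf.mpr fun P hP => hP.1
  have hlow : ∀ i j : Fin 5, j < i → ∀ f ∈ N, actE i j f ∈ N := fun i j hij f hf =>
    Submodule.mem_sInf.mpr fun P hP => hP.2 i j hij f (Submodule.mem_sInf.mp hf P hP)
  -- `Q` consists of the vectors of `N` that no `E_{ij}` moves out of `N`. It contains the highest
  -- weight vector and, by the commutation relations, is stable under lowering, so minimality of `N`
  -- gives `N ≤ Q`.
  set Q : Submodule ℂ Poly := N ⊓ ⨅ (i : Fin 5) (j : Fin 5), N.comap (actE i j).toLinearMap with hQ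
  have hQm : ∀ f, f ∈ Q ↔ f ∈ N ∧ ∀ i j, actE i j f ∈ N := by
    intro f
    simp only [hQ, Submodule.mem_inf, Submodule.mem_iInf, Submodule.mem_comap]
    rfl
  have hQT : Q ∈ T := by
    refine ⟨(hQm _).mpr ⟨hs, fun i j => ?_⟩, fun k l hkl f hf => ?_⟩
    · rcases lt_trichotomy i j with hij | rfl | hij
      · rw [actE_hwPoly lam hij]
        exact zero_mem _
      · rw [actE_self_hwPoly]
        exact N.smul_mem _ hs
      · exact hlow i j hij _ hs
    · obtain ⟨h1, h2⟩ := (hQm f).mp hf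
      refine (hQm _).mpr ⟨h2 k l, fun i j => ?_⟩
      rw [actE_comm]
      refine add_mem (hlow k l hkl _ (h2 i j)) (sub_mem ?_ ?_)
      · split_ifs
        exacts [h2 i l, zero_mem _]
      · split_ifs
        exacts [h2 k j, zero_mem _]
  have hNQ : N ≤ Q := sInf_le hQT
  have hFN : (F lam).toSubmodule ≤ N := by
    refine F_le lam N hs fun A f hf => ?_
    rw [act_eq_sum_actE]
    exact sum_mem fun i _ => sum_mem fun j _ => N.smul_mem _ (((hQm f).mp (hNQ hf)).2 i j)
  exact hFN.trans (sInf_le ⟨h, hl⟩)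

theorem polyConj_hwPoly (lam : Fin 4 → ℕ) : polyConj (hwPoly lam) = hwPoly lam := by
  simp only [hwPoly, map_mul, map_pow, polyConj_vx, polyConj_vxs, polyConj_vxx, polyConj_vxxs]

theorem polyConj_mem_F {lam : Fin 4 → ℕ} {f : Poly} (hf : f ∈ F lam) : polyConj f ∈ F lam := by
  refine F_le lam { carrier := {f | polyConj f ∈ F lam}
                    add_mem' := fun {f g} hf hg => ?_
                    zero_mem' := ?_
                    smul_mem' := fun c f hf => ?_ } ?_ (fun A f hf => ?_) hf
  · simp only [Set.mem_ofPred_eq] at *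
    rw [map_add]
    exact add_mem hf hg
  · simp only [Set.mem_ofPred_eq, map_zero]
    exact zero_mem _
  · simp only [Set.mem_ofPred_eq] at *
    rw [polyConj_smul]
    exact (F lam).smul_mem _ hf
  · change polyConj _ ∈ F lam
    rw [polyConj_hwPoly]
    exact (hw lam).2
  · change polyConj _ ∈ F lam
    rw [polyConj_act]
    refine act_mem_F ⟨A.1.map (starRingEnd ℂ), ?_⟩ hf
    have h : Matrix.trace A.1 = 0 := A.2
    change Matrix.trace (A.1.map (starRingEnd ℂ)) = 0
    refine (AddMonoidHom.map_trace (starRingEnd ℂ : ℂ →+ ℂ) A.1).symm.trans ?_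
    rw [h, map_zero]

theorem hwPoly_ne_zero (lam : Fin 4 → ℕ) : hwPoly lam ≠ 0 := by
  have e1 : vxx 0 1 ≠ 0 := by simp [vxx]
  have e2 : vxxs 3 4 ≠ 0 := by simp [vxxs]
  exact mul_ne_zero (mul_ne_zero (mul_ne_zero (pow_ne_zero _ (MvPolynomial.X_ne_zero _))
    (pow_ne_zero _ e1)) (pow_ne_zero _ e2)) (pow_ne_zero _ (MvPolynomial.X_ne_zero _))

/-- The highest weight vector of `F(λ)` is unique up to a scalar. -/
theorem exists_eq_smul_hwPoly {lam : Fin 4 → ℕ} {f : Poly} (hf : f ∈ F lam)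
    (h : ∀ i j : Fin 5, i < j → actE i j f = 0) : ∃ c : ℂ, f = c • hwPoly lam := by
  have hne : fischer (hwPoly lam) (hwPoly lam) ≠ 0 := fun h0 =>
    hwPoly_ne_zero lam (eq_zero_of_fischer_polyConj (by rwa [polyConj_hwPoly]))
  -- With this `c`, the difference `f'` is orthogonal to the highest weight vector.
  set c : ℂ := fischer (hwPoly lam) f / fischer (hwPoly lam) (hwPoly lam) with hc
  refine ⟨c, ?_⟩
  set f' : Poly := f - c • hwPoly lam with hf'
  have hf'F : f' ∈ F lam := sub_mem hf ((F lam).smul_mem _ (hw lam).2)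
  have h0 : ∀ i j : Fin 5, i < j → actE i j f' = 0 := by
    intro i j hij
    rw [hf', map_sub, Derivation.map_smul, h i j hij, actE_hwPoly lam hij, smul_zero, sub_zero]
  -- The raising operators, adjoint to the lowering ones, annihilate `f'`; hence `f'` is orthogonal
  -- to everything obtained from the highest weight vector by lowering, that is, to all of `F(λ)`,
  -- including its own conjugate.
  have h1 : (F lam).toSubmodule ≤ LinearMap.ker (fischer.flip f') := by
    refine F_le_of_lower lam _ ?_ fun i j hij g _ => ?_
    · rw [LinearMap.mem_ker, LinearMap.flip_apply, hf', map_sub, map_smul, hc, smul_eq_mul,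
        div_mul_cancel₀ _ hne, sub_self]
    · rw [LinearMap.mem_ker, LinearMap.flip_apply, fischer_act, Matrix.transpose_single, h0 j i hij,
        map_zero]
  have h2 : fischer f' (polyConj f') = 0 := by
    rw [fischer_symm]
    exact h1 (polyConj_mem_F hf'F)
  rw [← sub_eq_zero, ← hf']
  exact eq_zero_of_fischer_polyConj h2

/-! ### Duality -/

theorem finite_gen : Finite Gen := by
  let f : Gen → (Fin 5 ⊕ Pair) ⊕ (Fin 5 ⊕ Pair) := fun g => match g with
    | Gen.x i => Sum.inl (Sum.inl i)
    | Gen.xx p => Sum.inl (Sum.inr p)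
    | Gen.xs i => Sum.inr (Sum.inl i)
    | Gen.xxs p => Sum.inr (Sum.inr p)
  refine Finite.of_injective f fun a b h => ?_
  cases a <;> cases b <;> simp_all [f]

theorem isHomogeneous_vxx (i j : Fin 5) : (vxx i j).IsHomogeneous 1 := by
  unfold vxx
  split_ifs
  exacts [MvPolynomial.isHomogeneous_X _ _, (MvPolynomial.isHomogeneous_X _ _).neg,
    MvPolynomial.isHomogeneous_zero _ _ _]

theorem isHomogeneous_vxxs (i j : Fin 5) : (vxxs i j).IsHomogeneous 1 := by
  unfold vxxs
  split_ifs
  exacts [MvPolynomial.isHomogeneous_X _ _, (MvPolynomial.isHomogeneous_X _ _).neg,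
    MvPolynomial.isHomogeneous_zero _ _ _]

theorem isHomogeneous_actGen (A : Matrix (Fin 5) (Fin 5) ℂ) (g : Gen) :
    (actGen A g).IsHomogeneous 1 := by
  rw [← MvPolynomial.mem_homogeneousSubmodule]
  cases g with
  | x k =>
    exact sum_mem fun i _ => Submodule.smul_mem _ _ (MvPolynomial.isHomogeneous_X _ _)
  | xs k =>
    exact neg_mem (sum_mem fun i _ => Submodule.smul_mem _ _ (MvPolynomial.isHomogeneous_X _ _))
  | xx p =>
    exact sum_mem fun i _ => add_mem (Submodule.smul_mem _ _ (isHomogeneous_vxx _ _))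
      (Submodule.smul_mem _ _ (isHomogeneous_vxx _ _))
  | xxs p =>
    exact neg_mem (sum_mem fun i _ => add_mem (Submodule.smul_mem _ _ (isHomogeneous_vxxs _ _))
      (Submodule.smul_mem _ _ (isHomogeneous_vxxs _ _)))

theorem isHomogeneous_act (A : Matrix (Fin 5) (Fin 5) ℂ) {f : Poly} {N : ℕ}
    (hf : f.IsHomogeneous N) : (act A f).IsHomogeneous N := by
  classical
  rw [act, ← MvPolynomial.mem_homogeneousSubmodule]
  change MvPolynomial.mkDerivationₗ ℂ (actGen A) f ∈ _
  rw [f.as_sum, map_sum]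
  refine sum_mem fun m hm => ?_
  rw [MvPolynomial.mkDerivationₗ_monomial]
  refine Submodule.smul_mem _ _ (sum_mem fun g hg => ?_)
  have h1 : (Finsupp.degree m : ℕ) = N := by
    have := hf (MvPolynomial.mem_support_iff.mp hm)
    rw [Finsupp.degree_eq_weight_one]
    exact this
  have hle : Finsupp.single g 1 ≤ m := by
    rw [Finsupp.single_le_iff]
    exact Nat.one_le_iff_ne_zero.mpr (Finsupp.mem_support_iff.mp hg)
  have h2 : Finsupp.degree (m - Finsupp.single g 1) + 1 = N := by
    have := congrArg Finsupp.degree (tsub_add_cancel_of_le hle)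
    rw [map_add, Finsupp.degree_single] at this
    rw [this, h1]
  rw [← h2]
  exact (MvPolynomial.isHomogeneous_monomial _ rfl).mul (isHomogeneous_actGen A g)

/-- All elements are homogeneous of one degree in finitely many variables. Finiteness serves the
dimension count in the duality below. -/
instance finite_F (lam : Fin 4 → ℕ) : Module.Finite ℂ (F lam) := by
  have := finite_gen
  have h : (F lam).toSubmodule ≤
      MvPolynomial.homogeneousSubmodule Gen ℂ (lam 0 + lam 1 + lam 2 + lam 3) := by
    refine F_le lam _ ?_ fun A f hf => isHomogeneous_act A.1 hf
    rw [MvPolynomial.mem_homogeneousSubmodule]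
    simpa [hwPoly] using ((((MvPolynomial.isHomogeneous_X ℂ (Gen.x 0)).pow (lam 0)).mul
      ((isHomogeneous_vxx 0 1).pow (lam 1))).mul ((isHomogeneous_vxxs 3 4).pow (lam 2))).mul
      ((MvPolynomial.isHomogeneous_X ℂ (Gen.xs 4)).pow (lam 3))
  have : Module.Finite ℂ (MvPolynomial.homogeneousSubmodule Gen ℂ
      (lam 0 + lam 1 + lam 2 + lam 3)) := Module.Finite.iff_fg.mpr
    (MvPolynomial.homogeneousSubmodule_fg Gen ℂ _)
  exact Submodule.finiteDimensional_of_le h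

/-- The exchange of dual generators. -/
def Gen.dual : Gen → Gen
  | Gen.x i => Gen.xs i
  | Gen.xx p => Gen.xxs p
  | Gen.xxs p => Gen.xx p
  | Gen.xs i => Gen.x i

theorem Gen.dual_dual (g : Gen) : g.dual.dual = g := by cases g <;> rfl

/-- The involution of the symmetric algebra exchanging `x_i`, `x_{ij}` with `x_i^*`, `x_{ij}^*`. -/
def starMap : Poly →ₐ[ℂ] Poly := MvPolynomial.rename Gen.dual

theorem starMap_starMap (f : Poly) : starMap (starMap f) = f := by
  rw [starMap, MvPolynomial.rename_rename]
  have : Gen.dual ∘ Gen.dual = id := funext Gen.dual_dual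
  rw [this, MvPolynomial.rename_id, AlgHom.id_apply]

theorem starMap_injective : Function.Injective starMap :=
  Function.LeftInverse.injective starMap_starMap

theorem starMap_vx (i : Fin 5) : starMap (vx i) = vxs i := MvPolynomial.rename_X _ _

theorem starMap_vxs (i : Fin 5) : starMap (vxs i) = vx i := MvPolynomial.rename_X _ _

theorem starMap_vxx (i j : Fin 5) : starMap (vxx i j) = vxxs i j := by
  unfold vxx vxxs
  split_ifs <;> simp [starMap, Gen.dual]

theorem starMap_vxxs (i j : Fin 5) : starMap (vxxs i j) = vxx i j := by
  unfold vxx vxxs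
  split_ifs <;> simp [starMap, Gen.dual]

theorem starMap_act (A : Matrix (Fin 5) (Fin 5) ℂ) (f : Poly) :
    starMap (act A f) = act (-A.transpose) (starMap f) := by
  induction f using poly_induction with
  | h1 => simp
  | hadd f f' hf hf' => simp only [map_add, hf, hf']
  | hsmul c f hf => simp only [Derivation.map_smul, map_smul, hf]
  | hx i f hf =>
    simp only [Derivation.leibniz, smul_eq_mul, map_add, map_mul, hf, act_vx, act_vxs, map_sum,
      map_smul, starMap_vx, Matrix.neg_apply, Matrix.transpose_apply, neg_smul,
      Finset.sum_neg_distrib, neg_neg]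
  | hxx i j f hf =>
    simp only [Derivation.leibniz, smul_eq_mul, map_add, map_mul, hf, act_vxx, act_vxxs, map_sum,
      map_smul, starMap_vxx, Matrix.neg_apply, Matrix.transpose_apply, neg_smul, ← neg_add,
      Finset.sum_neg_distrib, neg_neg]
  | hxxs i j f hf =>
    simp only [Derivation.leibniz, smul_eq_mul, map_add, map_mul, map_neg, hf, act_vxx, act_vxxs,
      map_sum, map_smul, starMap_vxxs, Matrix.neg_apply, Matrix.transpose_apply, neg_smul, ← neg_add,
      Finset.sum_neg_distrib]
  | hxs i f hf =>
    simp only [Derivation.leibniz, smul_eq_mul, map_add, map_mul, map_neg, hf, act_vx, act_vxs,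
      map_sum, map_smul, starMap_vxs, Matrix.neg_apply, Matrix.transpose_apply, neg_smul,
      Finset.sum_neg_distrib]

/-- A derivation preserving `P` that exchanges a factor of a product lying in `P`. -/
theorem pow_mul_mem {P : Submodule ℂ Poly} {D : Derivation ℂ Poly Poly} (hP : ∀ f ∈ P, D f ∈ P)
    {a b c : Poly} (ha : D a = b) (hb : D b = 0) (hc : D c = 0) (n : ℕ) (h : a ^ n * c ∈ P) :
    b ^ n * c ∈ P := by
  -- One application of `D` to `b^j a^(k+1) c` gives `k + 1` times `b^(j+1) a^k c`, and `k + 1` is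
  -- invertible, so the factors are exchanged one at a time.
  have key : ∀ k j, b ^ j * a ^ k * c ∈ P → b ^ (j + k) * c ∈ P := by
    intro k
    induction k with
    | zero => intro j hj; simpa using hj
    | succ k ih =>
      intro j hj
      have e : D (b ^ j * a ^ (k + 1) * c) = ((k + 1 : ℕ) : ℂ) • (b ^ (j + 1) * a ^ k * c) := by
        rw [Derivation.leibniz, hc, smul_zero, zero_add, Derivation.leibniz, derivation_pow_zero hb,
          smul_zero, add_zero, Derivation.leibniz_pow, ha, Nat.cast_smul_eq_nsmul]
        simp only [smul_eq_mul, mul_smul_comm, add_tsub_cancel_right]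
        congr 1
        ring
      have h1 := hP _ hj
      rw [e] at h1
      have h2 := ih (j + 1) ((Submodule.smul_mem_iff _ (by exact_mod_cast k.succ_ne_zero)).mp h1)
      rwa [add_assoc, add_comm 1 k] at h2
  simpa using key n 0 (by simpa using h)

/-- The highest weight vector `x_1^n x_{12}^k` is carried to the lowest weight vector by powers of
`E_{42}`, `E_{41}`, `E_{51}`, `E_{54}` in turn. The order is such that each operator annihilates the
factor it is not meant to change. -/
theorem vx_pow_mul_vxx_pow_mem (n k : ℕ) : vx 4 ^ n * vxx 3 4 ^ k ∈ F ![n, k, 0, 0] := by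
  have hP : ∀ i j : Fin 5, i ≠ j → ∀ f ∈ (F ![n, k, 0, 0]).toSubmodule,
      actE i j f ∈ (F ![n, k, 0, 0]).toSubmodule := fun i j h f hf => actE_mem_F h hf
  have h0 : vxx 0 1 ^ k * vx 0 ^ n ∈ (F ![n, k, 0, 0]).toSubmodule := by
    have := (hw ![n, k, 0, 0]).2
    simpa [hw, hwPoly, mul_comm] using this
  have z : ∀ i, vxx i i = 0 := fun i => by simp [vxx]
  have h1 := pow_mul_mem (hP 3 1 (by decide)) (b := - vxx 3 0)
    (by simp [actE_vxx, vxx_swap 3 0]) (by simp [actE_vxx])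
    (derivation_pow_zero (by simp [actE_vx]) _) k h0
  rw [mul_comm] at h1
  have h2 := pow_mul_mem (hP 3 0 (by decide)) (b := vx 3) (by simp [actE_vx]) (by simp [actE_vx])
    (derivation_pow_zero (by simp [actE_vxx, z]) _) n h1
  rw [mul_comm] at h2
  have h3 := pow_mul_mem (hP 4 0 (by decide)) (b := - vxx 3 4) (by simp [actE_vxx])
    (by simp [actE_vxx]) (derivation_pow_zero (by simp [actE_vx]) _) k h2
  rw [mul_comm] at h3
  have h4 := pow_mul_mem (hP 4 3 (by decide)) (b := vx 4) (by simp [actE_vx]) (by simp [actE_vx])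
    (derivation_pow_zero (by simp [actE_vxx, z]) _) n h3
  rw [neg_pow, ← MvPolynomial.C_1, ← MvPolynomial.C_neg, ← MvPolynomial.C_pow, mul_left_comm,
    ← MvPolynomial.smul_eq_C_mul] at h4
  exact (Submodule.smul_mem_iff _ (pow_ne_zero _ (by norm_num))).mp h4

theorem vxs_pow_mul_vxxs_pow_mem (n k : ℕ) : vxs 0 ^ n * vxxs 0 1 ^ k ∈ F ![0, 0, k, n] := by
  have hP : ∀ i j : Fin 5, i ≠ j → ∀ f ∈ (F ![0, 0, k, n]).toSubmodule,
      (-actE i j) f ∈ (F ![0, 0, k, n]).toSubmodule := fun i j h f hf => neg_mem (actE_mem_F h hf)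
  have h0 : vxs 4 ^ n * vxxs 3 4 ^ k ∈ (F ![0, 0, k, n]).toSubmodule := by
    have := (hw ![0, 0, k, n]).2
    simpa [hw, hwPoly, mul_comm] using this
  have z : ∀ i, vxxs i i = 0 := fun i => by simp [vxxs]
  have h1 := pow_mul_mem (hP 4 3 (by decide)) (b := vxs 3) (by simp [actE_vxs]) (by simp [actE_vxs])
    (derivation_pow_zero (by simp [actE_vxxs, z]) _) n h0
  rw [mul_comm] at h1
  have h2 := pow_mul_mem (hP 4 0 (by decide)) (b := - vxxs 0 3)
    (by simp [actE_vxxs, vxxs_swap 0 3]) (by simp [actE_vxxs])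
    (derivation_pow_zero (by simp [actE_vxs]) _) k h1
  rw [mul_comm] at h2
  have h3 := pow_mul_mem (hP 3 0 (by decide)) (b := vxs 0) (by simp [actE_vxs]) (by simp [actE_vxs])
    (derivation_pow_zero (by simp [actE_vxxs, z]) _) n h2
  rw [mul_comm] at h3
  have h4 := pow_mul_mem (hP 3 1 (by decide)) (b := - vxxs 0 1) (by simp [actE_vxxs])
    (by simp [actE_vxxs]) (derivation_pow_zero (by simp [actE_vxs]) _) k h3
  rw [neg_pow, ← MvPolynomial.C_1, ← MvPolynomial.C_neg, ← MvPolynomial.C_pow, mul_assoc,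
    ← MvPolynomial.smul_eq_C_mul, mul_comm (vxxs 0 1 ^ k)] at h4
  exact (Submodule.smul_mem_iff _ (pow_ne_zero _ (by norm_num))).mp h4

/-- The matrix `-Aᵀ` in `𝔰𝔩₅`. -/
def negTranspose (A : sl5) : sl5 :=
  ⟨-A.1.transpose, by
    have h : Matrix.trace A.1 = 0 := A.2
    change Matrix.trace (-A.1.transpose) = 0
    rw [Matrix.trace_neg, Matrix.trace_transpose, h, neg_zero]⟩

theorem starMap_mem_of_hwPoly {lam mu : Fin 4 → ℕ} (h : starMap (hwPoly lam) ∈ F mu) {f : Poly}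
    (hf : f ∈ F lam) : starMap f ∈ F mu := by
  refine F_le lam ((F mu).toSubmodule.comap starMap.toLinearMap) h (fun A f hf => ?_) hf
  change starMap _ ∈ F mu
  rw [starMap_act]
  exact act_mem_F (negTranspose A) hf

theorem starMap_mem {n k : ℕ} {f : Poly} (hf : f ∈ F ![0, 0, k, n]) : starMap f ∈ F ![n, k, 0, 0] := by
  refine starMap_mem_of_hwPoly ?_ hf
  have := vx_pow_mul_vxx_pow_mem n k
  simpa [hwPoly, starMap_vxxs, starMap_vxs, mul_comm] using this

theorem starMap_mem' {n k : ℕ} {f : Poly} (hf : f ∈ F ![n, k, 0, 0]) : starMap f ∈ F ![0, 0, k, n] := by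
  refine starMap_mem_of_hwPoly ?_ hf
  have := vxs_pow_mul_vxxs_pow_mem n k
  simpa [hwPoly, starMap_vxx, starMap_vx, mul_comm] using this

/-- The pairing of `F(0,0,k,n)` with `F(n,k,0,0)`. -/
def dualHom (n k : ℕ) : F ![0, 0, k, n] →ₗ⁅ℂ, sl5⁆ Module.Dual ℂ (F ![n, k, 0, 0]) where
  toFun f := (fischer (starMap f)) ∘ₗ (F ![n, k, 0, 0]).toSubmodule.subtype
  map_add' f g := by
    ext x
    simp
  map_smul' c f := by
    ext x
    simp
  map_lie' {A f} := by
    ext x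
    change fischer (starMap (act A.1 f)) x = - fischer (starMap f) (act A.1 x)
    rw [starMap_act, fischer_act, Matrix.transpose_neg, Matrix.transpose_transpose,
      ← neg_one_smul ℂ, act_smul, Derivation.smul_apply, map_smul, neg_one_smul]

/-- If `f` pairs to zero with all of `F(n,k,0,0)`, it does so with the conjugate of its own image
under `starMap`, and positivity applies. -/
theorem dualHom_injective (n k : ℕ) : Function.Injective (dualHom n k) := by
  rw [injective_iff_map_eq_zero]
  intro f hf
  have h := LinearMap.congr_fun hf ⟨polyConj (starMap f), polyConj_mem_F (starMap_mem f.2)⟩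
  have := eq_zero_of_fischer_polyConj h
  exact Subtype.ext (starMap_injective (by rw [this]; simp))

/-- Dimension count: `starMap` embeds each of the two modules into the other, so they have equal
dimension. -/
theorem dualHom_bijective (n k : ℕ) : Function.Bijective (dualHom n k) := by
  have h1 : Module.finrank ℂ (F ![n, k, 0, 0]) ≤ Module.finrank ℂ (F ![0, 0, k, n]) := by
    let f : F ![n, k, 0, 0] →ₗ[ℂ] F ![0, 0, k, n] :=
      LinearMap.restrict starMap.toLinearMap (p := (F ![n, k, 0, 0]).toSubmodule)
        (q := (F ![0, 0, k, n]).toSubmodule) fun x hx => starMap_mem' hx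
    refine LinearMap.finrank_le_finrank_of_injective (f := f) fun a b hab => Subtype.ext ?_
    exact starMap_injective (congrArg Subtype.val hab)
  have h2 := LinearMap.finrank_le_finrank_of_injective
    (f := (dualHom n k).toLinearMap) (dualHom_injective n k)
  rw [Subspace.dual_finrank_eq] at h2
  refine ⟨dualHom_injective n k, ?_⟩
  exact (LinearMap.injective_iff_surjective_of_finrank_eq_finrank
    (f := (dualHom n k).toLinearMap)
    (by rw [Subspace.dual_finrank_eq]; exact le_antisymm h2 h1)).mp (dualHom_injective n k)

/-- The isomorphism of `F(0,0,k,n)` with the dual of `F(n,k,0,0)`. -/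
def dualEquiv (n k : ℕ) : F ![0, 0, k, n] ≃ₗ⁅ℂ, sl5⁆ Module.Dual ℂ (F ![n, k, 0, 0]) :=
  { dualHom n k with
    invFun := (Equiv.ofBijective _ (dualHom_bijective n k)).symm
    left_inv := (Equiv.ofBijective _ (dualHom_bijective n k)).left_inv
    right_inv := (Equiv.ofBijective _ (dualHom_bijective n k)).right_inv }

theorem dualEquiv_apply {n k : ℕ} (f : F ![0, 0, k, n]) (g : F ![n, k, 0, 0]) :
    dualEquiv n k f g = fischer (starMap f) g := rfl

theorem fischer_X_pow_mul (h : Gen) (n : ℕ) (f g : Poly) :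
    fischer (MvPolynomial.X h ^ n * f) g =
      fischer f (((MvPolynomial.pderiv h).toLinearMap ^ n : Poly →ₗ[ℂ] Poly) g) := by
  induction n generalizing g with
  | zero => simp
  | succ n ih =>
    rw [pow_succ', mul_assoc, fischer_X_mul, ih, pow_succ]
    rfl

/-- Iterated adjointness turns the constant coefficient operator into the pairing with a monomial,
where the invariance of the form can be used. -/
theorem dualVec_apply (m n : ℕ) (p : Pair) (g : F ![n, m + 1, 0, 0]) :
    dualVec m n p g = fischer (vx 4 ^ n * (vxx 3 4 ^ m * vxx p.1.1 p.1.2)) g := by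
  have h : vxx 3 4 = MvPolynomial.X (Gen.xx ⟨(3, 4), by decide⟩) := by simp [vxx]
  rw [h, ← vxx_of_lt, fischer_X_pow_mul, fischer_X_pow_mul, ← mul_one (MvPolynomial.X (Gen.xx p)),
    fischer_X_mul, fischer_one]
  rfl

theorem dualEquiv_hw (m n : ℕ) :
    dualEquiv n (m + 1) (hw ![0, 0, m + 1, n]) = dualVec m n ⟨(3, 4), by decide⟩ := by
  ext g
  rw [dualEquiv_apply, dualVec_apply]
  refine congrArg (fun f => fischer f (g : Poly)) ?_
  simp [hw, hwPoly, starMap_vxxs, starMap_vxs, pow_succ, mul_comm]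

/-! ### The action of `L_1` on elements of degree one -/

/-- The coefficients of the linear part of a two-form. -/
def oddCoeff (w : Odd) (a b c : Fin 5) : ℂ := MvPowerSeries.constantCoeff (pd a (w.1 b c))

theorem oddCoeff_closed (w : Odd) (a b c : Fin 5) :
    oddCoeff w a b c + oddCoeff w b c a + oddCoeff w c a b = 0 := by
  have := congrArg MvPowerSeries.constantCoeff (w.2.2 a b c)
  simpa [oddCoeff] using this

theorem linPart_bracketOO_d (w : Odd) (i j a t : Fin 5) :
    (linPart (bracketOO w (d i j))).1 a t = (1 / 4 : ℂ) * ∑ s : Equiv.Perm (Fin 5),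
      if s 4 = t then ((Equiv.Perm.sign s : ℤ) : ℂ) * (oddCoeff w a (s 0) (s 1) *
        ((if i = s 2 ∧ j = s 3 then 1 else 0) - (if i = s 3 ∧ j = s 2 then 1 else 0))) else 0 := by
  rw [linPart_apply]
  change MvPowerSeries.constantCoeff (pd a ((1 / 4 : ℂ) • ∑ s : Equiv.Perm (Fin 5),
    if s 4 = t then ((Equiv.Perm.sign s : ℤ) : PS) * (w.1 (s 0) (s 1) * MvPowerSeries.C
      ((if i = s 2 ∧ j = s 3 then 1 else 0) - (if i = s 3 ∧ j = s 2 then 1 else 0))) else 0)) = _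
  rw [Derivation.map_smul, MvPowerSeries.smul_eq_C_mul, map_mul, MvPowerSeries.constantCoeff_C,
    map_sum, map_sum]
  refine congrArg _ (Finset.sum_congr rfl fun s _ => ?_)
  split_ifs with h1 <;> simp [Derivation.leibniz, oddCoeff, pd, mul_comm]

/-- The action of `w` becomes a signed sum in which `s 0, s 1` index the component of `w`, `s 2, s
3` the form `d_{ij}`, and `s 4` the direction of the resulting vector field. Construction and
classification both evaluate this sum. -/
theorem sum_linPart_bracketOO_d {N : Type*} [AddCommGroup N] [Module ℂ N] (w : Odd)
    (G : Fin 5 → Fin 5 → Fin 5 → Fin 5 → N) :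
    ∑ i, ∑ j, ∑ a, ∑ t, (linPart (bracketOO w (d i j))).1 a t • G a t i j =
      (1 / 4 : ℂ) • ∑ s : Equiv.Perm (Fin 5), ((Equiv.Perm.sign s : ℤ) : ℂ) •
        ∑ a, oddCoeff w a (s 0) (s 1) • (G a (s 4) (s 2) (s 3) - G a (s 4) (s 3) (s 2)) := by
  simp only [linPart_bracketOO_d, mul_smul, Finset.sum_smul, ← Finset.smul_sum]
  congr 1
  have e : ∀ F : Fin 5 → Fin 5 → Fin 5 → Fin 5 → Equiv.Perm (Fin 5) → N,
      ∑ i, ∑ j, ∑ a, ∑ t, ∑ s, F i j a t s = ∑ s, ∑ a, ∑ i, ∑ j, ∑ t, F i j a t s := by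
    intro F
    rw [Finset.sum_congr rfl fun i _ => Finset.sum_congr rfl fun j _ =>
      (Finset.sum_congr rfl fun a _ => Finset.sum_comm).trans Finset.sum_comm]
    rw [Finset.sum_congr rfl fun i _ => Finset.sum_comm, Finset.sum_comm]
    refine Finset.sum_congr rfl fun s _ => ?_
    rw [Finset.sum_congr rfl fun i _ => Finset.sum_comm, Finset.sum_comm]
  rw [e]
  refine Finset.sum_congr rfl fun s _ => ?_
  rw [Finset.smul_sum]
  refine Finset.sum_congr rfl fun a _ => ?_
  simp only [ite_smul, zero_smul, Finset.sum_ite_eq, Finset.mem_univ, if_true, mul_smul,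
    ← Finset.smul_sum, sub_smul, ite_and, one_smul, Finset.sum_sub_distrib]
  congr 2
  simp

/-- Right translation by an even `g` preserves signs, so three times the sum is a sum of vanishing
triples. Closedness and the Plücker relations, both cyclic in three indices, enter through this
lemma. -/
theorem sum_sign_smul_eq_zero_of_cycle {N : Type*} [AddCommGroup N] [Module ℂ N]
    (T : Equiv.Perm (Fin 5) → N) (g : Equiv.Perm (Fin 5)) (hg : Equiv.Perm.sign g = 1)
    (h : ∀ s, T s + T (s * g) + T (s * g * g) = 0) :
    ∑ s, ((Equiv.Perm.sign s : ℤ) : ℂ) • T s = 0 := by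
  set S : Equiv.Perm (Fin 5) → N := fun s => ((Equiv.Perm.sign s : ℤ) : ℂ) • T s with hS
  have e1 : ∑ s, S (s * g) = ∑ s, S s := Equiv.sum_comp (Equiv.mulRight g) S
  have e2 : ∑ s, S (s * g * g) = ∑ s, S s := by
    rw [← e1]
    exact Equiv.sum_comp (Equiv.mulRight g) (fun s => S (s * g))
  have e3 : ∑ s, (S s + S (s * g) + S (s * g * g)) = 0 := by
    refine Finset.sum_eq_zero fun s _ => ?_
    simp only [hS, Equiv.Perm.sign_mul, hg, mul_one, ← smul_add, h, smul_zero]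
  rw [Finset.sum_add_distrib, Finset.sum_add_distrib, e1, e2] at e3
  have : (3 : ℂ) • ∑ s, S s = 0 := by
    rw [← e3, show (3 : ℂ) = 1 + 1 + 1 by norm_num, add_smul, add_smul, one_smul]
  exact (smul_eq_zero.mp this).resolve_left (by norm_num)

theorem sum_sign_smul_eq_zero_of_swap {N : Type*} [AddCommGroup N] [Module ℂ N]
    (T : Equiv.Perm (Fin 5) → N) (g : Equiv.Perm (Fin 5)) (hg : Equiv.Perm.sign g = -1)
    (h : ∀ s, T (s * g) = T s) : ∑ s, ((Equiv.Perm.sign s : ℤ) : ℂ) • T s = 0 := by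
  set S : Equiv.Perm (Fin 5) → N := fun s => ((Equiv.Perm.sign s : ℤ) : ℂ) • T s with hS
  have e1 : ∑ s, S (s * g) = ∑ s, S s := Equiv.sum_comp (Equiv.mulRight g) S
  have e2 : ∀ s, S (s * g) = - S s := fun s => by
    simp only [hS, Equiv.Perm.sign_mul, hg, h]
    simp
  simp only [e2, Finset.sum_neg_distrib] at e1
  have : (2 : ℂ) • ∑ s, S s = 0 := by
    rw [two_smul]
    nth_rewrite 1 [← e1]
    exact neg_add_cancel _
  exact (smul_eq_zero.mp this).resolve_left (by norm_num)

/-! ### Construction of morphisms from their value at the highest weight vector -/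

theorem F_induction {lam : Fin 4 → ℕ} (P : Submodule ℂ (F lam)) (h : hw lam ∈ P)
    (hlie : ∀ (A : sl5), ∀ v ∈ P, ⁅A, v⁆ ∈ P) (v : F lam) : v ∈ P := by
  have h1 : (F lam).toSubmodule ≤ P.map (F lam).toSubmodule.subtype := by
    refine F_le lam _ ⟨hw lam, h, rfl⟩ ?_
    rintro A _ ⟨v, hv, rfl⟩
    exact ⟨_, hlie A v hv, rfl⟩
  obtain ⟨v', hv', e⟩ := h1 v.2
  have : v' = v := Subtype.ext e
  rwa [← this]

/-- The highest weight vector generates `M(λ)` over `U`; all uniqueness statements rest on this. -/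
theorem F_hom_ext {W : Type*} [AddCommGroup W] [Module ℂ W] [LieRingModule sl5 W]
    [LieModule ℂ sl5 W] {lam : Fin 4 → ℕ} {φ ψ : M lam →ₗ[U] Verma W}
    (h : φ (tmul 1 (hw lam)) = ψ (tmul 1 (hw lam))) : φ = ψ := by
  refine verma_ext fun v => ?_
  refine F_induction (LinearMap.eqLocus (φ.restrictScalars ℂ ∘ₗ tmulL 1)
    (ψ.restrictScalars ℂ ∘ₗ tmulL 1)) h (fun A v hv => ?_) v
  have hv' : φ (tmul 1 v) = ψ (tmul 1 v) := hv
  change φ (tmul 1 ⁅A, v⁆) = ψ (tmul 1 ⁅A, v⁆)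
  rw [← toU_matField_smul, map_smul, map_smul, hv']

theorem exists_morphism_of_hw {W : Type*} [AddCommGroup W] [Module ℂ W] [LieRingModule sl5 W]
    [LieModule ℂ sl5 W] {lam : Fin 4 → ℕ} (θ : F lam →ₗ[ℂ] (Fin 5 → Fin 5 → W))
    (h1 : ∀ A v, θ ⁅A, v⁆ = tensorAct A (θ v)) (h2 : OddSingular (degOne (θ (hw lam)))) :
    ∃ φ : M lam →ₗ[U] Verma W, HasDegree 1 φ ∧ φ (tmul 1 (hw lam)) = degOne (θ (hw lam)) := by
  have key : ∀ v, OddSingular (degOne (θ v)) := by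
    let P : Submodule ℂ (F lam) :=
      { carrier := {v | OddSingular (degOne (θ v))}
        add_mem' := fun {a b} ha hb w hw => by
          rw [map_add, map_add, smul_add, ha w hw, hb w hw, add_zero]
        zero_mem' := fun w hw => by rw [map_zero, map_zero, smul_zero]
        smul_mem' := fun c a ha w hw => by
          rw [map_smul, map_smul, smul_comm, ha w hw, smul_zero] }
    refine fun v => F_induction P h2 (fun A v hv => ?_) v
    change OddSingular (degOne (θ ⁅A, v⁆))
    have e := toU_ev_smul_degOne (matField_mem A) (θ v)
    rw [linPart_matField] at e
    rw [h1, ← e]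
    exact OddSingular.matField_smul hv A
  obtain ⟨φ, hφ, hv⟩ := exists_morphism θ h1 key
  exact ⟨φ, hφ, hv _⟩

/-! ### Existence of the morphisms -/

theorem sum_lie_linPart_eq {mu : Fin 4 → ℕ} {f : Fin 5 → Fin 5 → F mu}
    (hf : ∀ i j, f i j = - f j i) (w : Odd) :
    ((∑ i, ∑ j, ⁅linPart (bracketOO w (d i j)), f i j⁆ : F mu) : Poly) =
      (1 / 2 : ℂ) • ∑ s : Equiv.Perm (Fin 5), ((Equiv.Perm.sign s : ℤ) : ℂ) •
        ∑ a, oddCoeff w a (s 0) (s 1) • actE a (s 4) (f (s 2) (s 3) : Poly) := by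
  have h1 : ((∑ i, ∑ j, ⁅linPart (bracketOO w (d i j)), f i j⁆ : F mu) : Poly) =
      ∑ i, ∑ j, act (linPart (bracketOO w (d i j))).1 (f i j : Poly) := by
    simp only [AddSubmonoidClass.coe_finsetSum]
    rfl
  have h2 : ∀ a i j k, actE a k (f i j : Poly) - actE a k (f j i : Poly) =
      (2 : ℂ) • actE a k (f i j : Poly) := by
    intro a i j k
    rw [hf j i, LieSubmodule.coe_neg, map_neg, sub_neg_eq_add, two_smul]
  rw [h1]
  simp only [act_eq_sum_actE (linPart _).1]
  rw [sum_linPart_bracketOO_d w fun a t i j => actE a t (f i j : Poly)]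
  simp only [h2, smul_comm _ (2 : ℂ), ← Finset.smul_sum]
  rw [smul_smul]
  norm_num

/-- The functional `coeffZero` recovers `v` from `1 ⊗ v`, so vanishing in the generalized Verma
module is the same as vanishing of a polynomial. -/
theorem oddSingular_degOne_iff {mu : Fin 4 → ℕ} {f : Fin 5 → Fin 5 → F mu}
    (hf : ∀ i j, f i j = - f j i) : OddSingular (degOne f) ↔ ∀ w : Odd, od w ∈ nonneg →
      ∑ s : Equiv.Perm (Fin 5), ((Equiv.Perm.sign s : ℤ) : ℂ) •
        ∑ a, oddCoeff w a (s 0) (s 1) • actE a (s 4) (f (s 2) (s 3) : Poly) = 0 := by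
  refine forall₂_congr fun w hw => ?_
  rw [toU_od_smul_degOne hw]
  have e := sum_lie_linPart_eq hf w
  constructor
  · intro h
    have h' := congrArg coeffZero h
    rw [coeffZero_tmul_one, map_zero] at h'
    rw [h', LieSubmodule.coe_zero] at e
    exact (smul_eq_zero.mp e.symm).resolve_left (by norm_num)
  · intro h
    rw [h, smul_zero] at e
    have : (∑ i, ∑ j, ⁅linPart (bracketOO w (d i j)), f i j⁆ : F mu) = 0 := Subtype.ext e
    rw [this]
    exact map_zero (tmulL 1)

/-- Defining the equivariant map on all polynomials avoids working inside `F(λ)`. The vectors sent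
into `F(μ)`-valued families form a stable subspace, so it suffices that the highest weight vector is
one of them. -/
theorem exists_morphism_of_poly {lam mu : Fin 4 → ℕ} (Θ : Poly →ₗ[ℂ] (Fin 5 → Fin 5 → Poly))
    (h1 : ∀ (A : sl5) (f : Poly), Θ ⁅A, f⁆ = tensorAct A (Θ f)) (f : Fin 5 → Fin 5 → F mu)
    (hf : ∀ i j, f i j = - f j i)
    (hΘ : ∀ i j, Θ (hwPoly lam) i j = f i j)
    (h2 : ∀ w : Odd, ∑ s : Equiv.Perm (Fin 5), ((Equiv.Perm.sign s : ℤ) : ℂ) •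
        ∑ a, oddCoeff w a (s 0) (s 1) • actE a (s 4) (f (s 2) (s 3) : Poly) = 0) :
    ∃ φ : M lam →ₗ[U] M mu, HasDegree 1 φ ∧ φ (tmul 1 (hw lam)) = degOne f := by
  have hmem : ∀ g ∈ F lam, ∀ i j, Θ g i j ∈ F mu := by
    have := F_le lam (⨅ (i : Fin 5) (j : Fin 5), (F mu).toSubmodule.comap
      ((LinearMap.proj j : (Fin 5 → Poly) →ₗ[ℂ] Poly) ∘ₗ LinearMap.proj i ∘ₗ Θ)) ?_ ?_
    · intro g hg i j
      have h := this hg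
      simp only [Submodule.mem_iInf, Submodule.mem_comap] at h
      exact h i j
    · simp only [Submodule.mem_iInf, Submodule.mem_comap]
      intro i j
      change Θ (hwPoly lam) i j ∈ F mu
      rw [hΘ]
      exact (f i j).2
    · intro A g hg
      simp only [Submodule.mem_iInf, Submodule.mem_comap] at hg ⊢
      intro i j
      change Θ ⁅A, g⁆ i j ∈ F mu
      rw [h1]
      exact add_mem ((F mu).lie_mem (hg i j)) (sum_mem fun m _ => add_mem
        ((F mu).smul_mem _ (hg m j)) ((F mu).smul_mem _ (hg i m)))
  let θ : F lam →ₗ[ℂ] (Fin 5 → Fin 5 → F mu) :=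
    { toFun := fun g i j => ⟨Θ g i j, hmem g g.2 i j⟩
      map_add' := fun g g' => by
        ext i j : 3
        change Θ ((g : Poly) + g') i j = Θ g i j + Θ g' i j
        rw [map_add]
        rfl
      map_smul' := fun c g => by
        ext i j : 3
        change Θ (c • (g : Poly)) i j = c • Θ g i j
        rw [map_smul]
        rfl }
  have e : θ (hw lam) = f := by
    ext i j : 3
    exact hΘ i j
  obtain ⟨φ, hφ⟩ := exists_morphism_of_hw θ (fun A v => by
    ext i j : 3
    refine (congrFun (congrFun (h1 A v) i) j).trans ?_
    simp only [tensorAct, LieSubmodule.coe_add, AddSubmonoidClass.coe_finsetSum, LieSubmodule.coe_smul,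
      LieSubmodule.coe_bracket]
    rfl) (by rw [e]; exact (oddSingular_degOne_iff hf).mpr fun w _ => h2 w)
  rw [e] at hφ
  exact ⟨φ, hφ⟩

theorem exists_nablaA (m n : ℕ) : ∃ φ : M ![m, n + 1, 0, 0] →ₗ[U] M ![m, n, 0, 0],
    HasDegree 1 φ ∧ IsNablaA m n φ := by
  -- Differentiating `x_{12}^{n+1}` produces `n + 1`, and `degOne` counts `d_{12}` and `d_{21}`
  -- separately, which produces the `2`.
  set c : ℂ := (2 * (n + 1 : ℂ))⁻¹ with hc
  have hn : (n + 1 : ℂ) ≠ 0 := by exact_mod_cast n.succ_ne_zero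
  let u : Fin 5 → Fin 5 → ℂ := fun i j =>
    (if i = 0 ∧ j = 1 then 1 else 0) - (if i = 1 ∧ j = 0 then 1 else 0)
  obtain ⟨φ, hφ, hv⟩ := exists_morphism_of_poly (lam := ![m, n + 1, 0, 0]) (mu := ![m, n, 0, 0])
    (LinearMap.pi fun i => LinearMap.pi fun j => c • (pdxx i j).toLinearMap) (fun A f => by
      ext i j : 2
      change c • pdxx i j (act A.1 f) = act A.1 (c • pdxx i j f) +
        ∑ k, (A.1 i k • c • pdxx k j f + A.1 j k • c • pdxx i k f)
      rw [pdxx_act, Derivation.map_smul, smul_add, Finset.smul_sum]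
      simp only [smul_add, smul_comm c])
    (fun i j => u i j • (1 / 2 : ℂ) • hw ![m, n, 0, 0])
    (fun i j => by rw [← neg_smul]; congr 1; simp only [u]; rw [neg_sub]; simp [and_comm])
    (fun i j => by
      change c • pdxx i j (vx 0 ^ m * vxx 0 1 ^ (n + 1) * vxxs 3 4 ^ 0 * vxs 4 ^ 0) =
        u i j • (1 / 2 : ℂ) • (vx 0 ^ m * vxx 0 1 ^ n * vxxs 3 4 ^ 0 * vxs 4 ^ 0)
      have e : pdxx i j (vxx 0 1) = MvPolynomial.C (u i j) := by
        rw [pdxx_vxx]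
        fin_cases i <;> fin_cases j <;> simp [u]
      simp only [pow_zero, mul_one]
      rw [Derivation.leibniz, derivation_pow_zero (pdxx_vx _ _ _), smul_zero, add_zero,
        Derivation.leibniz_pow, e, add_tsub_cancel_right, ← Nat.cast_smul_eq_nsmul ℂ, smul_eq_mul,
        smul_eq_mul, mul_comm (vxx 0 1 ^ n), ← MvPolynomial.smul_eq_C_mul, mul_smul_comm,
        mul_smul_comm, smul_smul, smul_smul, smul_smul]
      congr 1
      rw [hc]
      push_cast
      field_simp)
    (fun w => by
      refine Finset.sum_eq_zero fun s _ => ?_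
      rw [Finset.sum_eq_zero fun a _ => ?_, smul_zero]
      -- A term can be nonzero only if `{s 2, s 3} = {0, 1}`. Then `s 4` is neither `0` nor `1`, and
      -- `E_{a, s 4}` annihilates `x_1^m x_{12}^n`.
      by_cases h : u (s 2) (s 3) = 0
      · simp [h]
      have h0 : s 4 ≠ 0 ∧ s 4 ≠ 1 := by
        have h24 : s 2 ≠ s 4 := s.injective.ne (by decide)
        have h34 : s 3 ≠ s 4 := s.injective.ne (by decide)
        constructor <;> intro h4 <;> apply h <;> rw [h4] at h24 h34 <;> simp [u, h24, h34]
      have h1 : actE a (s 4) (hwPoly ![m, n, 0, 0]) = 0 := by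
        simp only [hwPoly]
        refine derivation_mul_zero (derivation_mul_zero (derivation_mul_zero
          (derivation_pow_zero ?_ _) (derivation_pow_zero ?_ _)) ?_) ?_
        · simp [actE_vx, h0.1]
        · simp [actE_vxx, h0.1, h0.2]
        · simp
        · simp
      change oddCoeff w a (s 0) (s 1) • actE a (s 4)
        (u (s 2) (s 3) • (1 / 2 : ℂ) • hwPoly ![m, n, 0, 0]) = 0
      rw [Derivation.map_smul, Derivation.map_smul, h1]
      simp)
  refine ⟨φ, hφ, rfl, rfl, ?_⟩
  rw [hv, degOne_apply]
  have e : ∀ i j v, (tmul (dU i j) (u i j • (1 / 2 : ℂ) • v) : M ![m, n, 0, 0]) =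
      u i j • (1 / 2 : ℂ) • tmul (dU i j) v := by
    intro i j v
    rw [← tmulL_apply, ← tmulL_apply, map_smul, map_smul]
  simp only [e, Fin.sum_univ_five]
  simp [u, tmul_dU_swap 1 0]
  rw [← add_smul]
  norm_num

theorem sum_sign_smul_mul_right {N : Type*} [AddCommGroup N] [Module ℂ N]
    (T : Equiv.Perm (Fin 5) → N) (g : Equiv.Perm (Fin 5)) (hg : Equiv.Perm.sign g = -1) :
    ∑ s, ((Equiv.Perm.sign s : ℤ) : ℂ) • T (s * g) =
      - ∑ s, ((Equiv.Perm.sign s : ℤ) : ℂ) • T s := by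
  rw [← Finset.sum_neg_distrib]
  refine Fintype.sum_equiv (Equiv.mulRight g) _ _ fun s => ?_
  simp [Equiv.Perm.sign_mul, hg]

/-- By the Leibniz rule `E_{a, s 4}` hits either `x_{s 3}^*`, with `a = s 3`, or a power of `x_5^*`,
with `a = 4`; it misses `x_1^m` because `s 4 ≠ s 2 = 0`. Terms of the first kind cancel cyclically
in `s 0, s 1, s 3` by closedness; those of the second kind are symmetric in `s 3, s 4` and cancel by
sign. -/
theorem nablaB_singular (m n : ℕ) (w : Odd) :
    ∑ s : Equiv.Perm (Fin 5), ((Equiv.Perm.sign s : ℤ) : ℂ) • ∑ a, oddCoeff w a (s 0) (s 1) •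
      actE a (s 4) (if s 2 = 0 then vx 0 ^ m * vxs 4 ^ n * vxs (s 3) else 0) = 0 := by
  have key : ∀ s : Equiv.Perm (Fin 5), ∑ a, oddCoeff w a (s 0) (s 1) •
      actE a (s 4) (if s 2 = 0 then vx 0 ^ m * vxs 4 ^ n * vxs (s 3) else 0) =
      (if s 2 = 0 then - (oddCoeff w (s 3) (s 0) (s 1) • (vx 0 ^ m * vxs 4 ^ n * vxs (s 4)))
        else 0) +
      (if s 2 = 0 then - (oddCoeff w 4 (s 0) (s 1) •
        (vx 0 ^ m * ((n : Poly) * vxs 4 ^ (n - 1)) * (vxs (s 3) * vxs (s 4)))) else 0) := by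
    intro s
    by_cases h : s 2 = 0
    · have h4 : s 4 ≠ 0 := by
        rw [← h]
        exact s.injective.ne (by decide)
      simp only [h, if_true]
      have e : ∀ a, actE a (s 4) (vx 0 ^ m * vxs 4 ^ n * vxs (s 3)) =
          (if a = s 3 then - (vx 0 ^ m * vxs 4 ^ n * vxs (s 4)) else 0) +
          (if a = 4 then - (vx 0 ^ m * ((n : Poly) * vxs 4 ^ (n - 1)) * (vxs (s 3) * vxs (s 4)))
            else 0) := by
        intro a
        have hx : actE a (s 4) (vx 0 ^ m) = 0 := derivation_pow_zero (by simp [actE_vx, h4]) _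
        rw [Derivation.leibniz, Derivation.leibniz, hx, Derivation.leibniz_pow, actE_vxs, actE_vxs]
        simp only [smul_eq_mul, nsmul_eq_mul]
        split_ifs <;> ring
      simp only [e, smul_add, Finset.sum_add_distrib, smul_ite, smul_zero, Finset.sum_ite_eq',
        Finset.mem_univ, if_true, smul_neg]
    · simp [h]
  simp only [key, smul_add, Finset.sum_add_distrib]
  rw [sum_sign_smul_eq_zero_of_cycle _ (Equiv.swap 0 1 * Equiv.swap 1 3) (by decide) fun s => ?_,
    zero_add]
  · refine sum_sign_smul_eq_zero_of_swap _ (Equiv.swap 3 4) (by decide) fun s => ?_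
    have e : Equiv.swap (3 : Fin 5) 4 0 = 0 ∧ Equiv.swap (3 : Fin 5) 4 1 = 1 ∧
      Equiv.swap (3 : Fin 5) 4 2 = 2 ∧ Equiv.swap (3 : Fin 5) 4 3 = 4 ∧
      Equiv.swap (3 : Fin 5) 4 4 = 3 := by decide
    simp only [Equiv.Perm.mul_apply, e, mul_comm (vxs (s 3))]
  · set g : Equiv.Perm (Fin 5) := Equiv.swap 0 1 * Equiv.swap 1 3 with hg
    have e : g 0 = 1 ∧ g 1 = 3 ∧ g 3 = 0 ∧ g 2 = 2 ∧ g 4 = 4 := by decide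
    simp only [Equiv.Perm.mul_apply, e]
    split_ifs
    · rw [← neg_add, ← neg_add, ← add_smul, ← add_smul]
      have := oddCoeff_closed w (s 3) (s 0) (s 1)
      rw [this]
      simp
    · simp

theorem vx_pow_mul_vxs_mem (m n : ℕ) {j : Fin 5} (hj : j ≠ 0) :
    vx 0 ^ m * vxs 4 ^ n * vxs j ∈ F ![m, 0, 0, n + 1] := by
  have h0 : hwPoly ![m, 0, 0, n + 1] = vx 0 ^ m * vxs 4 ^ (n + 1) := by simp [hwPoly]
  by_cases h4 : j = 4
  · subst h4
    rw [mul_assoc, ← pow_succ, ← h0]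
    exact (hw _).2
  · have h1 : actE 4 j (hwPoly ![m, 0, 0, n + 1]) =
        (-(n + 1 : ℕ) : ℂ) • (vx 0 ^ m * vxs 4 ^ n * vxs j) := by
      have hx : actE 4 j (vx 0 ^ m) = 0 := derivation_pow_zero (by simp [actE_vx, hj]) _
      rw [h0, Derivation.leibniz, hx, smul_zero, add_zero, Derivation.leibniz_pow, actE_vxs,
        if_pos rfl, ← Nat.cast_smul_eq_nsmul ℂ, add_tsub_cancel_right, neg_smul, smul_eq_mul,
        smul_eq_mul, mul_smul_comm, mul_neg, mul_neg, smul_neg, mul_assoc]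
    have h2 : actE 4 j (hwPoly ![m, 0, 0, n + 1]) ∈ F ![m, 0, 0, n + 1] :=
      actE_mem_F (Ne.symm h4) (hw _).2
    rw [h1] at h2
    exact (Submodule.smul_mem_iff (F ![m, 0, 0, n + 1]).toSubmodule
      (neg_ne_zero.mpr (by exact_mod_cast n.succ_ne_zero))).mp h2

theorem exists_nablaB (m n : ℕ) : ∃ φ : M ![m + 1, 0, 0, n] →ₗ[U] M ![m, 0, 0, n + 1],
    HasDegree 1 φ ∧ IsNablaB m n φ := by
  set c : ℂ := (2 * (m + 1 : ℂ))⁻¹ with hc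
  have hm : (m + 1 : ℂ) ≠ 0 := by exact_mod_cast m.succ_ne_zero
  let u : Fin 5 → F ![m, 0, 0, n + 1] := fun j => if h : j = 0 then 0 else
    ⟨_, vx_pow_mul_vxs_mem m n h⟩
  have hu0 : u 0 = 0 := rfl
  have hu : ∀ j, j ≠ 0 → (u j : Poly) = vx 0 ^ m * vxs 4 ^ n * vxs j := by
    intro j hj
    simp [u, hj]
  let f : Fin 5 → Fin 5 → F ![m, 0, 0, n + 1] := fun i j =>
    (1 / 2 : ℂ) • ((if i = 0 then u j else 0) - (if j = 0 then u i else 0))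
  have hf : ∀ i j, (f i j : Poly) = (1 / 2 : ℂ) •
      ((if i = 0 then vx 0 ^ m * vxs 4 ^ n * vxs j else 0) -
        (if j = 0 then vx 0 ^ m * vxs 4 ^ n * vxs i else 0)) := by
    intro i j
    simp only [f, LieSubmodule.coe_smul, LieSubmodule.coe_sub]
    congr 1
    by_cases hi : i = 0 <;> by_cases hj : j = 0 <;> simp [hi, hj, hu0, hu]
  obtain ⟨φ, hφ, hv⟩ := exists_morphism_of_poly (lam := ![m + 1, 0, 0, n]) (mu := ![m, 0, 0, n + 1])
    -- The derivatives `∂/∂x_i` and the vectors `x_j^*` transform compatibly with `tensorAct`, so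
    -- their antisymmetrized product is equivariant; it trades one `x` for one `x^*`. The constant
    -- `c` normalizes as for `∇_A`.
    (LinearMap.pi fun i => LinearMap.pi fun j => c •
      (LinearMap.mulRight ℂ (vxs j) ∘ₗ (pdx i).toLinearMap -
        LinearMap.mulRight ℂ (vxs i) ∘ₗ (pdx j).toLinearMap)) (fun A f => by
      ext i j : 2
      change c • (pdx i (act A.1 f) * vxs j - pdx j (act A.1 f) * vxs i) =
        act A.1 (c • (pdx i f * vxs j - pdx j f * vxs i)) +
        ∑ k, (A.1 i k • c • (pdx k f * vxs j - pdx j f * vxs k) +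
          A.1 j k • c • (pdx i f * vxs k - pdx k f * vxs i))
      rw [Derivation.map_smul, Finset.sum_congr rfl fun k _ => congrArg₂ (· + ·)
        (smul_comm (A.1 i k) c _) (smul_comm (A.1 j k) c _)]
      simp only [← smul_add, ← Finset.smul_sum]
      congr 1
      rw [pdx_act, pdx_act, map_sub, Derivation.leibniz, Derivation.leibniz, act_vxs, act_vxs]
      simp only [smul_eq_mul, add_mul, mul_neg, Finset.mul_sum, Finset.sum_mul, smul_sub,
        Finset.sum_add_distrib, Finset.sum_sub_distrib, mul_smul_comm, smul_mul_assoc]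
      ring)
    f
    (fun i j => by
      simp only [f]
      rw [← smul_neg, neg_sub])
    (fun i j => by
      change c • (pdx i (hwPoly _) * vxs j - pdx j (hwPoly _) * vxs i) = _
      have e : ∀ i, pdx i (hwPoly ![m + 1, 0, 0, n]) =
          (m + 1 : ℂ) • (if i = 0 then vx 0 ^ m * vxs 4 ^ n else 0) := by
        intro i
        have h0 : hwPoly ![m + 1, 0, 0, n] = vx 0 ^ (m + 1) * vxs 4 ^ n := by simp [hwPoly]
        rw [h0, Derivation.leibniz, derivation_pow_zero (pdx_vxs _ _), smul_zero, zero_add,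
          Derivation.leibniz_pow, pdx_vx, ← Nat.cast_smul_eq_nsmul ℂ, add_tsub_cancel_right,
          smul_eq_mul, smul_eq_mul, mul_smul_comm]
        push_cast
        congr 1
        by_cases hi : i = 0
        · simp [hi, mul_comm]
        · simp [hi, Ne.symm hi]
      rw [hf, e, e, smul_mul_assoc, smul_mul_assoc, ← smul_sub, smul_smul]
      congr 1
      · rw [hc]
        field_simp
      · simp only [ite_mul, zero_mul])
    (fun w => by
      -- The terms of `f` with `j = 0` arise from those with `i = 0` by exchanging `s 2` and `s 3`.
      have h2 := sum_sign_smul_mul_right (fun s => ∑ a, oddCoeff w a (s 0) (s 1) •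
        actE a (s 4) (if s 2 = 0 then vx 0 ^ m * vxs 4 ^ n * vxs (s 3) else 0))
        (Equiv.swap 2 3) (by decide)
      rw [nablaB_singular] at h2
      have e : Equiv.swap (2 : Fin 5) 3 0 = 0 ∧ Equiv.swap (2 : Fin 5) 3 1 = 1 ∧
        Equiv.swap (2 : Fin 5) 3 2 = 3 ∧ Equiv.swap (2 : Fin 5) 3 3 = 2 ∧
        Equiv.swap (2 : Fin 5) 3 4 = 4 := by decide
      simp only [Equiv.Perm.mul_apply, e] at h2
      simp only [hf, Derivation.map_smul, map_sub, smul_sub, Finset.sum_sub_distrib,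
        smul_comm _ (1 / 2 : ℂ), ← Finset.smul_sum]
      rw [h2, nablaB_singular]
      simp)
  refine ⟨φ, hφ, rfl, rfl, fun j => u j.succ, fun j => ?_, ?_⟩
  · rw [hu _ (Fin.succ_ne_zero j)]
    ring
  · rw [hv, degOne_apply]
    have e : ∀ i j, (tmul (dU i j) (f i j) : M ![m, 0, 0, n + 1]) = (1 / 2 : ℂ) •
        ((if i = 0 then tmul (dU i j) (u j) else 0) - (if j = 0 then tmul (dU i j) (u i) else 0)) := by
      intro i j
      simp only [f, ← tmulL_apply, map_smul, map_sub]
      congr 2 <;> split_ifs <;> simp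
    have hz : (tmul (dU 0 0) (u 0) : M ![m, 0, 0, n + 1]) = 0 := by
      rw [hu0]
      exact map_zero (tmulL _)
    simp only [e, ← Finset.smul_sum, Finset.sum_sub_distrib, Finset.sum_ite_eq', Finset.mem_univ,
      if_true]
    rw [Finset.sum_comm]
    simp only [Finset.sum_ite_eq', Finset.mem_univ, if_true]
    rw [Finset.sum_congr rfl fun x _ => tmul_dU_swap x 0 (u x), Finset.sum_neg_distrib,
      sub_neg_eq_add, ← two_smul ℂ, smul_smul, Fin.sum_univ_succ, hz]
    norm_num

theorem sum_pair_eq {N : Type*} [AddCommGroup N] (T : Fin 5 → Fin 5 → N)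
    (h : ∀ i j, T i j = T j i) (h0 : ∀ i, T i i = 0) :
    ∑ i, ∑ j, T i j = ∑ p : Pair, (T p.1.1 p.1.2 + T p.1.1 p.1.2) := by
  have h1 : ∑ p : Pair, (T p.1.1 p.1.2 + T p.1.1 p.1.2) =
      ∑ i, ∑ j, if i < j then T i j + T i j else 0 := by
    rw [← Fintype.sum_prod_type' (f := fun i j => if i < j then T i j + T i j else 0),
      ← Finset.sum_filter]
    exact (Finset.sum_subtype (Finset.univ.filter fun p : Fin 5 × Fin 5 => p.1 < p.2) (by simp)
      fun p => T p.1 p.2 + T p.1 p.2).symm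
  have h2 : ∀ i j, T i j = (if i < j then T i j else 0) + (if j < i then T j i else 0) := by
    intro i j
    rcases lt_trichotomy i j with hij | rfl | hij
    · simp [hij, hij.not_gt]
    · simp [h0]
    · simp [hij, hij.not_gt, h i j]
  rw [h1]
  conv_lhs => rw [Finset.sum_congr rfl fun i _ => Finset.sum_congr rfl fun j _ => h2 i j]
  simp only [Finset.sum_add_distrib]
  rw [Finset.sum_comm (f := fun i j => if j < i then T j i else 0), ← Finset.sum_add_distrib]
  refine Finset.sum_congr rfl fun i _ => ?_
  rw [← Finset.sum_add_distrib]
  refine Finset.sum_congr rfl fun j _ => ?_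
  split_ifs <;> simp

/-! ### The Plücker relations -/

/-- On the highest weight vector the cyclic sum is, up to a common factor, a coefficient of `x_1 ∧
(x_1 ∧ x_2) = 0`. The common kernel of all these operators is stable under `𝔰𝔩₅`, hence contains the
module generated by that vector. -/
theorem plucker_x {n k : ℕ} {g : Poly} (hg : g ∈ F ![n, k, 0, 0]) (i j l : Fin 5) :
    pdx l (pdxx i j g) + pdx i (pdxx j l g) + pdx j (pdxx l i g) = 0 := by
  let D : Fin 5 → Fin 5 → Fin 5 → (Poly →ₗ[ℂ] Poly) := fun i j l =>
    (pdx l).toLinearMap ∘ₗ (pdxx i j).toLinearMap + (pdx i).toLinearMap ∘ₗ (pdxx j l).toLinearMap +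
      (pdx j).toLinearMap ∘ₗ (pdxx l i).toLinearMap
  have hD : ∀ i j l f, D i j l f =
    pdx l (pdxx i j f) + pdx i (pdxx j l f) + pdx j (pdxx l i f) := fun _ _ _ _ => rfl
  have h := F_le ![n, k, 0, 0] (⨅ (i : Fin 5) (j : Fin 5) (l : Fin 5), LinearMap.ker (D i j l))
    ?_ ?_ hg
  · simp only [Submodule.mem_iInf, LinearMap.mem_ker] at h
    exact h i j l
  · simp only [Submodule.mem_iInf, LinearMap.mem_ker]
    intro i j l
    have e : ∀ i j l, pdx l (pdxx i j (hwPoly ![n, k, 0, 0])) =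
        pdx l (vx 0) * pdxx i j (vxx 0 1) * (n * vx 0 ^ (n - 1) * (k * vxx 0 1 ^ (k - 1))) := by
      intro i j l
      have h0 : hwPoly ![n, k, 0, 0] = vx 0 ^ n * vxx 0 1 ^ k := by simp [hwPoly]
      have hc : pdx l (pdxx i j (vxx 0 1)) = 0 := by
        rw [pdxx_vxx]
        split_ifs <;> simp
      have hk : pdx l ((k : Poly) * (vxx 0 1 ^ (k - 1))) = 0 :=
        derivation_mul_zero (by simp) (derivation_pow_zero (pdx_vxx _ _ _) _)
      rw [h0, Derivation.leibniz, derivation_pow_zero (pdxx_vx _ _ _), smul_zero, add_zero,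
        Derivation.leibniz_pow, smul_eq_mul, smul_eq_mul, nsmul_eq_mul, ← mul_assoc (k : Poly),
        Derivation.leibniz, derivation_mul_zero hk hc, smul_zero, zero_add, Derivation.leibniz_pow,
        smul_eq_mul, smul_eq_mul, nsmul_eq_mul]
      ring
    rw [hD, e, e, e, ← add_mul, ← add_mul]
    have : pdx l (vx 0) * pdxx i j (vxx 0 1) + pdx i (vx 0) * pdxx j l (vxx 0 1) +
        pdx j (vx 0) * pdxx l i (vxx 0 1) = 0 := by
      simp only [pdxx_vxx, pdx_vx, ite_and]
      split_ifs <;> simp_all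
    rw [this, zero_mul]
  · intro A f hf
    simp only [Submodule.mem_iInf, LinearMap.mem_ker, hD] at hf ⊢
    intro i j l
    have e : ∀ i j l, pdx l (pdxx i j (act A.1 f)) = act A.1 (pdx l (pdxx i j f)) +
        ∑ m, (A.1 l m • pdx m (pdxx i j f) + A.1 i m • pdx l (pdxx m j f) +
          A.1 j m • pdx l (pdxx i m f)) := by
      intro i j l
      simp only [pdxx_act, map_add, pdx_act, map_sum, Derivation.map_smul, Finset.sum_add_distrib]
      abel
    have h1 := congrArg (act A.1) (hf i j l)
    rw [map_zero, map_add, map_add] at h1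
    have h2 : ∑ m, (A.1 l m • (pdx m (pdxx i j f) + pdx i (pdxx j m f) + pdx j (pdxx m i f)) +
        A.1 i m • (pdx l (pdxx m j f) + pdx m (pdxx j l f) + pdx j (pdxx l m f)) +
        A.1 j m • (pdx l (pdxx i m f) + pdx i (pdxx m l f) + pdx m (pdxx l i f))) = 0 :=
      Finset.sum_eq_zero fun m _ => by rw [hf, hf, hf]; simp
    rw [e, e, e]
    simp only [smul_add, Finset.sum_add_distrib] at h2 ⊢
    linear_combination (exp := 1) h1 + h2

/-- The same argument, with the quadratic Plücker relation for the decomposable bivector `x_1 ∧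
x_2`. -/
theorem plucker_xx {n k : ℕ} {g : Poly} (hg : g ∈ F ![n, k, 0, 0]) (i j l t : Fin 5) :
    pdxx l t (pdxx i j g) + pdxx i t (pdxx j l g) + pdxx j t (pdxx l i g) = 0 := by
  let D : Fin 5 → Fin 5 → Fin 5 → Fin 5 → (Poly →ₗ[ℂ] Poly) := fun i j l t =>
    (pdxx l t).toLinearMap ∘ₗ (pdxx i j).toLinearMap +
      (pdxx i t).toLinearMap ∘ₗ (pdxx j l).toLinearMap +
      (pdxx j t).toLinearMap ∘ₗ (pdxx l i).toLinearMap
  have hD : ∀ i j l t f, D i j l t f =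
    pdxx l t (pdxx i j f) + pdxx i t (pdxx j l f) + pdxx j t (pdxx l i f) := fun _ _ _ _ _ => rfl
  have h := F_le ![n, k, 0, 0] (⨅ (i : Fin 5) (j : Fin 5) (l : Fin 5) (t : Fin 5),
    LinearMap.ker (D i j l t)) ?_ ?_ hg
  · simp only [Submodule.mem_iInf, LinearMap.mem_ker] at h
    exact h i j l t
  · simp only [Submodule.mem_iInf, LinearMap.mem_ker]
    intro i j l t
    have e : ∀ i j l t, pdxx l t (pdxx i j (hwPoly ![n, k, 0, 0])) =
        pdxx l t (vxx 0 1) * pdxx i j (vxx 0 1) *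
          (vx 0 ^ n * (k * ((k - 1 : ℕ) * vxx 0 1 ^ (k - 1 - 1)))) := by
      intro i j l t
      have h0 : hwPoly ![n, k, 0, 0] = vx 0 ^ n * vxx 0 1 ^ k := by simp [hwPoly]
      have hc : pdxx l t (pdxx i j (vxx 0 1)) = 0 := by
        rw [pdxx_vxx]
        simp only [map_sub]
        split_ifs <;> simp
      have hn : pdxx l t (vx 0 ^ n * (k : Poly)) = 0 :=
        derivation_mul_zero (derivation_pow_zero (pdxx_vx _ _ _) _) (by simp)
      rw [h0, Derivation.leibniz, derivation_pow_zero (pdxx_vx _ _ _), smul_zero, add_zero,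
        Derivation.leibniz_pow, smul_eq_mul, smul_eq_mul, nsmul_eq_mul, ← mul_assoc (vx 0 ^ n),
        Derivation.leibniz, hn, smul_zero, add_zero, Derivation.leibniz, hc, smul_zero, zero_add,
        Derivation.leibniz_pow]
      simp only [smul_eq_mul, nsmul_eq_mul]
      ring
    rw [hD, e, e, e, ← add_mul, ← add_mul]
    have : pdxx l t (vxx 0 1) * pdxx i j (vxx 0 1) + pdxx i t (vxx 0 1) * pdxx j l (vxx 0 1) +
        pdxx j t (vxx 0 1) * pdxx l i (vxx 0 1) = 0 := by
      have hp : ∀ i j, pdxx i j (vxx 0 1) =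
          (if i = 0 then 1 else 0) * (if j = 1 then 1 else 0) -
          (if i = 1 then 1 else 0) * (if j = 0 then 1 else 0) := by
        intro i j
        rw [pdxx_vxx]
        fin_cases i <;> fin_cases j <;> simp
      rw [hp, hp, hp, hp, hp, hp]
      ring
    rw [this, zero_mul]
  · intro A f hf
    simp only [Submodule.mem_iInf, LinearMap.mem_ker, hD] at hf ⊢
    intro i j l t
    have e : ∀ i j l t, pdxx l t (pdxx i j (act A.1 f)) = act A.1 (pdxx l t (pdxx i j f)) +
        ∑ m, (A.1 l m • pdxx m t (pdxx i j f) + A.1 t m • pdxx l m (pdxx i j f) +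
          A.1 i m • pdxx l t (pdxx m j f) + A.1 j m • pdxx l t (pdxx i m f)) := by
      intro i j l t
      simp only [pdxx_act, map_add, map_sum, Derivation.map_smul, Finset.sum_add_distrib]
      abel
    have h1 := congrArg (act A.1) (hf i j l t)
    rw [map_zero, map_add, map_add] at h1
    have h2 : ∑ m, (
        A.1 l m • (pdxx m t (pdxx i j f) + pdxx i t (pdxx j m f) + pdxx j t (pdxx m i f)) +
        A.1 i m • (pdxx l t (pdxx m j f) + pdxx m t (pdxx j l f) + pdxx j t (pdxx l m f)) +
        A.1 j m • (pdxx l t (pdxx i m f) + pdxx i t (pdxx m l f) + pdxx m t (pdxx l i f)) +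
        A.1 t m • (pdxx l m (pdxx i j f) + pdxx i m (pdxx j l f) + pdxx j m (pdxx l i f))) = 0 :=
      Finset.sum_eq_zero fun m _ => by rw [hf, hf, hf, hf]; simp
    rw [e, e, e]
    simp only [smul_add, Finset.sum_add_distrib] at h2 ⊢
    linear_combination (exp := 1) h1 + h2

/-- By contravariance `E_{s 4, a}` acts on the left factor. Terms in which it hits `x_{s 2, s 3}`
cancel by closedness; terms in which it hits the powers of `x_{45}` and `x_5` cancel cyclically in
`s 2, s 3, s 4` by the Plücker relations satisfied by `g`. -/
theorem nablaC_singular (m n : ℕ) (w : Odd) {g : Poly} (hg : g ∈ F ![n, m + 1, 0, 0]) :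
    ∑ s : Equiv.Perm (Fin 5), ((Equiv.Perm.sign s : ℤ) : ℂ) • ∑ a, oddCoeff w a (s 0) (s 1) •
      fischer (vxx (s 2) (s 3) * (vxx 3 4 ^ m * vx 4 ^ n)) (actE a (s 4) g) = 0 := by
  set Q : Poly := vxx 3 4 ^ m * vx 4 ^ n with hQ
  set r : Poly := vxx 3 4 ^ m * (n * vx 4 ^ (n - 1)) with hr
  set r' : Poly := vx 4 ^ n * (m * vxx 3 4 ^ (m - 1)) with hr'
  have key : ∀ b c k l t : Fin 5, ∑ a, oddCoeff w a b c • fischer (vxx k l * Q) (actE a t g) =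
      oddCoeff w k b c • fischer (Q * vxx t l) g + oddCoeff w l b c • fischer (Q * vxx k t) g +
      (oddCoeff w 4 b c • fischer (vxx k l * (vx t * r)) g +
        oddCoeff w 4 b c • fischer (vxx k l * (vxx 3 t * r')) g +
        oddCoeff w 3 b c • fischer (vxx k l * (vxx t 4 * r')) g) := by
    intro b c k l t
    have e : ∀ a, actE t a (vxx k l * Q) =
        (if a = k then Q * vxx t l else 0) + (if a = l then Q * vxx k t else 0) +
        ((if a = 4 then vxx k l * (vx t * r) else 0) +
          (if a = 4 then vxx k l * (vxx 3 t * r') else 0) +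
          (if a = 3 then vxx k l * (vxx t 4 * r') else 0)) := by
      intro a
      rw [hQ, Derivation.leibniz, Derivation.leibniz, Derivation.leibniz_pow, Derivation.leibniz_pow,
        actE_vxx, actE_vxx, actE_vx, hr, hr']
      simp only [smul_eq_mul, nsmul_eq_mul]
      split_ifs <;> ring
    have e' : ∀ a, fischer (vxx k l * Q) (actE a t g) =
        (if a = k then fischer (Q * vxx t l) g else 0) +
        (if a = l then fischer (Q * vxx k t) g else 0) +
        ((if a = 4 then fischer (vxx k l * (vx t * r)) g else 0) +
          (if a = 4 then fischer (vxx k l * (vxx 3 t * r')) g else 0) +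
          (if a = 3 then fischer (vxx k l * (vxx t 4 * r')) g else 0)) := by
      intro a
      have := fischer_act (Matrix.single t a 1) (vxx k l * Q) g
      rw [Matrix.transpose_single] at this
      rw [← this, e]
      simp only [map_add, LinearMap.add_apply]
      split_ifs <;> simp
    simp only [e', smul_add, Finset.sum_add_distrib, smul_ite, smul_zero, Finset.sum_ite_eq',
      Finset.mem_univ, if_true]
  have hp1 : ∀ i j l, fischer (vxx i j * (vx l * r)) g + fischer (vxx j l * (vx i * r)) g +
      fischer (vxx l i * (vx j * r)) g = 0 := by
    intro i j l
    simp only [fischer_vxx_mul, fischer_vx_mul, ← map_add]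
    rw [plucker_x hg, map_zero]
  have hp2 : ∀ i j l t, fischer (vxx i j * (vxx l t * r')) g +
      fischer (vxx j l * (vxx i t * r')) g + fischer (vxx l i * (vxx j t * r')) g = 0 := by
    intro i j l t
    simp only [fischer_vxx_mul, ← map_add]
    rw [plucker_xx hg, map_zero]
  have hp3 : ∀ i j l t, fischer (vxx i j * (vxx t l * r')) g +
      fischer (vxx j l * (vxx t i * r')) g + fischer (vxx l i * (vxx t j * r')) g = 0 := by
    intro i j l t
    have h := hp2 i j l t
    rw [vxx_swap t l, vxx_swap t i, vxx_swap t j]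
    simp only [neg_mul, mul_neg, map_neg, LinearMap.neg_apply]
    linear_combination -h
  simp only [key]
  rw [Finset.sum_congr rfl fun s _ => smul_add _ _ _, Finset.sum_add_distrib,
    Finset.sum_congr rfl fun s _ => smul_add _ _ _, Finset.sum_add_distrib]
  -- The first two cycles rotate positions `0, 1, 2` and `0, 1, 3`, for closedness; the third
  -- rotates `2, 3, 4`, for the Plücker relations.
  rw [sum_sign_smul_eq_zero_of_cycle _ (Equiv.swap 0 1 * Equiv.swap 1 2) (by decide) fun s => ?_,
    sum_sign_smul_eq_zero_of_cycle _ (Equiv.swap 0 1 * Equiv.swap 1 3) (by decide) fun s => ?_,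
    sum_sign_smul_eq_zero_of_cycle _ (Equiv.swap 2 3 * Equiv.swap 3 4) (by decide) fun s => ?_,
    add_zero, add_zero]
  · set c : Equiv.Perm (Fin 5) := Equiv.swap 2 3 * Equiv.swap 3 4 with hc
    have e : c 0 = 0 ∧ c 1 = 1 ∧ c 2 = 3 ∧ c 3 = 4 ∧ c 4 = 2 := by decide
    simp only [Equiv.Perm.mul_apply, e, smul_eq_mul]
    linear_combination oddCoeff w 4 (s 0) (s 1) * (hp1 (s 2) (s 3) (s 4)) +
      oddCoeff w 4 (s 0) (s 1) * (hp3 (s 2) (s 3) (s 4) 3) +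
      oddCoeff w 3 (s 0) (s 1) * (hp2 (s 2) (s 3) (s 4) 4)
  · set c : Equiv.Perm (Fin 5) := Equiv.swap 0 1 * Equiv.swap 1 3 with hc
    have e : c 0 = 1 ∧ c 1 = 3 ∧ c 2 = 2 ∧ c 3 = 0 ∧ c 4 = 4 := by decide
    simp only [Equiv.Perm.mul_apply, e, ← add_smul]
    rw [oddCoeff_closed, zero_smul]
  · set c : Equiv.Perm (Fin 5) := Equiv.swap 0 1 * Equiv.swap 1 2 with hc
    have e : c 0 = 1 ∧ c 1 = 2 ∧ c 2 = 0 ∧ c 3 = 3 ∧ c 4 = 4 := by decide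
    simp only [Equiv.Perm.mul_apply, e, ← add_smul]
    rw [oddCoeff_closed, zero_smul]

/-- The equivariant map underlying `∇_C`, with values in the dual of `F(n,m+1,0,0)`. -/
def nablaCDual (m n : ℕ) (i j : Fin 5) :
    Poly →ₗ[ℂ] Module.Dual ℂ (F ![n, m + 1, 0, 0]) :=
  LinearMap.lcomp ℂ ℂ (F ![n, m + 1, 0, 0]).toSubmodule.subtype ∘ₗ
    ((1 / 2 : ℂ) • fischer ∘ₗ LinearMap.mulLeft ℂ (vxx i j) ∘ₗ starMap.toLinearMap)

/-- As a polynomial, `x_{ij}^* (x_{45}^*)^m (x_5^*)^n` need not lie in `F(0,0,m+1,n)`. As a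
functional on `F(n,m+1,0,0)` it does define an element of that module, so the computation is done in
the dual. -/
theorem nablaCDual_apply (m n : ℕ) (i j : Fin 5) (f : Poly) (g : F ![n, m + 1, 0, 0]) :
    nablaCDual m n i j f g = (1 / 2 : ℂ) * fischer (vxx i j * starMap f) g := rfl

theorem nablaCDual_act (m n : ℕ) (A : sl5) (f : Poly) :
    (fun i j => nablaCDual m n i j (act A.1 f)) = tensorAct A fun i j => nablaCDual m n i j f := by
  ext i j g
  simp only [tensorAct, LinearMap.add_apply, LinearMap.sum_apply, LinearMap.smul_apply,
    nablaCDual_apply, smul_eq_mul]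
  have h1 : ⁅A, nablaCDual m n i j f⁆ g =
      (1 / 2 : ℂ) * fischer (act (-A.1.transpose) (vxx i j * starMap f)) g := by
    change - ((1 / 2 : ℂ) * fischer (vxx i j * starMap f) (act A.1 g)) = _
    rw [fischer_act, Matrix.transpose_neg, Matrix.transpose_transpose, ← neg_one_smul ℂ A.1,
      act_smul, Derivation.smul_apply, map_smul, neg_one_smul, mul_neg]
  have h2 : act (-A.1.transpose) (vxx i j) =
      -∑ k, (A.1 i k • vxx k j + A.1 j k • vxx i k) := by
    rw [act_vxx, ← Finset.sum_neg_distrib]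
    refine Finset.sum_congr rfl fun k _ => ?_
    rw [Matrix.neg_apply, Matrix.neg_apply, Matrix.transpose_apply, Matrix.transpose_apply, neg_smul,
      neg_smul, neg_add]
  rw [h1, starMap_act, Derivation.leibniz, h2, smul_eq_mul, smul_eq_mul, mul_neg, mul_comm (starMap f),
    Finset.sum_mul]
  simp only [add_mul, smul_mul_assoc, map_add, map_neg, map_sum, map_smul, LinearMap.add_apply,
    LinearMap.neg_apply, LinearMap.sum_apply, LinearMap.smul_apply, smul_eq_mul]
  have h3 : ∀ u v : Fin 5 → ℂ, ∑ k, (A.1 i k * (1 / 2 * u k) + A.1 j k * (1 / 2 * v k)) =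
      1 / 2 * ∑ k, (A.1 i k * u k + A.1 j k * v k) := by
    intro u v
    rw [Finset.mul_sum]
    exact Finset.sum_congr rfl fun k _ => by ring
  rw [h3]
  ring

theorem sum_lie_nablaCDual (m n : ℕ) (w : Odd) :
    ∑ i, ∑ j, ⁅linPart (bracketOO w (d i j)), nablaCDual m n i j (hwPoly ![0, 0, m, n])⁆ = 0 := by
  ext g
  have hQ : starMap (hwPoly ![0, 0, m, n]) = vxx 3 4 ^ m * vx 4 ^ n := by
    simp [hwPoly, starMap_vxxs, starMap_vxs]
  have h1 : ∀ B : sl5, ∀ i j, ⁅B, nablaCDual m n i j (hwPoly ![0, 0, m, n])⁆ g =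
      ∑ a, ∑ t, B.1 a t • (-(1 / 2 : ℂ) *
        fischer (vxx i j * (vxx 3 4 ^ m * vx 4 ^ n)) (actE a t (g : Poly))) := by
    intro B i j
    change - ((1 / 2 : ℂ) * fischer (vxx i j * starMap (hwPoly ![0, 0, m, n])) (act B.1 g)) = _
    rw [hQ, act_eq_sum_actE B.1]
    simp only [map_sum, map_smul, Finset.mul_sum, smul_eq_mul, ← Finset.sum_neg_distrib]
    refine Finset.sum_congr rfl fun a _ => Finset.sum_congr rfl fun t _ => ?_
    ring
  simp only [LinearMap.sum_apply, h1, LinearMap.zero_apply]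
  rw [sum_linPart_bracketOO_d w fun a t i j => -(1 / 2 : ℂ) *
        fischer (vxx i j * (vxx 3 4 ^ m * vx 4 ^ n)) (actE a t (g : Poly))]
  have h2 : ∀ a t k l, -(1 / 2 : ℂ) *
      fischer (vxx k l * (vxx 3 4 ^ m * vx 4 ^ n)) (actE a t (g : Poly)) - -(1 / 2 : ℂ) *
      fischer (vxx l k * (vxx 3 4 ^ m * vx 4 ^ n)) (actE a t (g : Poly)) = (-1 : ℂ) •
      fischer (vxx k l * (vxx 3 4 ^ m * vx 4 ^ n)) (actE a t (g : Poly)) := by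
    intro a t k l
    rw [vxx_swap l k, neg_mul (vxx k l), map_neg, LinearMap.neg_apply, smul_eq_mul]
    ring
  simp only [h2, smul_comm _ (-1 : ℂ), ← Finset.smul_sum]
  rw [nablaC_singular m n w g.2]
  simp

theorem exists_nablaC (m n : ℕ) : ∃ φ : M ![0, 0, m, n] →ₗ[U] M ![0, 0, m + 1, n],
    HasDegree 1 φ ∧ IsNablaC m n φ := by
  let e := dualEquiv n (m + 1)
  have he : ∀ A x, e.symm ⁅A, x⁆ = ⁅A, e.symm x⁆ := fun A x => e.symm.toLieModuleHom.map_lie A x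
  let θ : F ![0, 0, m, n] →ₗ[ℂ] (Fin 5 → Fin 5 → F ![0, 0, m + 1, n]) :=
    LinearMap.pi fun i => LinearMap.pi fun j => e.symm.toLinearEquiv.toLinearMap ∘ₗ
      nablaCDual m n i j ∘ₗ (F ![0, 0, m, n]).toSubmodule.subtype
  have hθ : ∀ v i j, θ v i j = e.symm (nablaCDual m n i j (v : Poly)) := fun _ _ _ => rfl
  obtain ⟨φ, hφ, hv⟩ := exists_morphism_of_hw θ (fun A v => by
    ext i j : 2
    rw [hθ]
    have h := congrFun (congrFun (nablaCDual_act m n A v) i) j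
    have h' : nablaCDual m n i j ((⁅A, v⁆ : F ![0, 0, m, n]) : Poly) = _ := h
    rw [h']
    simp only [tensorAct, hθ]
    rw [map_add, map_sum, he]
    simp only [map_add, map_smul]) (fun w hw => by
    rw [toU_od_smul_degOne hw]
    have h : ∑ i, ∑ j, ⁅linPart (bracketOO w (d i j)), θ (E510.hw ![0, 0, m, n]) i j⁆ = 0 := by
      have := congrArg e.symm (sum_lie_nablaCDual m n w)
      rw [map_zero] at this
      rw [← this]
      simp only [map_sum, he]
      rfl
    rw [h]
    exact map_zero (tmulL 1))
  refine ⟨φ, hφ, rfl, rfl, e, dualEquiv_hw m n, ?_⟩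
  have hanti : ∀ i j, θ (hw ![0, 0, m, n]) i j = - θ (hw ![0, 0, m, n]) j i := by
    intro i j
    rw [hθ, hθ, ← map_neg]
    congr 1
    ext g
    rw [nablaCDual_apply, LinearMap.neg_apply, nablaCDual_apply, vxx_swap i j, neg_mul, map_neg,
      LinearMap.neg_apply, mul_neg]
  -- Passing from ordered pairs to `i < j` doubles each term, which absorbs the `1/2` in
  -- `nablaCDual`.
  rw [hv, degOne_apply, sum_pair_eq]
  · refine Finset.sum_congr rfl fun p _ => ?_
    rw [← tmulL_apply, ← map_add, tmulL_apply, hθ, ← map_add]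
    congr 2
    ext g
    rw [LinearMap.add_apply, nablaCDual_apply, dualVec_apply]
    have hQ : starMap (hwPoly ![0, 0, m, n]) = vxx 3 4 ^ m * vx 4 ^ n := by
      simp [hwPoly, starMap_vxxs, starMap_vxs]
    change (1 / 2 : ℂ) * fischer (vxx p.1.1 p.1.2 * starMap (hwPoly ![0, 0, m, n])) _ +
      (1 / 2 : ℂ) * fischer (vxx p.1.1 p.1.2 * starMap (hwPoly ![0, 0, m, n])) _ = _
    rw [hQ, ← two_mul, ← mul_assoc, show vxx p.1.1 p.1.2 * (vxx 3 4 ^ m * vx 4 ^ n) =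
      vx 4 ^ n * (vxx 3 4 ^ m * vxx p.1.1 p.1.2) by ring]
    norm_num
  · intro i j
    rw [tmul_dU_swap, hanti, ← tmulL_apply, map_neg, neg_neg, tmulL_apply]
  · intro i
    have : θ (hw ![0, 0, m, n]) i i = 0 := by
      rw [hθ, ← map_zero e.symm]
      congr 1
      ext g
      rw [nablaCDual_apply, show vxx i i = 0 by simp [vxx]]
      simp
    rw [this]
    exact map_zero (tmulL _)

/-! ### Uniqueness and non-vanishing -/

theorem hw_ne_zero (lam : Fin 4 → ℕ) : hw lam ≠ 0 := fun h =>
  hwPoly_ne_zero lam (congrArg Subtype.val h)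

theorem existsUnique_nablaA (m n : ℕ) :
    ∃! φ : M ![m, n + 1, 0, 0] →ₗ[U] M ![m, n, 0, 0], IsNablaA m n φ := by
  obtain ⟨φ, _, h⟩ := exists_nablaA m n
  exact ⟨φ, h, fun ψ h' => F_hom_ext (h'.2.2.trans h.2.2.symm)⟩

theorem existsUnique_nablaB (m n : ℕ) :
    ∃! φ : M ![m + 1, 0, 0, n] →ₗ[U] M ![m, 0, 0, n + 1], IsNablaB m n φ := by
  obtain ⟨φ, _, h⟩ := exists_nablaB m n
  refine ⟨φ, h, fun ψ h' => F_hom_ext ?_⟩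
  obtain ⟨_, _, w, hw, e⟩ := h
  obtain ⟨_, _, w', hw', e'⟩ := h'
  have : w' = w := funext fun j => Subtype.ext ((hw' j).trans (hw j).symm)
  rw [e, e', this]

/-- The identification with the dual occurring in `∇_C` is fixed by its value at the highest weight
vector, so `∇_C` does not depend on a choice. -/
theorem lieEquiv_ext {W : Type*} [AddCommGroup W] [Module ℂ W] [LieRingModule sl5 W]
    [LieModule ℂ sl5 W] {mu : Fin 4 → ℕ} {e e' : F mu ≃ₗ⁅ℂ, sl5⁆ W} (h : e (hw mu) = e' (hw mu))
    (v : F mu) : e v = e' v := by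
  refine F_induction (LinearMap.eqLocus (e.toLinearEquiv : F mu →ₗ[ℂ] W)
    (e'.toLinearEquiv : F mu →ₗ[ℂ] W)) h (fun A v hv => ?_) v
  have hv' : e v = e' v := hv
  change e ⁅A, v⁆ = e' ⁅A, v⁆
  rw [show e ⁅A, v⁆ = ⁅A, e v⁆ from e.toLieModuleHom.map_lie A v,
    show e' ⁅A, v⁆ = ⁅A, e' v⁆ from e'.toLieModuleHom.map_lie A v, hv']

theorem existsUnique_nablaC (m n : ℕ) :
    ∃! φ : M ![0, 0, m, n] →ₗ[U] M ![0, 0, m + 1, n], IsNablaC m n φ := by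
  obtain ⟨φ, _, h⟩ := exists_nablaC m n
  refine ⟨φ, h, fun ψ h' => F_hom_ext ?_⟩
  obtain ⟨_, _, e, he, h⟩ := h
  obtain ⟨_, _, e', he', h'⟩ := h'
  rw [h, h']
  refine Finset.sum_congr rfl fun p _ => ?_
  congr 1
  apply e.injective
  rw [← lieEquiv_ext (he'.trans he.symm), LieModuleEquiv.apply_symm_apply,
    LieModuleEquiv.apply_symm_apply]

theorem IsNablaA.hasDegree {m n : ℕ} {lam mu : Fin 4 → ℕ} {φ : M lam →ₗ[U] M mu}
    (h : IsNablaA m n φ) : HasDegree 1 φ := by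
  obtain ⟨rfl, rfl, _⟩ := id h
  obtain ⟨ψ, hψ, h'⟩ := exists_nablaA m n
  rwa [(existsUnique_nablaA m n).unique h h']

theorem IsNablaB.hasDegree {m n : ℕ} {lam mu : Fin 4 → ℕ} {φ : M lam →ₗ[U] M mu}
    (h : IsNablaB m n φ) : HasDegree 1 φ := by
  obtain ⟨rfl, rfl, _⟩ := id h
  obtain ⟨ψ, hψ, h'⟩ := exists_nablaB m n
  rwa [(existsUnique_nablaB m n).unique h h']

theorem IsNablaC.hasDegree {m n : ℕ} {lam mu : Fin 4 → ℕ} {φ : M lam →ₗ[U] M mu}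
    (h : IsNablaC m n φ) : HasDegree 1 φ := by
  obtain ⟨rfl, rfl, _⟩ := id h
  obtain ⟨ψ, hψ, h'⟩ := exists_nablaC m n
  rwa [(existsUnique_nablaC m n).unique h h']

/-- For the three families the highest weight vector of the target appears at `d_{12}`, `d_{15}`,
`d_{45}` respectively. This shows non-vanishing and fixes the scalar in the final comparison. -/
theorem IsNablaA.coeffOne_hw {m n : ℕ} {lam mu : Fin 4 → ℕ} {φ : M lam →ₗ[U] M mu}
    (h : IsNablaA m n φ) : coeffOne 0 1 (φ (tmul 1 (hw lam))) = hw mu := by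
  rw [h.2.2, coeffOne_tmul_dU]
  simp

theorem IsNablaB.coeffOne_hw {m n : ℕ} {lam mu : Fin 4 → ℕ} {φ : M lam →ₗ[U] M mu}
    (h : IsNablaB m n φ) : coeffOne 0 4 (φ (tmul 1 (hw lam))) = hw mu := by
  obtain ⟨_, hmu, w, hw, e⟩ := h
  rw [e, map_sum, Fin.sum_univ_four]
  simp only [coeffOne_tmul_dU]
  simp
  refine Subtype.ext ((hw 3).trans ?_)
  subst hmu
  simp [E510.hw, hwPoly, pow_succ, mul_comm, mul_assoc]

theorem IsNablaC.coeffOne_hw {m n : ℕ} {lam mu : Fin 4 → ℕ} {φ : M lam →ₗ[U] M mu}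
    (h : IsNablaC m n φ) : coeffOne 3 4 (φ (tmul 1 (hw lam))) = hw mu := by
  obtain ⟨_, _, e, he, h⟩ := h
  rw [h, map_sum, Finset.sum_eq_single ⟨(3, 4), by decide⟩]
  · rw [coeffOne_tmul_dU, ← he, LieModuleEquiv.symm_apply_apply]
    simp
  · rintro ⟨⟨i, j⟩, hij⟩ _ hne
    rw [coeffOne_tmul_dU]
    have hij' : i < j := hij
    have h1 : ¬ (i = 3 ∧ j = 4) := fun hh => hne (Subtype.ext (Prod.ext hh.1 hh.2))
    have h2 : ¬ (i = 4 ∧ j = 3) := by omega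
    simp [h1, h2]
  · simp

theorem ne_zero_of_coeffOne_hw {lam mu : Fin 4 → ℕ} {φ : M lam →ₗ[U] M mu} {i j : Fin 5}
    (h : coeffOne i j (φ (tmul 1 (hw lam))) = hw mu) : φ ≠ 0 := by
  rintro rfl
  rw [LinearMap.zero_apply, map_zero] at h
  exact hw_ne_zero mu h.symm

/-! ### Singular vectors of degree one -/

/-- Translation by `p` reduces to permutations fixing `0` and `1`, of which there are six. The lemma
extracts one prescribed component of a two-form from the singularity sum. -/
theorem sum_sign_smul_fix_two {N : Type*} [AddCommGroup N] [Module ℂ N]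
    (Y : Fin 5 → Fin 5 → Fin 5 → N) (p : Equiv.Perm (Fin 5)) :
    ∑ s : Equiv.Perm (Fin 5), ((Equiv.Perm.sign s : ℤ) : ℂ) •
      (if s 0 = p 0 ∧ s 1 = p 1 then Y (s 2) (s 3) (s 4) else 0) =
    ((Equiv.Perm.sign p : ℤ) : ℂ) • (Y (p 2) (p 3) (p 4) - Y (p 3) (p 2) (p 4) +
      Y (p 3) (p 4) (p 2) - Y (p 4) (p 3) (p 2) + Y (p 4) (p 2) (p 3) - Y (p 2) (p 4) (p 3)) := by
  have base : ∀ Y : Fin 5 → Fin 5 → Fin 5 → N, ∑ s : Equiv.Perm (Fin 5),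
      (if s 0 = 0 ∧ s 1 = 1 then ((Equiv.Perm.sign s : ℤ) : ℂ) • Y (s 2) (s 3) (s 4) else 0) =
      Y 2 3 4 - Y 3 2 4 + Y 3 4 2 - Y 4 3 2 + Y 4 2 3 - Y 2 4 3 := by
    intro Y
    rw [← Finset.sum_filter]
    have key : ((Finset.univ.filter fun s : Equiv.Perm (Fin 5) => s 0 = 0 ∧ s 1 = 1).val.map
        fun s => (s 2, s 3, s 4, (Equiv.Perm.sign s : ℤ))) =
        ([(2, 3, 4, 1), (3, 2, 4, -1), (3, 4, 2, 1), (4, 3, 2, -1), (4, 2, 3, 1), (2, 4, 3, -1)] :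
          List (Fin 5 × Fin 5 × Fin 5 × ℤ)) := by
      decide +kernel
    have h := congrArg (fun m => (m.map fun k : Fin 5 × Fin 5 × Fin 5 × ℤ =>
      (k.2.2.2 : ℂ) • Y k.1 k.2.1 k.2.2.1).sum) key
    simp only [Multiset.map_map, Multiset.map_coe, Multiset.sum_coe, List.map_cons, List.map_nil,
      List.sum_cons, List.sum_nil] at h
    refine Eq.trans h ?_
    push_cast
    simp only [one_smul, neg_smul]
    abel
  rw [← base fun i j k => Y (p i) (p j) (p k), Finset.smul_sum]
  refine (Fintype.sum_equiv (Equiv.mulLeft p) _ _ fun s => ?_).symm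
  simp only [Equiv.coe_mulLeft, Equiv.Perm.mul_apply, Equiv.Perm.sign_mul,
    EmbeddingLike.apply_eq_iff_eq]
  split_ifs
  · rw [smul_smul]
    push_cast
    rfl
  · rw [smul_zero, smul_zero]

/-- The closed two-form `x_a d_{bc} + x_b d_{ac}`. -/
def linForm (a b c : Fin 5) : Odd :=
  ⟨fun k l => MvPowerSeries.X a * (d b c).1 k l + MvPowerSeries.X b * (d a c).1 k l, by
    refine ⟨fun k l => ?_, fun i k l => ?_⟩
    · beta_reduce
      rw [odd_swap (d b c) k l, odd_swap (d a c) k l]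
      ring
    · have e : ∀ (i k l a b c : Fin 5), pd i (MvPowerSeries.X a * (d b c).1 k l) =
          (if i = a then 1 else 0) * ((if k = b then 1 else 0) * (if l = c then 1 else 0) -
            (if l = b then 1 else 0) * (if k = c then 1 else 0)) := by
        intro i k l a b c
        have h : (d b c).1 k l = MvPowerSeries.C ((if b = k ∧ c = l then 1 else 0) -
          (if b = l ∧ c = k then 1 else 0)) := rfl
        rw [h, Derivation.leibniz, pd, MvPowerSeries.pderiv_C, smul_zero, zero_add,
          MvPowerSeries.pderiv_X, smul_eq_mul, mul_comm, Pi.single_apply]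
        simp only [ite_and, eq_comm (a := b), eq_comm (a := c), eq_comm (a := a)]
        congr 1
        split_ifs <;> simp
      simp only [map_add, e]
      ring⟩

theorem linForm_mem (a b c : Fin 5) : od (linForm a b c) ∈ nonneg := by
  rw [mem_nonneg_od]
  intro k l
  change MvPowerSeries.constantCoeff (MvPowerSeries.X a * (d b c).1 k l +
    MvPowerSeries.X b * (d a c).1 k l) = 0
  simp

theorem oddCoeff_linForm (a b c p k l : Fin 5) : oddCoeff (linForm a b c) p k l =
    (if p = a then ((if k = b ∧ l = c then 1 else 0) - (if k = c ∧ l = b then 1 else 0)) else 0) +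
    (if p = b then ((if k = a ∧ l = c then 1 else 0) - (if k = c ∧ l = a then 1 else 0)) else 0) := by
  have e : ∀ (a b c : Fin 5), MvPowerSeries.constantCoeff (pd p (MvPowerSeries.X a * (d b c).1 k l)) =
      if p = a then ((if k = b ∧ l = c then 1 else 0) - (if k = c ∧ l = b then 1 else 0) : ℂ)
      else 0 := by
    intro a b c
    rw [Derivation.leibniz, map_add, smul_eq_mul, smul_eq_mul, map_mul, map_mul,
      MvPowerSeries.constantCoeff_X, zero_mul, zero_add, constantCoeff_d, pd,
      MvPowerSeries.pderiv_X, Pi.single_apply]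
    simp only [eq_comm (a := b), eq_comm (a := c), eq_comm (a := a), and_comm]
    split_ifs <;> simp
  change MvPowerSeries.constantCoeff (pd p (MvPowerSeries.X a * (d b c).1 k l +
    MvPowerSeries.X b * (d a c).1 k l)) = _
  rw [map_add, map_add, e, e]

/-- The relation that the closed two-form `x_a d_{bc} + x_b d_{ac}` imposes on singular vectors. -/
theorem OddSingular.actE_eq {mu : Fin 4 → ℕ} {w : Fin 5 → Fin 5 → F mu}
    (hw : ∀ i j, w i j = - w j i) (h : OddSingular (degOne w)) {a b d e : Fin 5} (hab : a ≠ b)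
    (had : a ≠ d) (hae : a ≠ e) (hbd : b ≠ d) (hbe : b ≠ e) (hde : d ≠ e) :
    actE a a (w d e : Poly) + actE a d (w e a : Poly) + actE a e (w a d : Poly) =
    actE b b (w d e : Poly) + actE b d (w e b : Poly) + actE b e (w b d : Poly) := by
  obtain ⟨c, hca, hcb, hcd, hce⟩ : ∃ c : Fin 5, c ≠ a ∧ c ≠ b ∧ c ≠ d ∧ c ≠ e := by
    clear hab had hae hbd hbe hde h hw w
    revert a b d e
    decide
  -- The four nonzero linear coefficients of the form prescribe `(s 0, s 1)` as `(b, c)`, `(c, b)`,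
  -- `(a, c)`, `(c, a)`; these are the first two values of `p` and of its products with the
  -- transpositions below.
  obtain ⟨p, hp⟩ : ∃ p : Equiv.Perm (Fin 5), ∀ i, p i = ![b, c, d, e, a] i := by
    have hinj : Function.Injective ![b, c, d, e, a] := by
      intro i j hij
      fin_cases i <;> fin_cases j <;> simp_all
    exact ⟨Equiv.ofBijective _ (Finite.injective_iff_bijective.mp hinj), fun i => rfl⟩
  have h1 := (oddSingular_degOne_iff hw).mp h _ (linForm_mem a b c)
  have e1 : ∀ s : Equiv.Perm (Fin 5), ∑ k, oddCoeff (linForm a b c) k (s 0) (s 1) •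
      actE k (s 4) (w (s 2) (s 3) : Poly) =
      (if s 0 = b ∧ s 1 = c then actE a (s 4) (w (s 2) (s 3) : Poly) else 0) -
      (if s 0 = c ∧ s 1 = b then actE a (s 4) (w (s 2) (s 3) : Poly) else 0) +
      ((if s 0 = a ∧ s 1 = c then actE b (s 4) (w (s 2) (s 3) : Poly) else 0) -
      (if s 0 = c ∧ s 1 = a then actE b (s 4) (w (s 2) (s 3) : Poly) else 0)) := by
    intro s
    simp only [oddCoeff_linForm, add_smul, Finset.sum_add_distrib, ite_smul, zero_smul,
      Finset.sum_ite_eq', Finset.mem_univ, if_true, sub_smul, one_smul]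
  simp only [e1, smul_add, smul_sub, Finset.sum_add_distrib, Finset.sum_sub_distrib] at h1
  have hp0 : p 0 = b := hp 0
  have hp1 : p 1 = c := hp 1
  have hp2 : p 2 = d := hp 2
  have hp3 : p 3 = e := hp 3
  have hp4 : p 4 = a := hp 4
  have t1 := sum_sign_smul_fix_two (fun i j k => actE a k (w i j : Poly)) p
  have t2 := sum_sign_smul_fix_two (fun i j k => actE a k (w i j : Poly)) (p * Equiv.swap 0 1)
  have t3 := sum_sign_smul_fix_two (fun i j k => actE b k (w i j : Poly)) (p * Equiv.swap 0 4)
  have t4 := sum_sign_smul_fix_two (fun i j k => actE b k (w i j : Poly))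
    (p * Equiv.swap 0 4 * Equiv.swap 0 1)
  have g1 : Equiv.swap (0 : Fin 5) 1 0 = 1 ∧ Equiv.swap (0 : Fin 5) 1 1 = 0 ∧
      Equiv.swap (0 : Fin 5) 1 2 = 2 ∧ Equiv.swap (0 : Fin 5) 1 3 = 3 ∧
      Equiv.swap (0 : Fin 5) 1 4 = 4 := by decide
  have g2 : Equiv.swap (0 : Fin 5) 4 0 = 4 ∧ Equiv.swap (0 : Fin 5) 4 1 = 1 ∧
      Equiv.swap (0 : Fin 5) 4 2 = 2 ∧ Equiv.swap (0 : Fin 5) 4 3 = 3 ∧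
      Equiv.swap (0 : Fin 5) 4 4 = 0 := by decide
  have s1 : Equiv.Perm.sign (Equiv.swap (0 : Fin 5) 1) = -1 := by decide
  have s2 : Equiv.Perm.sign (Equiv.swap (0 : Fin 5) 4) = -1 := by decide
  simp only [Equiv.Perm.mul_apply, Equiv.Perm.sign_mul, g1, g2, s1, s2, hp0, hp1, hp2, hp3, hp4,
    mul_neg, mul_one, neg_neg] at t1 t2 t3 t4
  rw [t1, t2, t3, t4] at h1
  have hsw : ∀ x y i j, actE x y (w i j : Poly) = - actE x y (w j i : Poly) := by
    intro x y i j
    rw [hw i j, LieSubmodule.coe_neg, map_neg]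
  rw [hsw a a e d, hsw a d a e, hsw a e d a, hsw b b e d, hsw b d b e, hsw b e d b] at h1
  push_cast at h1
  simp only [neg_smul, sub_neg_eq_add] at h1
  have hs : ((Equiv.Perm.sign p : ℤ) : ℂ) ≠ 0 := by
    exact_mod_cast (Equiv.Perm.sign p).ne_zero
  -- The factor `4` comes from antisymmetry of the two-form in `s 0, s 1` and of `w` in `s 2, s 3`.
  have h2 : ((Equiv.Perm.sign p : ℤ) : ℂ) • (4 : ℂ) •
    ((actE a a (w d e : Poly) + actE a d (w e a : Poly) + actE a e (w a d : Poly)) -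
    (actE b b (w d e : Poly) + actE b d (w e b : Poly) + actE b e (w b d : Poly))) = 0 := by
    rw [← h1]
    module
  exact sub_eq_zero.mp (((smul_eq_zero.mp ((smul_eq_zero.mp h2).resolve_left hs))).resolve_left
    (by norm_num))

theorem tensorAct_swap {V : Type*} [AddCommGroup V] [Module ℂ V] [LieRingModule sl5 V]
    [LieModule ℂ sl5 V] {w : Fin 5 → Fin 5 → V} (hw : ∀ i j, w i j = - w j i) (A : sl5)
    (i j : Fin 5) : tensorAct A w i j = - tensorAct A w j i := by
  rw [tensorAct, tensorAct, hw i j, lie_neg, neg_add, ← Finset.sum_neg_distrib]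
  refine congrArg₂ _ rfl (Finset.sum_congr rfl fun m _ => ?_)
  rw [hw m j, hw i m, smul_neg, smul_neg, neg_add, add_comm]

section singular

variable {lam mu : Fin 4 → ℕ} {φ : M lam →ₗ[U] M mu} {w : Fin 5 → Fin 5 → F mu}

theorem oddSingular_of_morphism (h : φ (tmul 1 (hw lam)) = degOne w) : OddSingular (degOne w) := by
  intro ω hω
  rw [← h, ← map_smul, smul_tmul, mul_one]
  have e := tmul_mul_toU 1 hω (hw lam)
  rw [one_mul] at e
  have h0 : linPart (od ω).1 = 0 := by
    ext i j
    change (linPart 0).1 i j = 0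
    rw [linPart_apply]
    simp
  have hz : (tmul 1 (0 : F lam) : M lam) = 0 := map_zero (tmulL 1)
  rw [e, h0, zero_lie, hz, map_zero]

/-- A morphism commutes with `L_0`, and injectivity of `degOne` on antisymmetric families allows
comparison coefficient by coefficient. -/
theorem tensorAct_of_morphism (hanti : ∀ i j, w i j = - w j i)
    (h : φ (tmul 1 (hw lam)) = degOne w) (A : sl5) (c : ℂ)
    (hA : act A.1 (hwPoly lam) = c • hwPoly lam) (i j : Fin 5) :
    tensorAct A w i j = c • w i j := by
  have hA' : ⁅A, hw lam⁆ = c • hw lam := Subtype.ext hA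
  have hc : ∀ (V : Type) [AddCommGroup V] [Module ℂ V] [LieRingModule sl5 V] [LieModule ℂ sl5 V]
      (z : Verma V), c • z = (algebraMap ℂ U c) • z := fun V _ _ _ _ z => (algebraMap_smul U c z).symm
  have e : degOne (tensorAct A w) = degOne (c • w) := by
    have e1 := toU_ev_smul_degOne (matField_mem A) w
    rw [linPart_matField, ← h, ← map_smul, toU_matField_smul, hA'] at e1
    rw [← e1, map_smul, ← h, ← tmulL_apply, map_smul, hc, map_smul, ← hc, tmulL_apply]
  have := degOne_injective (w := tensorAct A w - c • w) (fun i j => by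
    simp only [Pi.sub_apply, Pi.smul_apply]
    rw [tensorAct_swap hanti, hanti i j, smul_neg]
    abel) (by rw [map_sub, e, sub_self])
  exact sub_eq_zero.mp (congrFun (congrFun this i) j)

/-- The total vector is annihilated by raising operators, so `E_{ij}` with `i < j` turns a
coefficient into one with an index `i` replaced by the larger `j`. This is what makes a leading
coefficient meaningful. -/
theorem raising_of_morphism (hanti : ∀ i j, w i j = - w j i)
    (h : φ (tmul 1 (hw lam)) = degOne w) {i j : Fin 5} (hij : i < j) (k l : Fin 5) :
    actE i j (w k l : Poly) =
      -((if i = k then (w j l : Poly) else 0) + (if i = l then (w k j : Poly) else 0)) := by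
  have e := tensorAct_of_morphism hanti h (slE i j hij.ne) 0
    (by rw [zero_smul]; exact actE_hwPoly lam hij) k l
  have e' := congrArg Subtype.val e
  simp only [tensorAct, LieSubmodule.coe_add, AddSubmonoidClass.coe_finsetSum,
    LieSubmodule.coe_smul, zero_smul, LieSubmodule.coe_zero] at e'
  have hm : ∀ a b, (slE i j hij.ne).1 a b = if i = a ∧ j = b then 1 else 0 := fun a b =>
    Matrix.single_apply ..
  simp only [hm, ite_and, ite_smul, one_smul, zero_smul, Finset.sum_add_distrib,
    Finset.sum_ite_irrel, Finset.sum_ite_eq, Finset.mem_univ, if_true, Finset.sum_const_zero] at e'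
  exact eq_neg_of_add_eq_zero_left e'

theorem weight_of_morphism (hanti : ∀ i j, w i j = - w j i)
    (h : φ (tmul 1 (hw lam)) = degOne w) (i j k l : Fin 5) :
    actE i i (w k l : Poly) - actE j j (w k l : Poly) =
      ((wt lam i - wt lam j - (if i = k then 1 else 0) - (if i = l then 1 else 0) +
        (if j = k then 1 else 0) + (if j = l then 1 else 0) : ℤ) : ℂ) • (w k l : Poly) := by
  have e := tensorAct_of_morphism hanti h (slH i j) (wt lam i - wt lam j)
    (by rw [act_slH, actE_self_hwPoly, actE_self_hwPoly, sub_smul]) k l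
  have e' := congrArg Subtype.val e
  simp only [tensorAct, LieSubmodule.coe_add, AddSubmonoidClass.coe_finsetSum,
    LieSubmodule.coe_smul] at e'
  have hm : ∀ a b, (slH i j).1 a b = (if i = a ∧ i = b then 1 else 0) -
      (if j = a ∧ j = b then 1 else 0) := fun a b => by
    change (Matrix.single i i (1 : ℂ) - Matrix.single j j 1 : Matrix (Fin 5) (Fin 5) ℂ) a b = _
    rw [Matrix.sub_apply, Matrix.single_apply, Matrix.single_apply]
  have hb : ((⁅slH i j, w k l⁆ : F mu) : Poly) =
      actE i i (w k l : Poly) - actE j j (w k l : Poly) := act_slH i j _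
  rw [hb] at e'
  simp only [hm, ite_and, ite_smul, one_smul, zero_smul, sub_smul, Finset.sum_add_distrib,
    Finset.sum_sub_distrib, Finset.sum_ite_irrel, Finset.sum_ite_eq, Finset.mem_univ, if_true,
    Finset.sum_const_zero] at e'
  push_cast
  have r : ∀ (P : Prop) [Decidable P] (x : Poly), (if P then (1 : ℂ) else 0) • x =
      if P then x else 0 := fun P _ x => by split_ifs <;> simp
  have r1 : ∀ a, (if a = k then (w a l : Poly) else 0) = if a = k then (w k l : Poly) else 0 :=
    fun a => by split_ifs with ha <;> simp [ha]
  have r2 : ∀ a, (if a = l then (w k a : Poly) else 0) = if a = l then (w k l : Poly) else 0 :=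
    fun a => by split_ifs with ha <;> simp [ha]
  rw [r1, r1, r2, r2] at e'
  simp only [add_smul, sub_smul, r]
  linear_combination (exp := 1) e'

/-- The leading coefficient of a nonzero singular vector of degree one is a highest weight vector. -/
theorem exists_leading (hanti : ∀ i j, w i j = - w j i) (h : φ (tmul 1 (hw lam)) = degOne w)
    (hφ : φ ≠ 0) : ∃ (d e : Fin 5) (c : ℂ), d < e ∧ c ≠ 0 ∧ w d e = c • hw mu ∧
      ∀ k l : Fin 5, (d : ℕ) + e < k + l → w k l = 0 := by
  have hw0 : ∃ p : Fin 5 × Fin 5, w p.1 p.2 ≠ 0 := by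
    by_contra! hall
    apply hφ
    refine F_hom_ext ?_
    have : w = 0 := funext fun i => funext fun j => hall (i, j)
    rw [h, this, map_zero, LinearMap.zero_apply]
  classical
  obtain ⟨p, hp, hmax⟩ := (Finset.univ.filter fun p : Fin 5 × Fin 5 => w p.1 p.2 ≠ 0).exists_max_image
    (fun p => (p.1 : ℕ) + p.2) ⟨hw0.choose, by simpa using hw0.choose_spec⟩
  simp only [Finset.mem_filter, Finset.mem_univ, true_and] at hp hmax
  have hz : ∀ k l : Fin 5, (p.1 : ℕ) + p.2 < k + l → w k l = 0 := by
    intro k l hkl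
    by_contra hne
    exact absurd (hmax (k, l) hne) (not_le.mpr hkl)
  obtain ⟨d, e, hde, hne, hz⟩ : ∃ d e : Fin 5, d < e ∧ w d e ≠ 0 ∧
      ∀ k l : Fin 5, (d : ℕ) + e < k + l → w k l = 0 := by
    rcases lt_trichotomy p.1 p.2 with hlt | heq | hgt
    · exact ⟨p.1, p.2, hlt, hp, hz⟩
    · exfalso
      apply hp
      have := hanti p.1 p.1
      rw [← heq]
      rw [eq_neg_iff_add_eq_zero, ← two_smul ℂ] at this
      exact (smul_eq_zero.mp this).resolve_left two_ne_zero
    · refine ⟨p.2, p.1, hgt, fun h0 => hp ?_, fun k l hkl => hz k l (by omega)⟩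
      rw [hanti, h0, neg_zero]
  -- Raising `w d e` yields only coefficients with larger index sum, and these vanish by maximality.
  obtain ⟨c, hc⟩ := exists_eq_smul_hwPoly (w d e).2 fun i j hij => by
    rw [raising_of_morphism hanti h hij]
    have h1 : i = d → w j e = 0 := fun hid => hz j e (by subst hid; omega)
    have h2 : i = e → w d j = 0 := fun hie => hz d j (by subst hie; omega)
    split_ifs with hd he he
    · rw [h1 hd, h2 he]; simp
    · rw [h1 hd]; simp
    · rw [h2 he]; simp
    · simp
  refine ⟨d, e, c, hde, ?_, Subtype.ext hc, hz⟩
  rintro rfl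
  exact hne (Subtype.ext (by rw [hc, zero_smul]; rfl))

/-- The possible weights of morphisms of degree one, and the position of the leading coefficient. -/
theorem classify (hanti : ∀ i j, w i j = - w j i) (h : φ (tmul 1 (hw lam)) = degOne w)
    (hφ : φ ≠ 0) : ∃ (m n : ℕ) (d e : Fin 5) (c : ℂ), c ≠ 0 ∧ w d e = c • hw mu ∧
      ((d = 0 ∧ e = 1 ∧ lam = ![m, n + 1, 0, 0] ∧ mu = ![m, n, 0, 0]) ∨
        (d = 0 ∧ e = 4 ∧ lam = ![m + 1, 0, 0, n] ∧ mu = ![m, 0, 0, n + 1]) ∨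
        (d = 3 ∧ e = 4 ∧ lam = ![0, 0, m, n] ∧ mu = ![0, 0, m + 1, n])) := by
  obtain ⟨d, e, c, hde, hc, hwde, hz⟩ := exists_leading hanti h hφ
  have hP : (w d e : Poly) = c • hwPoly mu := congrArg Subtype.val hwde
  have hne : (w d e : Poly) ≠ 0 := by
    rw [hP]
    exact smul_ne_zero hc (hwPoly_ne_zero mu)
  have hE : ∀ a, actE a a (w d e : Poly) = ((wt mu a : ℤ) : ℂ) • (w d e : Poly) := by
    intro a
    rw [hP, Derivation.map_smul, actE_self_hwPoly, smul_comm]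
  have hwt : ∀ i j : Fin 5, wt mu i - wt mu j = wt lam i - wt lam j - (if i = d then 1 else 0) -
      (if i = e then 1 else 0) + (if j = d then 1 else 0) + (if j = e then 1 else 0) := by
    intro i j
    have e1 := weight_of_morphism hanti h i j d e
    rw [hE, hE, ← sub_smul] at e1
    exact_mod_cast smul_left_injective ℂ hne e1
  -- In the relation from `x_a d_{bc} + x_b d_{ac}`, the term `E_{ad} w_{ea}` equals `w_{de}` if `a
  -- < d`, by the raising formula, and vanishes if `a > d`, because `w_{ea}` lies beyond the leading
  -- position; likewise with `e`. Only eigenvalues and indicators remain.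
  have hsing : ∀ a b : Fin 5, a ≠ b → a ≠ d → a ≠ e → b ≠ d → b ≠ e →
      wt mu a + (if a < d then 1 else 0) + (if a < e then 1 else 0) =
      wt mu b + (if b < d then 1 else 0) + (if b < e then 1 else 0) := by
    intro a b hab had hae hbd hbe
    have e1 := (oddSingular_of_morphism h).actE_eq hanti hab had hae hbd hbe hde.ne
    have side : ∀ a : Fin 5, a ≠ d → a ≠ e →
        actE a a (w d e : Poly) + actE a d (w e a : Poly) + actE a e (w a d : Poly) =
        ((wt mu a + (if a < d then 1 else 0) + (if a < e then 1 else 0) : ℤ) : ℂ) •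
          (w d e : Poly) := by
      intro a had hae
      have x1 : actE a d (w e a : Poly) = (if a < d then 1 else 0 : ℂ) • (w d e : Poly) := by
        split_ifs with hlt
        · rw [raising_of_morphism hanti h hlt, if_neg hae, if_pos rfl, hanti e d]
          simp
        · rw [hz e a (by omega)]
          simp
      have x2 : actE a e (w a d : Poly) = (if a < e then 1 else 0 : ℂ) • (w d e : Poly) := by
        split_ifs with hlt
        · rw [raising_of_morphism hanti h hlt, if_neg had, if_pos rfl, hanti e d]
          simp
        · rw [hz a d (by omega)]
          simp
      rw [hE, x1, x2, ← add_smul, ← add_smul]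
      push_cast
      rfl
    rw [side a had hae, side b hbd hbe] at e1
    exact_mod_cast smul_left_injective ℂ hne e1
  have hext : ∀ (f : Fin 4 → ℕ) (x y z t : ℕ), f 0 = x → f 1 = y → f 2 = z → f 3 = t →
      f = ![x, y, z, t] := by
    rintro f _ _ _ _ rfl rfl rfl rfl
    funext i
    fin_cases i <;> rfl
  have hcases : (d = 0 ∧ e = 1) ∨ (d = 0 ∧ e = 4) ∨ (d = 3 ∧ e = 4) ∨ (d = 0 ∧ e = 2) ∨
      (d = 0 ∧ e = 3) ∨ (d = 1 ∧ e = 2) ∨ (d = 1 ∧ e = 3) ∨ (d = 1 ∧ e = 4) ∨ (d = 2 ∧ e = 3) ∨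
      (d = 2 ∧ e = 4) := by omega
  rcases hcases with ⟨rfl, rfl⟩ | ⟨rfl, rfl⟩ | ⟨rfl, rfl⟩ | ⟨rfl, rfl⟩ | ⟨rfl, rfl⟩ | ⟨rfl, rfl⟩ |
    ⟨rfl, rfl⟩ | ⟨rfl, rfl⟩ | ⟨rfl, rfl⟩ | ⟨rfl, rfl⟩
  -- In the first three cases the complement of `{d, e}` is an interval. Equality of the weights of
  -- `μ` on it kills two coordinates of `μ`, and the weight comparison then gives `λ`.
  · have s1 := hsing 2 3 (by decide) (by decide) (by decide) (by decide) (by decide)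
    have s2 := hsing 3 4 (by decide) (by decide) (by decide) (by decide) (by decide)
    have w0 := hwt 0 1
    have w1 := hwt 1 2
    have w2 := hwt 2 3
    have w3 := hwt 3 4
    simp [wt] at s1 s2 w0 w1 w2 w3
    refine ⟨mu 0, mu 1, 0, 1, c, hc, hwde, Or.inl ⟨rfl, rfl, hext _ _ _ _ _ ?_ ?_ ?_ ?_,
      hext _ _ _ _ _ ?_ ?_ ?_ ?_⟩⟩ <;> omega
  · have s1 := hsing 1 2 (by decide) (by decide) (by decide) (by decide) (by decide)
    have s2 := hsing 2 3 (by decide) (by decide) (by decide) (by decide) (by decide)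
    have w0 := hwt 0 1
    have w1 := hwt 1 2
    have w2 := hwt 2 3
    have w3 := hwt 3 4
    simp [wt] at s1 s2 w0 w1 w2 w3
    refine ⟨mu 0, lam 3, 0, 4, c, hc, hwde, Or.inr (Or.inl ⟨rfl, rfl, hext _ _ _ _ _ ?_ ?_ ?_ ?_,
      hext _ _ _ _ _ ?_ ?_ ?_ ?_⟩)⟩ <;> omega
  · have s1 := hsing 0 1 (by decide) (by decide) (by decide) (by decide) (by decide)
    have s2 := hsing 1 2 (by decide) (by decide) (by decide) (by decide) (by decide)
    have w0 := hwt 0 1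
    have w1 := hwt 1 2
    have w2 := hwt 2 3
    have w3 := hwt 3 4
    simp [wt] at s1 s2 w0 w1 w2 w3
    refine ⟨lam 2, mu 3, 3, 4, c, hc, hwde, Or.inr (Or.inr ⟨rfl, rfl, hext _ _ _ _ _ ?_ ?_ ?_ ?_,
      hext _ _ _ _ _ ?_ ?_ ?_ ?_⟩)⟩ <;> omega
  -- In each remaining case the chosen `a < b` are separated by `d` or `e`: the indicators are
  -- strictly larger at `a`, while the weight of `μ` is at least as large there as at `b`.
  · have s1 := hsing 1 3 (by decide) (by decide) (by decide) (by decide) (by decide)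
    simp [wt] at s1
    all_goals omega
  · have s1 := hsing 1 4 (by decide) (by decide) (by decide) (by decide) (by decide)
    simp [wt] at s1
    all_goals omega
  · have s1 := hsing 0 3 (by decide) (by decide) (by decide) (by decide) (by decide)
    simp [wt] at s1
    all_goals omega
  · have s1 := hsing 0 2 (by decide) (by decide) (by decide) (by decide) (by decide)
    simp [wt] at s1
    all_goals omega
  · have s1 := hsing 0 2 (by decide) (by decide) (by decide) (by decide) (by decide)
    simp [wt] at s1
    all_goals omega
  · have s1 := hsing 0 4 (by decide) (by decide) (by decide) (by decide) (by decide)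
    simp [wt] at s1
    all_goals omega
  · have s1 := hsing 0 3 (by decide) (by decide) (by decide) (by decide) (by decide)
    simp [wt] at s1
    all_goals omega

end singular

/-! ### Proportionality to the three families -/

theorem coeffOne_degOne_antisymm {mu : Fin 4 → ℕ} {w : Fin 5 → Fin 5 → F mu}
    (hanti : ∀ i j, w i j = - w j i) (i j : Fin 5) :
    coeffOne i j (degOne w) = (2 : ℂ) • w i j := by
  rw [coeffOne_degOne, hanti j i, sub_neg_eq_add, two_smul]

/-- The morphisms `∇_A`, `∇_B` and `∇_C` between given modules, together with the position of their
leading coefficient. -/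
def IsNablaAt (d e : Fin 5) (m n : ℕ) {lam mu : Fin 4 → ℕ} (φ : M lam →ₗ[U] M mu) : Prop :=
  (d = 0 ∧ e = 1 ∧ IsNablaA m n φ) ∨ (d = 0 ∧ e = 4 ∧ IsNablaB m n φ) ∨
    (d = 3 ∧ e = 4 ∧ IsNablaC m n φ)

theorem IsNablaAt.coeffOne_hw {d e : Fin 5} {m n : ℕ} {lam mu : Fin 4 → ℕ} {φ : M lam →ₗ[U] M mu}
    (h : IsNablaAt d e m n φ) : coeffOne d e (φ (tmul 1 (hw lam))) = hw mu := by
  rcases h with ⟨rfl, rfl, h⟩ | ⟨rfl, rfl, h⟩ | ⟨rfl, rfl, h⟩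
  exacts [h.coeffOne_hw, h.coeffOne_hw, h.coeffOne_hw]

theorem IsNablaAt.hasDegree {d e : Fin 5} {m n : ℕ} {lam mu : Fin 4 → ℕ} {φ : M lam →ₗ[U] M mu}
    (h : IsNablaAt d e m n φ) : HasDegree 1 φ := by
  rcases h with ⟨_, _, h⟩ | ⟨_, _, h⟩ | ⟨_, _, h⟩
  exacts [h.hasDegree, h.hasDegree, h.hasDegree]

theorem exists_isNablaAt {lam mu : Fin 4 → ℕ} {m n : ℕ} {d e : Fin 5}
    (h : (d = 0 ∧ e = 1 ∧ lam = ![m, n + 1, 0, 0] ∧ mu = ![m, n, 0, 0]) ∨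
        (d = 0 ∧ e = 4 ∧ lam = ![m + 1, 0, 0, n] ∧ mu = ![m, 0, 0, n + 1]) ∨
        (d = 3 ∧ e = 4 ∧ lam = ![0, 0, m, n] ∧ mu = ![0, 0, m + 1, n])) :
    ∃ ψ : M lam →ₗ[U] M mu, IsNablaAt d e m n ψ := by
  rcases h with ⟨hd, he, rfl, rfl⟩ | ⟨hd, he, rfl, rfl⟩ | ⟨hd, he, rfl, rfl⟩
  · obtain ⟨ψ, _, h⟩ := exists_nablaA m n
    exact ⟨ψ, Or.inl ⟨hd, he, h⟩⟩
  · obtain ⟨ψ, _, h⟩ := exists_nablaB m n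
    exact ⟨ψ, Or.inr (Or.inl ⟨hd, he, h⟩)⟩
  · obtain ⟨ψ, _, h⟩ := exists_nablaC m n
    exact ⟨ψ, Or.inr (Or.inr ⟨hd, he, h⟩)⟩

/-- Every nonzero morphism of degree one is proportional to one of `∇_A`, `∇_B`, `∇_C`. -/
theorem exists_eq_smul_nabla {lam mu : Fin 4 → ℕ} {φ : M lam →ₗ[U] M mu} (hφ : φ ≠ 0)
    (hdeg : HasDegree 1 φ) : ∃ (m n : ℕ) (d e : Fin 5) (ψ : M lam →ₗ[U] M mu) (c : ℂ),
      IsNablaAt d e m n ψ ∧ φ = c • ψ := by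
  obtain ⟨w, hanti, hw⟩ := hdeg.exists_antisymm (hw lam)
  obtain ⟨m, n, d, e, c, -, hc, hcase⟩ := classify hanti hw hφ
  obtain ⟨ψ, hψ⟩ := exists_isNablaAt hcase
  obtain ⟨v, hvanti, hv⟩ := hψ.hasDegree.exists_antisymm (E510.hw lam)
  have hvde : (2 : ℂ) • v d e = E510.hw mu := by
    rw [← coeffOne_degOne_antisymm hvanti, ← hv, hψ.coeffOne_hw]
  -- The coefficient `v d e` is half the highest weight vector, whereas `w d e` is `c` times it;
  -- hence the scalar `2 * c`.
  refine ⟨m, n, d, e, ψ, 2 * c, hψ, ?_⟩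
  rw [← sub_eq_zero]
  by_contra hne
  obtain ⟨m', n', d', e', c', hc', hcde, hcase'⟩ := classify (w := w - (2 * c) • v)
    (φ := φ - (2 * c) • ψ) (fun i j => by
      simp only [Pi.sub_apply, Pi.smul_apply]
      rw [hanti i j, hvanti i j, smul_neg]
      abel) (by
      rw [LinearMap.sub_apply, LinearMap.smul_apply, hw, hv, map_sub, map_smul]) hne
  -- The pair `(λ, μ)` determines the family, so a nonzero difference would again have its leading
  -- coefficient at `(d, e)`, where it vanishes by the choice of scalar.
  have hde : d' = d ∧ e' = e := by
    have val : ∀ (f : Fin 4 → ℕ) (x y z t : ℕ), f = ![x, y, z, t] →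
        f 0 = x ∧ f 1 = y ∧ f 2 = z ∧ f 3 = t := by
      rintro _ x y z t rfl
      exact ⟨rfl, rfl, rfl, rfl⟩
    rcases hcase with ⟨rfl, rfl, h1, h2⟩ | ⟨rfl, rfl, h1, h2⟩ | ⟨rfl, rfl, h1, h2⟩ <;>
    rcases hcase' with ⟨rfl, rfl, h3, h4⟩ | ⟨rfl, rfl, h3, h4⟩ | ⟨rfl, rfl, h3, h4⟩
    all_goals
      replace h1 := val _ _ _ _ _ h1
      replace h2 := val _ _ _ _ _ h2
      replace h3 := val _ _ _ _ _ h3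
      replace h4 := val _ _ _ _ _ h4
      first
        | exact ⟨rfl, rfl⟩
        | exfalso; omega
  obtain ⟨rfl, rfl⟩ := hde
  have hzero : (w - (2 * c) • v) d' e' = 0 := by
    simp only [Pi.sub_apply, Pi.smul_apply]
    rw [hc, mul_comm, mul_smul, hvde, sub_self]
  rw [hzero] at hcde
  exact smul_ne_zero hc' (hw_ne_zero mu) hcde.symm

end

end E510

theorem mainTheorem3 :
    (∀ m n : ℕ,
      (∃! φ : E510.M ![m, n + 1, 0, 0] →ₗ[E510.U] E510.M ![m, n, 0, 0],
        E510.IsNablaA m n φ) ∧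
      (∃! φ : E510.M ![m + 1, 0, 0, n] →ₗ[E510.U] E510.M ![m, 0, 0, n + 1],
        E510.IsNablaB m n φ) ∧
      (∃! φ : E510.M ![0, 0, m, n] →ₗ[E510.U] E510.M ![0, 0, m + 1, n],
        E510.IsNablaC m n φ)) ∧
    (∀ (lam mu : Fin 4 → ℕ) (φ : E510.M lam →ₗ[E510.U] E510.M mu) (m n : ℕ),
      E510.IsNablaA m n φ ∨ E510.IsNablaB m n φ ∨ E510.IsNablaC m n φ →
        φ ≠ 0 ∧ E510.HasDegree 1 φ) ∧
    (∀ (lam mu : Fin 4 → ℕ) (φ : E510.M lam →ₗ[E510.U] E510.M mu),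
      φ ≠ 0 → E510.HasDegree 1 φ →
        ∃ (m n : ℕ) (ψ : E510.M lam →ₗ[E510.U] E510.M mu) (c : ℂ),
          (E510.IsNablaA m n ψ ∨ E510.IsNablaB m n ψ ∨ E510.IsNablaC m n ψ) ∧
          ∀ x : E510.M lam, φ x = c • ψ x) := by
  refine ⟨fun m n => ⟨E510.existsUnique_nablaA m n, E510.existsUnique_nablaB m n,
    E510.existsUnique_nablaC m n⟩, fun lam mu φ m n h => ?_, fun lam mu φ hφ hdeg => ?_⟩
  · rcases h with h | h | h
    · exact ⟨E510.ne_zero_of_coeffOne_hw h.coeffOne_hw, h.hasDegree⟩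
    · exact ⟨E510.ne_zero_of_coeffOne_hw h.coeffOne_hw, h.hasDegree⟩
    · exact ⟨E510.ne_zero_of_coeffOne_hw h.coeffOne_hw, h.hasDegree⟩
  · obtain ⟨m, n, d, e, ψ, c, hψ, rfl⟩ := E510.exists_eq_smul_nabla hφ hdeg
    refine ⟨m, n, ψ, c, ?_, fun x => rfl⟩
    rcases hψ with ⟨_, _, h⟩ | ⟨_, _, h⟩ | ⟨_, _, h⟩
    exacts [Or.inl h, Or.inr (Or.inl h), Or.inr (Or.inr h)]
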